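/- Let $N\ge 3$ be an integer and $\alpha>-2$. For $\beta\in\mathbb R$ consider the radial initial value problem $$\Delta^2u=r^{\alpha}e^{u}\ \ (r=|x|>0,\ x\in\mathbb R^N),\qquad u'(0)=u'''(0)=0,\quad u(0)=0,\quad \Delta u(0)=\beta, \tag{P}$$ where $\Delta f=f''+\frac{N-1}{r}f'$. An entire solution of (P) is a function $u$ on $[0,\infty)$ which is $C^4$ on $(0,\infty)$, satisfies the equation for all $r>0$, and satisfies $u(0)=0$, $u'(0)=0$ and $\lim_{r\to0^+}\Delta u(r)=\beta$; the condition $u'''(0)=0$ is understood in the sense $\lim_{r\to 0^+}r^{N-1}(\Delta u)'(r)=0$, which also makes sense for $-2<\alpha\le -1$, where $u$ is less regular at the origin. Then there is a number $\beta_0<0$ such that (P) has an entire solution if and only if $\beta\le\beta_0$, and the entire solution $u=u_{\beta_0}$ of (P) with $\beta=\beta_0$ (the separatrix) has the following behaviour at infinity. (i) If $N=3$, there is $c>0$ such that, as $r\to\infty$, $$u(r)=a_1r+a_2+a_3r^{-1}+O(e^{-cr}),$$ where $$a_1=-\frac1{8\pi}\int_{\mathbb R^3}|x|^{\alpha}e^{u}\,dx,\qquad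 a_2=\frac1{8\pi}\int_{\mathbb R^3}|x|^{1+\alpha}e^{u}\,dx,\qquad a_3=-\frac1{24\pi}\int_{\mathbb R^3}|x|^{2+\alpha}e^{u}\,dx,$$ and these integrals converge. (ii) If $N=4$, then, the integral being absolutely convergent, $$\lim_{r\to\infty}\big[u(r)+(8+2\alpha)\ln r\big]=\frac1{8\pi^2}\int_{\mathbb R^4}e^{u}|x|^{\alpha}\ln|x|\,dx .$$ (iii) If $N\ge5$, then $$\lim_{r\to\infty}\big[u(r)+(4+\alpha)\ln r\big]=\ln\big[2(4+\alpha)(N-2)(N-4)\big].$$ -/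

import Mathlib

open Filter Topology MeasureTheory Asymptotics Set

/-- The Laplacian in `ℝ^N` of a radial function `x ↦ f |x|`, as a function of `r = |x| > 0`:
`Δf = f'' + (N - 1) / r * f'`. -/
noncomputable def radialLaplacian (N : ℕ) (f : ℝ → ℝ) (r : ℝ) : ℝ :=
  deriv (deriv f) r + ((N : ℝ) - 1) / r * deriv f r

/-- `u`, as a function of `r = |x| ∈ [0, ∞)`, is a global (entire) solution of the radial initial
value problem `Δ²u = |x|^α e^u`, `u'(0) = u'''(0) = 0`, `u(0) = 0`, `Δu(0) = β` in `ℝ^N`.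
The values of `u` on the negative half-line play no role.

For `-2 < α ≤ -1` a solution is not three times differentiable at the origin with `u'''(0) = 0`,
since `(Δu)'(r)` behaves like `r^(1 + α) / (N + α)` as `r → 0`; the condition `u'''(0) = 0` is
therefore expressed, for all `α`, by saying that the flux `r^(N-1) (Δu)'(r)` of `∇Δu` through
small spheres tends to `0`, i.e. that `Δ²u` has no point mass at the origin.  -/
structure IsEntireRadialSolution (N : ℕ) (α β : ℝ) (u : ℝ → ℝ) : Prop where
  contDiffOn : ContDiffOn ℝ 4 u (Ioi 0)
  equation : ∀ r : ℝ, 0 < r →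
    radialLaplacian N (radialLaplacian N u) r = r ^ α * Real.exp (u r)
  value_zero : u 0 = 0
  deriv_zero : HasDerivWithinAt u 0 (Ici 0) 0
  laplacian_zero : Tendsto (radialLaplacian N u) (𝓝[>] 0) (𝓝 β)
  flux_zero : Tendsto (fun r : ℝ => r ^ (N - 1) * deriv (radialLaplacian N u) r) (𝓝[>] 0) (𝓝 0)

/-!
The equation is treated as the first-order system for `u`, `w = Δu` and the fluxes
`q = r^d u'`, `m = r^d w'` (`d = N - 1`), or equivalently as the fixed point equation
`u = Δ⁻¹ (β + Δ⁻¹ (r^α e^u))`, where `Δ⁻¹ = invLaplacian d` is a positive operator.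

*The threshold.* If `Δu` is nonnegative somewhere, `u` blows up at a finite radius; hence an entire
solution has `Δu < 0` everywhere and is decreasing (`IsRadialSystem.w_neg`). Since `Δ⁻¹` is
monotone, the Picard iterates increase, and an entire solution exists exactly when they all stay
nonpositive (`exists_isEntireRadialSolution_iff`). A nonpositive supersolution suffices for this,
so the set of admissible `β` is nonempty and closed downwards; it is closed by dominated
convergence and consists of negative numbers, so it is `(-∞, β₀]` with `β₀ < 0`. If `Δu` tended to
a negative limit, `u` would decay like a Gaussian exponent and could be perturbed to a
supersolution for a larger `β` (`IsRadialSystem.exists_gt_mem_nonposIterates`). So `Δu → 0` at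
infinity for every solution with `β = β₀`, and only this is used below.

*Asymptotics.* From `Δu → 0` one gets `-Δu ≥ r^(1-d) m / (d-1)`.
For `N = 3` this makes `u` decay linearly, all moments of `e^u` are finite with exponentially small
tails, and the expansion is read off from the explicit radial Green kernel
(`IsRadialSystem.expansion_three`).
For `N ≥ 4` the variable `s = log r` turns the equation into an autonomous polynomial system
(`IsLogSystem`) for `a = r u'`, `b = r² Δu`, `c = r³ (Δu)'`, `e = r^(4+α) e^u`, in which `e` is
bounded (`IsRadialSystem.exists_rpow_mul_exp_le`).
For `N = 4` there is a conserved quantity, whose values at `s = ±∞` determine the total mass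
`lim c = 8 (4 + α)` (`IsLogSystem.tendsto_mass_four`); integrating the equation once more gives
the limit.
For `N ≥ 5` there is instead an energy whose derivative is a positive definite quadratic form in
the first two derivatives of `u + (4 + α) s`. The energy is monotone and bounded above, so its
derivative tends to zero, and by repeated use of "`f` converges and `f''` is bounded imply
`f' → 0`" so do all derivatives; the equation then gives the limit of `e`
(`IsLogSystem.tendsto_e`).
-/

/-! ### Calculus on the half-line -/

theorem monotoneOn_Ioi_of_hasDerivAt {a : ℝ} {f f' : ℝ → ℝ}
    (hf : ∀ r, a < r → HasDerivAt f (f' r) r) (h : ∀ r, a < r → 0 ≤ f' r) :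
    MonotoneOn f (Ioi a) := by
  refine monotoneOn_of_deriv_nonneg (convex_Ioi a)
    (fun r hr => (hf r hr).continuousAt.continuousWithinAt) ?_ ?_
  · rw [interior_Ioi]
    exact fun r hr => (hf r hr).differentiableAt.differentiableWithinAt
  · rw [interior_Ioi]
    exact fun r hr => by rw [(hf r hr).deriv]; exact h r hr

theorem monotoneOn_Ici_of_hasDerivAt {a : ℝ} {f f' : ℝ → ℝ}
    (hf : ∀ r, a ≤ r → HasDerivAt f (f' r) r) (h : ∀ r, a ≤ r → 0 ≤ f' r) :
    MonotoneOn f (Ici a) := by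
  refine monotoneOn_of_deriv_nonneg (convex_Ici a)
    (fun r hr => (hf r hr).continuousAt.continuousWithinAt) ?_ ?_
  · rw [interior_Ici]
    exact fun r hr => (hf r (le_of_lt hr)).differentiableAt.differentiableWithinAt
  · rw [interior_Ici]
    exact fun r hr => by rw [(hf r (le_of_lt hr)).deriv]; exact h r (le_of_lt hr)

theorem strictMonoOn_Ioi_of_hasDerivAt {a : ℝ} {f f' : ℝ → ℝ}
    (hf : ∀ r, a < r → HasDerivAt f (f' r) r) (h : ∀ r, a < r → 0 < f' r) :
    StrictMonoOn f (Ioi a) := by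
  refine strictMonoOn_of_deriv_pos (convex_Ioi a)
    (fun r hr => (hf r hr).continuousAt.continuousWithinAt) ?_
  rw [interior_Ioi]
  exact fun r hr => by rw [(hf r hr).deriv]; exact h r hr

theorem MonotoneOn.le_of_tendsto_nhdsGT {a L : ℝ} {f : ℝ → ℝ} (hf : MonotoneOn f (Ioi a))
    (hL : Tendsto f (𝓝[>] a) (𝓝 L)) {r : ℝ} (hr : a < r) : L ≤ f r := by
  refine le_of_tendsto hL ?_
  filter_upwards [Ioo_mem_nhdsGT hr] with s hs
  exact hf hs.1 hr hs.2.le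

theorem eq_of_hasDerivAt_eq_of_tendsto {f g f' : ℝ → ℝ} {L : ℝ}
    (hf : ∀ r, 0 < r → HasDerivAt f (f' r) r) (hg : ∀ r, 0 < r → HasDerivAt g (f' r) r)
    (hfL : Tendsto f (𝓝[>] 0) (𝓝 L)) (hgL : Tendsto g (𝓝[>] 0) (𝓝 L)) {r : ℝ} (hr : 0 < r) :
    f r = g r := by
  have h1 : MonotoneOn (fun s => f s - g s) (Ioi 0) :=
    monotoneOn_Ioi_of_hasDerivAt (fun s hs => (hf s hs).sub (hg s hs)) (by simp)
  have h2 : MonotoneOn (fun s => g s - f s) (Ioi 0) :=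
    monotoneOn_Ioi_of_hasDerivAt (fun s hs => (hg s hs).sub (hf s hs)) (by simp)
  have h3 := h1.le_of_tendsto_nhdsGT (hfL.sub hgL) hr
  have h4 := h2.le_of_tendsto_nhdsGT (hgL.sub hfL) hr
  simp only [sub_self] at h3 h4
  linarith

/-! ### The inverse of the radial Laplacian -/

/-- Right-hand sides to which the inverse radial Laplacian is applied: measurable functions on
the half-line which are `O(t ^ γ)` on every bounded interval `(0, R]`. Only measurability is
required, since limits of iterates are inserted before their continuity is known. -/
structure IsRadialSource (γ : ℝ) (g : ℝ → ℝ) : Prop where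
  aestronglyMeasurable : AEStronglyMeasurable g (volume.restrict (Ioi 0))
  bound : ∀ R : ℝ, ∃ C : ℝ, ∀ t ∈ Ioc 0 R, |g t| ≤ C * t ^ γ

/-- The flux `∫₀^r t^d g(t) dt` through the sphere of radius `r` in `ℝ^(d+1)`, up to the measure
of the unit sphere. -/
noncomputable def radialFlux (d : ℕ) (g : ℝ → ℝ) (r : ℝ) : ℝ := ∫ t in (0 : ℝ)..r, t ^ d * g t

/-- The radial solution `f` of `Δf = g` in `ℝ^(d+1)` that is regular at the origin with
`f(0) = 0`. -/
noncomputable def invLaplacian (d : ℕ) (g : ℝ → ℝ) (r : ℝ) : ℝ :=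
  ∫ s in (0 : ℝ)..r, radialFlux d g s / s ^ d

namespace IsRadialSource

variable {d : ℕ} {γ : ℝ} {g h : ℝ → ℝ}

theorem of_continuousOn (hg : ContinuousOn g (Ioi 0))
    (hb : ∀ R : ℝ, ∃ C : ℝ, ∀ t ∈ Ioc 0 R, |g t| ≤ C * t ^ γ) : IsRadialSource γ g :=
  ⟨hg.aestronglyMeasurable measurableSet_Ioi, hb⟩

theorem exists_bound (hg : IsRadialSource γ g) (R : ℝ) :
    ∃ C : ℝ, 0 ≤ C ∧ ∀ t ∈ Ioc 0 R, |g t| ≤ C * t ^ γ := by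
  obtain ⟨C, hC⟩ := hg.bound R
  refine ⟨|C|, abs_nonneg _, fun t ht => (hC t ht).trans ?_⟩
  exact mul_le_mul_of_nonneg_right (le_abs_self C) (Real.rpow_nonneg ht.1.le _)

theorem abs_pow_mul_le {C R : ℝ} (hC : ∀ t ∈ Ioc 0 R, |g t| ≤ C * t ^ γ) {t : ℝ}
    (ht : t ∈ Ioc 0 R) : |t ^ d * g t| ≤ C * t ^ ((d : ℝ) + γ) := by
  have ht0 : (0 : ℝ) < t := ht.1
  rw [abs_mul, abs_of_pos (pow_pos ht0 d), Real.rpow_add ht0, Real.rpow_natCast]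
  have := mul_le_mul_of_nonneg_left (hC t ht) (pow_pos ht0 d).le
  linarith

theorem aesm_Ioc (hg : IsRadialSource γ g) (r : ℝ) (hr : 0 ≤ r) :
    AEStronglyMeasurable (fun t => t ^ d * g t) (volume.restrict (uIoc 0 r)) := by
  rw [uIoc_of_le hr]
  exact (by fun_prop : Continuous fun t : ℝ => t ^ d).aestronglyMeasurable.mul
    (hg.aestronglyMeasurable.mono_measure (Measure.restrict_mono Ioc_subset_Ioi_self le_rfl))

theorem intervalIntegrable (hd : 2 ≤ d) (hγ : -2 < γ) (hg : IsRadialSource γ g) {r : ℝ}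
    (hr : 0 ≤ r) : IntervalIntegrable (fun t => t ^ d * g t) volume 0 r := by
  have hd' : (2 : ℝ) ≤ d := by exact_mod_cast hd
  obtain ⟨C, hC0, hC⟩ := hg.exists_bound r
  have hi : IntervalIntegrable (fun t : ℝ => C * t ^ ((d : ℝ) + γ)) volume 0 r :=
    (intervalIntegral.intervalIntegrable_rpow' (by linarith)).const_mul C
  refine hi.mono_fun' (hg.aesm_Ioc r hr) ?_
  rw [uIoc_of_le hr]
  filter_upwards [self_mem_ae_restrict measurableSet_Ioc] with t ht
  exact abs_pow_mul_le hC ht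

theorem abs_radialFlux_le (hd : 2 ≤ d) (hγ : -2 < γ) {C R : ℝ} (hC0 : 0 ≤ C)
    (hC : ∀ t ∈ Ioc 0 R, |g t| ≤ C * t ^ γ) {r : ℝ} (hr : r ∈ Ioc 0 R) :
    |radialFlux d g r| ≤ C * r ^ ((d : ℝ) + γ + 1) := by
  have hd' : (2 : ℝ) ≤ d := by exact_mod_cast hd
  have hi : IntervalIntegrable (fun t : ℝ => C * t ^ ((d : ℝ) + γ)) volume 0 r :=
    (intervalIntegral.intervalIntegrable_rpow' (by linarith)).const_mul C
  have h1 := intervalIntegral.norm_integral_le_of_norm_le (μ := volume) hr.1.le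
    (f := fun t => t ^ d * g t)
    (Eventually.of_forall fun t ht => abs_pow_mul_le hC ⟨ht.1, ht.2.trans hr.2⟩) hi
  rw [intervalIntegral.integral_const_mul, integral_rpow (Or.inl (by linarith)),
    Real.zero_rpow (by linarith), sub_zero] at h1
  refine h1.trans (mul_le_mul_of_nonneg_left ?_ hC0)
  exact div_le_self (Real.rpow_nonneg hr.1.le _) (by linarith)

theorem abs_radialFlux_div_le (hd : 2 ≤ d) (hγ : -2 < γ) {C R : ℝ} (hC0 : 0 ≤ C)
    (hC : ∀ t ∈ Ioc 0 R, |g t| ≤ C * t ^ γ) {r : ℝ} (hr : r ∈ Ioc 0 R) :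
    |radialFlux d g r / r ^ d| ≤ C * r ^ (γ + 1) := by
  have h := abs_radialFlux_le hd hγ hC0 hC hr
  rw [abs_div, abs_of_pos (pow_pos hr.1 d), div_le_iff₀ (pow_pos hr.1 d)]
  refine h.trans (le_of_eq ?_)
  rw [add_assoc, Real.rpow_add hr.1, Real.rpow_natCast]
  ring

theorem continuousAt_radialFlux (hd : 2 ≤ d) (hγ : -2 < γ) (hg : IsRadialSource γ g) {r : ℝ}
    (hr : 0 < r) : ContinuousAt (radialFlux d g) r := by
  have h := intervalIntegral.continuousOn_primitive_interval'
    (hg.intervalIntegrable hd hγ (by linarith : 0 ≤ r + 1)) left_mem_uIcc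
  rw [uIcc_of_le (by linarith)] at h
  exact h.continuousAt (Icc_mem_nhds hr (by linarith))

theorem continuousAt_radialFlux_div (hd : 2 ≤ d) (hγ : -2 < γ) (hg : IsRadialSource γ g) {r : ℝ}
    (hr : 0 < r) : ContinuousAt (fun r => radialFlux d g r / r ^ d) r :=
  (hg.continuousAt_radialFlux hd hγ hr).div (by fun_prop) (pow_pos hr d).ne'

theorem continuousOn_radialFlux_div (hd : 2 ≤ d) (hγ : -2 < γ) (hg : IsRadialSource γ g) :
    ContinuousOn (fun r => radialFlux d g r / r ^ d) (Ioi 0) := fun _ hr =>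
  (hg.continuousAt_radialFlux_div hd hγ hr).continuousWithinAt

theorem intervalIntegrable_radialFlux_div (hd : 2 ≤ d) (hγ : -2 < γ) (hg : IsRadialSource γ g)
    {r : ℝ} (hr : 0 ≤ r) :
    IntervalIntegrable (fun s => radialFlux d g s / s ^ d) volume 0 r := by
  obtain ⟨C, hC0, hC⟩ := hg.exists_bound r
  have hi : IntervalIntegrable (fun t : ℝ => C * t ^ (γ + 1)) volume 0 r :=
    (intervalIntegral.intervalIntegrable_rpow' (by linarith)).const_mul C
  rw [← uIoc_of_le hr] at hC
  refine hi.mono_fun' ?_ ?_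
  · rw [uIoc_of_le hr]
    exact ((hg.continuousOn_radialFlux_div hd hγ).mono Ioc_subset_Ioi_self).aestronglyMeasurable
      measurableSet_Ioc
  · rw [uIoc_of_le hr] at hC ⊢
    filter_upwards [self_mem_ae_restrict measurableSet_Ioc] with t ht
    exact abs_radialFlux_div_le hd hγ hC0 hC ht

theorem hasDerivAt_invLaplacian (hd : 2 ≤ d) (hγ : -2 < γ) (hg : IsRadialSource γ g) {r : ℝ}
    (hr : 0 < r) : HasDerivAt (invLaplacian d g) (radialFlux d g r / r ^ d) r :=
  intervalIntegral.integral_hasDerivAt_right (hg.intervalIntegrable_radialFlux_div hd hγ hr.le)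
    ((hg.continuousOn_radialFlux_div hd hγ).stronglyMeasurableAtFilter isOpen_Ioi r hr)
    (hg.continuousAt_radialFlux_div hd hγ hr)

theorem hasDerivAt_radialFlux (hd : 2 ≤ d) (hγ : -2 < γ) (hg : IsRadialSource γ g)
    (hgc : ContinuousOn g (Ioi 0)) {r : ℝ} (hr : 0 < r) :
    HasDerivAt (radialFlux d g) (r ^ d * g r) r := by
  have hc : ContinuousOn (fun t => t ^ d * g t) (Ioi 0) := by fun_prop
  exact intervalIntegral.integral_hasDerivAt_right (hg.intervalIntegrable hd hγ hr.le)
    (hc.stronglyMeasurableAtFilter isOpen_Ioi r hr) (hc.continuousAt (Ioi_mem_nhds hr))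

theorem tendsto_radialFlux_zero (hd : 2 ≤ d) (hγ : -2 < γ) (hg : IsRadialSource γ g) :
    Tendsto (radialFlux d g) (𝓝[>] 0) (𝓝 0) := by
  have h := intervalIntegral.continuousOn_primitive_interval'
    (hg.intervalIntegrable hd hγ zero_le_one) left_mem_uIcc
  rw [uIcc_of_le zero_le_one] at h
  have h0 := (h 0 ⟨le_rfl, zero_le_one⟩).mono_left (nhdsWithin_mono 0 Ioo_subset_Icc_self)
  rw [nhdsWithin_Ioo_eq_nhdsGT zero_lt_one] at h0
  simp only [intervalIntegral.integral_same] at h0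
  exact h0

theorem tendsto_invLaplacian_zero (hd : 2 ≤ d) (hγ : -2 < γ) (hg : IsRadialSource γ g) :
    Tendsto (invLaplacian d g) (𝓝[>] 0) (𝓝 0) := by
  have h := intervalIntegral.continuousOn_primitive_interval'
    (hg.intervalIntegrable_radialFlux_div hd hγ zero_le_one) left_mem_uIcc
  rw [uIcc_of_le zero_le_one] at h
  have h0 := (h 0 ⟨le_rfl, zero_le_one⟩).mono_left (nhdsWithin_mono 0 Ioo_subset_Icc_self)
  rw [nhdsWithin_Ioo_eq_nhdsGT zero_lt_one] at h0
  simp only [intervalIntegral.integral_same] at h0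
  exact h0

theorem continuousOn_invLaplacian (hd : 2 ≤ d) (hγ : -2 < γ) (hg : IsRadialSource γ g) :
    ContinuousOn (invLaplacian d g) (Ioi 0) := fun _ hr =>
  (hg.hasDerivAt_invLaplacian hd hγ hr).continuousAt.continuousWithinAt

theorem radialFlux_mono (hd : 2 ≤ d) (hγ : -2 < γ) (hg : IsRadialSource γ g)
    (hh : IsRadialSource γ h) {r : ℝ} (hr : 0 < r) (hgh : ∀ t ∈ Ioo 0 r, g t ≤ h t) :
    radialFlux d g r ≤ radialFlux d h r :=
  intervalIntegral.integral_mono_on_of_le_Ioo hr.le (hg.intervalIntegrable hd hγ hr.le)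
    (hh.intervalIntegrable hd hγ hr.le) fun t ht =>
      mul_le_mul_of_nonneg_left (hgh t ht) (pow_pos ht.1 d).le

theorem invLaplacian_mono (hd : 2 ≤ d) (hγ : -2 < γ) (hg : IsRadialSource γ g)
    (hh : IsRadialSource γ h) {r : ℝ} (hr : 0 < r) (hgh : ∀ t ∈ Ioo 0 r, g t ≤ h t) :
    invLaplacian d g r ≤ invLaplacian d h r :=
  intervalIntegral.integral_mono_on_of_le_Ioo hr.le
    (hg.intervalIntegrable_radialFlux_div hd hγ hr.le)
    (hh.intervalIntegrable_radialFlux_div hd hγ hr.le) fun _ ht =>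
      div_le_div_of_nonneg_right
        (hg.radialFlux_mono hd hγ hh ht.1 fun t hts => hgh t ⟨hts.1, hts.2.trans ht.2⟩)
        (pow_pos ht.1 d).le

theorem radialFlux_const_mul (c r : ℝ) :
    radialFlux d (fun t => c * g t) r = c * radialFlux d g r := by
  rw [radialFlux, radialFlux, ← intervalIntegral.integral_const_mul]
  exact intervalIntegral.integral_congr fun t _ => by ring

theorem invLaplacian_const_mul (c r : ℝ) :
    invLaplacian d (fun t => c * g t) r = c * invLaplacian d g r := by
  rw [invLaplacian, invLaplacian, ← intervalIntegral.integral_const_mul]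
  exact intervalIntegral.integral_congr fun t _ => by
    simp only [radialFlux_const_mul, mul_div_assoc]

theorem invLaplacian_add (hd : 2 ≤ d) (hγ : -2 < γ) (hg : IsRadialSource γ g)
    (hh : IsRadialSource γ h) {r : ℝ} (hr : 0 ≤ r) :
    invLaplacian d (fun t => g t + h t) r = invLaplacian d g r + invLaplacian d h r := by
  rw [invLaplacian, invLaplacian, invLaplacian, ← intervalIntegral.integral_add
    (hg.intervalIntegrable_radialFlux_div hd hγ hr)
    (hh.intervalIntegrable_radialFlux_div hd hγ hr)]
  refine intervalIntegral.integral_congr fun s hs => ?_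
  rw [uIcc_of_le hr] at hs
  simp only [radialFlux, mul_add]
  rw [intervalIntegral.integral_add (hg.intervalIntegrable hd hγ hs.1)
    (hh.intervalIntegrable hd hγ hs.1), add_div]

theorem invLaplacian_const (c : ℝ) {r : ℝ} (hr : 0 ≤ r) :
    invLaplacian d (fun _ => c) r = c * r ^ 2 / (2 * (d + 1)) := by
  have h1 : ∀ s ∈ uIcc 0 r, radialFlux d (fun _ => c) s / s ^ d = c / (d + 1) * s := by
    intro s hs
    rw [uIcc_of_le hr] at hs
    rw [radialFlux, intervalIntegral.integral_mul_const, integral_pow]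
    rcases hs.1.eq_or_lt with h0 | h0
    · rw [← h0]; simp
    · have : (d : ℝ) + 1 ≠ 0 := by positivity
      rw [zero_pow (by omega), sub_zero]
      field_simp
      ring
  rw [invLaplacian, intervalIntegral.integral_congr h1, intervalIntegral.integral_const_mul,
    integral_id]
  have : (d : ℝ) + 1 ≠ 0 := by positivity
  field_simp
  ring

theorem radialFlux_nonneg (hg : ∀ t, 0 < t → 0 ≤ g t) {r : ℝ} (hr : 0 < r) :
    0 ≤ radialFlux d g r := by
  rw [radialFlux, intervalIntegral.integral_of_le hr.le]
  exact setIntegral_nonneg measurableSet_Ioc fun t ht => mul_nonneg (pow_pos ht.1 d).le (hg t ht.1)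

/-- The inverse Laplacian commutes with dominated pointwise limits. -/
theorem tendsto_invLaplacian {G : ℕ → ℝ → ℝ} (hd : 2 ≤ d) (hγ : -2 < γ)
    (hG : ∀ n, AEStronglyMeasurable (G n) (volume.restrict (Ioi 0)))
    (hb : ∀ R : ℝ, ∃ C : ℝ, 0 ≤ C ∧ ∀ n, ∀ t ∈ Ioc 0 R, |G n t| ≤ C * t ^ γ)
    (hlim : ∀ t, 0 < t → Tendsto (fun n => G n t) atTop (𝓝 (g t))) {r : ℝ} (hr : 0 < r) :
    Tendsto (fun n => invLaplacian d (G n) r) atTop (𝓝 (invLaplacian d g r)) := by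
  have hd' : (2 : ℝ) ≤ d := by exact_mod_cast hd
  obtain ⟨C, hC0, hC⟩ := hb r
  have hGs : ∀ n, IsRadialSource γ (G n) := fun n =>
    ⟨hG n, fun R => let ⟨C, _, hC⟩ := hb R; ⟨C, hC n⟩⟩
  have hflux : ∀ s ∈ Ioc 0 r,
      Tendsto (fun n => radialFlux d (G n) s) atTop (𝓝 (radialFlux d g s)) := by
    intro s hs
    refine intervalIntegral.tendsto_integral_filter_of_dominated_convergence
      (fun t => C * t ^ ((d : ℝ) + γ)) (Eventually.of_forall fun n => (hGs n).aesm_Ioc s hs.1.le)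
      ?_ ((intervalIntegral.intervalIntegrable_rpow' (by linarith)).const_mul C) ?_
    · refine Eventually.of_forall fun n => Eventually.of_forall fun t ht => ?_
      rw [uIoc_of_le hs.1.le] at ht
      exact abs_pow_mul_le (hC n) ⟨ht.1, ht.2.trans hs.2⟩
    · refine Eventually.of_forall fun t ht => ?_
      rw [uIoc_of_le hs.1.le] at ht
      exact (hlim t ht.1).const_mul _
  refine intervalIntegral.tendsto_integral_filter_of_dominated_convergence
    (fun t => C * t ^ (γ + 1)) (Eventually.of_forall fun n => ?_)
    ?_ ((intervalIntegral.intervalIntegrable_rpow' (by linarith)).const_mul C) ?_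
  · have := ((hGs n).intervalIntegrable_radialFlux_div hd hγ hr.le).aestronglyMeasurable
    rwa [uIoc_of_le hr.le]
  · refine Eventually.of_forall fun n => Eventually.of_forall fun t ht => ?_
    rw [uIoc_of_le hr.le] at ht
    exact abs_radialFlux_div_le hd hγ hC0 (hC n) ht
  · refine Eventually.of_forall fun t ht => ?_
    rw [uIoc_of_le hr.le] at ht
    exact (hflux t ht).div_const _

/-- `Δ⁻¹ g` is bounded on bounded intervals. -/
theorem invLaplacian_source (hd : 2 ≤ d) (hγ : -2 < γ) (hg : IsRadialSource γ g) :
    IsRadialSource 0 (invLaplacian d g) := by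
  refine of_continuousOn (hg.continuousOn_invLaplacian hd hγ) fun R => ?_
  rcases le_or_gt R 0 with hR | hR
  · exact ⟨0, fun t ht => absurd (ht.1.trans_le ht.2) (not_lt.mpr hR)⟩
  have h := intervalIntegral.continuousOn_primitive_interval'
    (hg.intervalIntegrable_radialFlux_div hd hγ hR.le) left_mem_uIcc
  rw [uIcc_of_le hR.le] at h
  obtain ⟨C, hC⟩ := isCompact_Icc.exists_bound_of_continuousOn h
  exact ⟨C, fun t ht => by simpa [invLaplacian] using hC t ⟨ht.1.le, ht.2⟩⟩

theorem add (hg : IsRadialSource γ g) (hh : IsRadialSource γ h) :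
    IsRadialSource γ (fun t => g t + h t) := by
  refine ⟨hg.aestronglyMeasurable.add hh.aestronglyMeasurable, fun R => ?_⟩
  obtain ⟨C, hC⟩ := hg.bound R
  obtain ⟨D, hD⟩ := hh.bound R
  exact ⟨C + D, fun t ht => (abs_add_le _ _).trans (by linarith [hC t ht, hD t ht])⟩

theorem const_mul (hg : IsRadialSource γ g) (c : ℝ) : IsRadialSource γ (fun t => c * g t) := by
  refine ⟨hg.aestronglyMeasurable.const_mul c, fun R => ?_⟩
  obtain ⟨C, hC⟩ := hg.bound R
  refine ⟨|c| * C, fun t ht => ?_⟩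
  rw [abs_mul, mul_assoc]
  exact mul_le_mul_of_nonneg_left (hC t ht) (abs_nonneg c)

theorem const (c : ℝ) : IsRadialSource 0 (fun _ => c) :=
  of_continuousOn continuousOn_const fun _ => ⟨|c|, by simp⟩

theorem radialFlux_rpow {γ : ℝ} (hγ : -2 < γ) (hd : 2 ≤ d) {r : ℝ} (hr : 0 < r) :
    radialFlux d (fun t => t ^ γ) r = r ^ (d + γ + 1) / (d + γ + 1) := by
  have hd' : (2 : ℝ) ≤ d := by exact_mod_cast hd
  have h1 : radialFlux d (fun t => t ^ γ) r = ∫ t in (0 : ℝ)..r, t ^ ((d : ℝ) + γ) := by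
    refine intervalIntegral.integral_congr_ae (Eventually.of_forall fun t ht => ?_)
    rw [uIoc_of_le hr.le] at ht
    rw [Real.rpow_add ht.1, Real.rpow_natCast]
  rw [h1, integral_rpow (Or.inl (by linarith)), Real.zero_rpow (by linarith), sub_zero]

theorem rpow (γ : ℝ) : IsRadialSource γ fun t => t ^ γ :=
  ⟨(by fun_prop : Measurable fun t : ℝ => t ^ γ).aestronglyMeasurable, fun _ => ⟨1, fun t ht => by
    rw [one_mul, abs_of_nonneg (Real.rpow_nonneg ht.1.le _)]⟩⟩

/-- `r ↦ r ^ α e^v` is an admissible right-hand side as soon as `v` is measurable and locally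
bounded. -/
theorem rpow_mul_exp (α : ℝ) {v : ℝ → ℝ} (hv : IsRadialSource 0 v) :
    IsRadialSource α (fun t => t ^ α * Real.exp (v t)) := by
  refine ⟨((by fun_prop : Measurable fun t : ℝ => t ^ α).aestronglyMeasurable).mul
    (Real.continuous_exp.comp_aestronglyMeasurable hv.aestronglyMeasurable), fun R => ?_⟩
  obtain ⟨C, hC⟩ := hv.bound R
  refine ⟨Real.exp C, fun t ht => ?_⟩
  have h := hC t ht
  rw [Real.rpow_zero, mul_one] at h
  rw [abs_of_nonneg (mul_nonneg (Real.rpow_nonneg ht.1.le _) (Real.exp_pos _).le), mul_comm]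
  exact mul_le_mul_of_nonneg_right (Real.exp_le_exp.mpr ((le_abs_self _).trans h))
    (Real.rpow_nonneg ht.1.le _)

theorem invLaplacian_nonneg (hg : ∀ t, 0 < t → 0 ≤ g t) {r : ℝ} (hr : 0 < r) :
    0 ≤ invLaplacian d g r := by
  rw [invLaplacian, intervalIntegral.integral_of_le hr.le]
  exact setIntegral_nonneg measurableSet_Ioc fun t ht =>
    div_nonneg (radialFlux_nonneg hg ht.1) (pow_pos ht.1 d).le

theorem continuous_mul {k : ℝ → ℝ} (hg : IsRadialSource γ g) (hk : Continuous k) :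
    IsRadialSource γ (fun t => k t * g t) := by
  refine ⟨hk.aestronglyMeasurable.mul hg.aestronglyMeasurable, fun R => ?_⟩
  obtain ⟨C, hC⟩ := hg.bound R
  obtain ⟨D, hD⟩ := (isCompact_Icc (a := 0) (b := R)).exists_bound_of_continuousOn hk.continuousOn
  refine ⟨D * C, fun t ht => ?_⟩
  have h1 := hD t ⟨ht.1.le, ht.2⟩
  rw [abs_mul, mul_assoc]
  exact mul_le_mul h1 (hC t ht) (abs_nonneg _) ((norm_nonneg _).trans h1)

theorem mul_source (hg : IsRadialSource γ g) (hh : IsRadialSource 0 h) :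
    IsRadialSource γ (fun t => g t * h t) := by
  refine ⟨hg.aestronglyMeasurable.mul hh.aestronglyMeasurable, fun R => ?_⟩
  obtain ⟨C, hC0, hC⟩ := hg.exists_bound R
  obtain ⟨D, hD⟩ := hh.bound R
  refine ⟨C * D, fun t ht => ?_⟩
  have h2 := hD t ht
  rw [Real.rpow_zero, mul_one] at h2
  rw [abs_mul]
  calc |g t| * |h t| ≤ (C * t ^ γ) * D :=
        mul_le_mul (hC t ht) h2 (abs_nonneg _) (mul_nonneg hC0 (Real.rpow_nonneg ht.1.le _))
    _ = C * D * t ^ γ := by ring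

/-- A nonnegative source of finite total mass on the half-line has a bounded inverse Laplacian:
this is where the dimension `d + 1 ≥ 3` enters. -/
theorem exists_invLaplacian_le (hd : 2 ≤ d) (hγ : -2 < γ) (hg : IsRadialSource γ g)
    (hpos : ∀ t, 0 < t → 0 ≤ g t) (hint : IntegrableOn (fun t => t ^ d * g t) (Ioi 0)) :
    ∃ C : ℝ, ∀ r, 0 < r → invLaplacian d g r ≤ C := by
  set I := ∫ t in Ioi 0, t ^ d * g t
  have hfl : ∀ r, 0 < r → radialFlux d g r ≤ I := by
    intro r hr
    rw [radialFlux, intervalIntegral.integral_of_le hr.le]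
    refine setIntegral_mono_set hint ?_ (Ioc_subset_Ioi_self.eventuallyLE)
    filter_upwards [self_mem_ae_restrict measurableSet_Ioi] with t ht
    exact mul_nonneg (pow_pos ht d).le (hpos t ht)
  have hfl0 : ∀ r, 0 < r → 0 ≤ radialFlux d g r := fun r hr => radialFlux_nonneg hpos hr
  have hI : 0 ≤ I := (hfl0 1 one_pos).trans (hfl 1 one_pos)
  have h1 : MonotoneOn (invLaplacian d g) (Ioi 0) :=
    monotoneOn_Ioi_of_hasDerivAt (fun r hr => hg.hasDerivAt_invLaplacian hd hγ hr)
      fun r hr => div_nonneg (hfl0 r hr) (pow_pos hr d).le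
  have h2 : MonotoneOn (fun r => -I / r - invLaplacian d g r) (Ici 1) := by
    refine monotoneOn_Ici_of_hasDerivAt (f' := fun r => I / r ^ 2 - radialFlux d g r / r ^ d)
      (fun r hr => ?_) fun r hr => ?_
    · have hr0 : 0 < r := by linarith
      refine HasDerivAt.sub ?_ (hg.hasDerivAt_invLaplacian hd hγ hr0)
      have := (hasDerivAt_const r (-I)).fun_div (hasDerivAt_id' r) hr0.ne'
      simpa using this
    · have hr0 : 0 < r := by linarith
      have : radialFlux d g r / r ^ d ≤ I / r ^ 2 :=
        div_le_div₀ hI (hfl r hr0) (by positivity) (pow_le_pow_right₀ hr hd)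
      linarith
  refine ⟨invLaplacian d g 1 + I, fun r hr => ?_⟩
  rcases le_total r 1 with h | h
  · have := h1 hr (mem_Ioi.mpr one_pos) h
    linarith
  · have := h2 self_mem_Ici h h
    have h3 : 0 ≤ I / r := div_nonneg hI hr.le
    simp only [neg_div, div_one] at this
    linarith

end IsRadialSource

/-! ### The first-order system -/

theorem IsRadialSource.of_tendsto {f : ℝ → ℝ} {L : ℝ} (hf : ContinuousOn f (Ioi 0))
    (hL : Tendsto f (𝓝[>] 0) (𝓝 L)) : IsRadialSource 0 f := by
  refine IsRadialSource.of_continuousOn hf fun R => ?_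
  have h1 : ∀ᶠ t in 𝓝[>] (0 : ℝ), |f t| ≤ |L| + 1 := by
    filter_upwards [hL.abs.eventually_lt_const (by linarith : |L| < |L| + 1)] with t ht
    exact ht.le
  obtain ⟨δ, hδ0, hδ⟩ := (mem_nhdsGT_iff_exists_Ioo_subset).mp h1
  have hδ0 : 0 < δ := hδ0
  obtain ⟨C, hC⟩ := isCompact_Icc.exists_bound_of_continuousOn
    (hf.mono (fun t ht => lt_of_lt_of_le hδ0 ht.1 : Icc δ R ⊆ Ioi 0))
  refine ⟨max (|L| + 1) C, fun t ht => ?_⟩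
  rw [Real.rpow_zero, mul_one]
  rcases lt_or_ge t δ with h | h
  · exact (hδ ⟨ht.1, h⟩).trans (le_max_left _ _)
  · exact (hC t ⟨h, ht.2⟩).trans (le_max_right _ _)

/-- The equation `Δ²u = r^α e^u` in `ℝ^(d+1)` as a first-order system on the half-line, where
`w = Δu` and `q`, `m` are the fluxes of `∇u` and `∇Δu`, with the regular initial values at the
origin. -/
structure IsRadialSystem (d : ℕ) (α β : ℝ) (u w q m : ℝ → ℝ) : Prop where
  deriv_u : ∀ r, 0 < r → HasDerivAt u (q r / r ^ d) r
  deriv_q : ∀ r, 0 < r → HasDerivAt q (r ^ d * w r) r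
  deriv_w : ∀ r, 0 < r → HasDerivAt w (m r / r ^ d) r
  deriv_m : ∀ r, 0 < r → HasDerivAt m (r ^ d * (r ^ α * Real.exp (u r))) r
  tendsto_u : Tendsto u (𝓝[>] 0) (𝓝 0)
  tendsto_q : Tendsto q (𝓝[>] 0) (𝓝 0)
  tendsto_w : Tendsto w (𝓝[>] 0) (𝓝 β)
  tendsto_m : Tendsto m (𝓝[>] 0) (𝓝 0)

theorem hasDerivAt_pow_mul {d : ℕ} (hd : 1 ≤ d) {f : ℝ → ℝ} {f' r : ℝ} (hr : 0 < r)
    (hf : HasDerivAt f f' r) :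
    HasDerivAt (fun s => s ^ d * f s) (r ^ d * (f' + ((d + 1 : ℕ) - 1 : ℝ) / r * f r)) r := by
  refine ((hasDerivAt_pow d r).fun_mul hf).congr_deriv ?_
  obtain ⟨k, rfl⟩ : ∃ k, d = k + 1 := ⟨d - 1, by omega⟩
  push_cast
  field_simp
  ring

theorem radialLaplacian_eq {d : ℕ} (hd : 1 ≤ d) {f F w : ℝ → ℝ}
    (hf : ∀ r, 0 < r → HasDerivAt f (F r / r ^ d) r)
    (hF : ∀ r, 0 < r → HasDerivAt F (r ^ d * w r) r) {r : ℝ} (hr : 0 < r) :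
    radialLaplacian (d + 1) f r = w r := by
  have h1 : deriv f =ᶠ[𝓝 r] fun s => F s / s ^ d := by
    filter_upwards [Ioi_mem_nhds hr] with s hs using (hf s hs).deriv
  have h2 := (hF r hr).fun_div (hasDerivAt_pow d r) (pow_pos hr d).ne'
  rw [radialLaplacian, h1.deriv_eq, h1.eq_of_nhds, h2.deriv]
  obtain ⟨k, rfl⟩ : ∃ k, d = k + 1 := ⟨d - 1, by omega⟩
  push_cast
  field_simp
  ring

theorem contDiffOn_succ_Ioi {n : ℕ} {f f' : ℝ → ℝ} (hf : ∀ r, 0 < r → HasDerivAt f (f' r) r)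
    (hf' : ContDiffOn ℝ n f' (Ioi 0)) : ContDiffOn ℝ (n + 1 : ℕ) f (Ioi 0) := by
  push_cast
  refine (contDiffOn_succ_iff_deriv_of_isOpen isOpen_Ioi).mpr
    ⟨fun r hr => (hf r hr).differentiableAt.differentiableWithinAt, by simp, ?_⟩
  exact hf'.congr fun r hr => (hf r hr).deriv

theorem contDiffOn_pow_inv (d : ℕ) (n : WithTop ℕ∞) :
    ContDiffOn ℝ n (fun r : ℝ => (r ^ d)⁻¹) (Ioi 0) :=
  (contDiff_id.pow d).contDiffOn.inv fun _ hr => (pow_pos hr d).ne'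

namespace IsEntireRadialSolution

variable {d : ℕ} {α β : ℝ} {u : ℝ → ℝ}

theorem isRadialSystem (hd : 2 ≤ d) (h : IsEntireRadialSolution (d + 1) α β u) :
    IsRadialSystem d α β u (radialLaplacian (d + 1) u) (fun r => r ^ d * deriv u r)
      (fun r => r ^ d * deriv (radialLaplacian (d + 1) u) r) := by
  have hd1 : 1 ≤ d := by omega
  obtain ⟨hu, -, hu1⟩ := (contDiffOn_succ_iff_deriv_of_isOpen (n := 3) isOpen_Ioi).mp
    (h.contDiffOn.of_le (by norm_num))
  obtain ⟨hu1d, -, hu2⟩ := (contDiffOn_succ_iff_deriv_of_isOpen (n := 2) isOpen_Ioi).mp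
    (hu1.of_le (by norm_num))
  have hwc : ContDiffOn ℝ 2 (radialLaplacian (d + 1) u) (Ioi 0) := by
    unfold radialLaplacian
    refine hu2.add (ContDiffOn.mul (contDiffOn_const.div contDiffOn_id fun r hr => ?_)
      (hu1.of_le (by norm_num)))
    exact (mem_Ioi.mp hr).ne'
  obtain ⟨hw, -, hw1⟩ := (contDiffOn_succ_iff_deriv_of_isOpen (n := 1) isOpen_Ioi).mp
    (hwc.of_le (by norm_num))
  have hw1d : DifferentiableOn ℝ (deriv (radialLaplacian (d + 1) u)) (Ioi 0) :=
    hw1.differentiableOn (by norm_num)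
  have hu' : ∀ r, 0 < r → HasDerivAt u (deriv u r) r := fun r hr =>
    (hu.differentiableAt (Ioi_mem_nhds hr)).hasDerivAt
  have hq : ∀ r, 0 < r →
      HasDerivAt (fun r => r ^ d * deriv u r) (r ^ d * radialLaplacian (d + 1) u r) r :=
    fun r hr => hasDerivAt_pow_mul hd1 hr (hu1d.differentiableAt (Ioi_mem_nhds hr)).hasDerivAt
  have huc : ContinuousWithinAt u (Ici 0) 0 := h.deriv_zero.continuousWithinAt
  refine ⟨fun r hr => ?_, hq, fun r hr => ?_, fun r hr => ?_, ?_, ?_, h.laplacian_zero, ?_⟩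
  · rw [mul_div_cancel_left₀ _ (pow_pos hr d).ne']
    exact hu' r hr
  · rw [mul_div_cancel_left₀ _ (pow_pos hr d).ne']
    exact (hw.differentiableAt (Ioi_mem_nhds hr)).hasDerivAt
  · rw [← h.equation r hr]
    exact hasDerivAt_pow_mul hd1 hr (hw1d.differentiableAt (Ioi_mem_nhds hr)).hasDerivAt
  · have := huc.mono_left (nhdsWithin_mono 0 Ioi_subset_Ici_self)
    rwa [h.value_zero] at this
  · -- The flux `q` of `∇u` has a limit `L` at the origin; `L = 0` since the mean value theorem
    -- provides points arbitrarily close to the origin where `u'` is small.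
    have hws : IsRadialSource 0 (radialLaplacian (d + 1) u) :=
      IsRadialSource.of_tendsto hwc.continuousOn h.laplacian_zero
    set q : ℝ → ℝ := fun r => r ^ d * deriv u r with hqdef
    set L := q 1 - radialFlux d (radialLaplacian (d + 1) u) 1
    have hflux : ∀ r, 0 < r → HasDerivAt (radialFlux d (radialLaplacian (d + 1) u))
        (r ^ d * radialLaplacian (d + 1) u r) r := fun r hr =>
      hws.hasDerivAt_radialFlux hd (by norm_num) hwc.continuousOn hr
    have hconst : ∀ r, 0 < r → q r = radialFlux d (radialLaplacian (d + 1) u) r + L := by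
      intro r hr
      have h1 : MonotoneOn (fun s => q s - radialFlux d (radialLaplacian (d + 1) u) s) (Ioi 0) :=
        monotoneOn_Ioi_of_hasDerivAt (fun s hs => (hq s hs).sub (hflux s hs)) (by simp)
      have h2 : MonotoneOn (fun s => radialFlux d (radialLaplacian (d + 1) u) s - q s) (Ioi 0) :=
        monotoneOn_Ioi_of_hasDerivAt (fun s hs => (hflux s hs).sub (hq s hs)) (by simp)
      rcases le_total r 1 with hr1 | hr1
      · have e1 := h1 hr (mem_Ioi.mpr one_pos) hr1
        have e2 := h2 hr (mem_Ioi.mpr one_pos) hr1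
        simp only at e1 e2
        linarith
      · have e1 := h1 (mem_Ioi.mpr one_pos) hr hr1
        have e2 := h2 (mem_Ioi.mpr one_pos) hr hr1
        simp only at e1 e2
        linarith
    have hqL : Tendsto q (𝓝[>] 0) (𝓝 L) := by
      have h1 := (hws.tendsto_radialFlux_zero hd (by norm_num)).add_const L
      rw [zero_add] at h1
      refine h1.congr' ?_
      filter_upwards [self_mem_nhdsWithin] with r hr using (hconst r hr).symm
    have hmv : ∀ x : ℝ, ∃ c, 0 < x → c ∈ Ioo 0 x ∧ deriv u c = u x / x := by
      intro x
      by_cases hx : 0 < x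
      · have huc' : ContinuousOn u (Icc 0 x) := by
          intro t ht
          rcases ht.1.eq_or_lt with h0 | h0
          · rw [← h0]
            exact huc.mono Icc_subset_Ici_self
          · exact (hu' t h0).continuousAt.continuousWithinAt
        obtain ⟨c, hc, hc'⟩ := exists_hasDerivAt_eq_slope u (deriv u) hx huc'
          fun t ht => hu' t ht.1
        refine ⟨c, fun _ => ⟨hc, ?_⟩⟩
        rw [hc', h.value_zero, sub_zero, sub_zero]
      · exact ⟨0, fun h => absurd h hx⟩
    choose ξ hξ using hmv
    have hξ0 : Tendsto ξ (𝓝[>] 0) (𝓝[>] 0) := by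
      refine tendsto_nhdsWithin_iff.mpr ⟨?_, ?_⟩
      · refine squeeze_zero' (g := fun x => x) ?_ ?_ nhdsWithin_le_nhds
        · filter_upwards [self_mem_nhdsWithin] with x hx using (hξ x hx).1.1.le
        · filter_upwards [self_mem_nhdsWithin] with x hx using (hξ x hx).1.2.le
      · filter_upwards [self_mem_nhdsWithin] with x hx using (hξ x hx).1.1
    have hslope : Tendsto (fun x => u x / x) (𝓝[>] 0) (𝓝 0) := by
      have h1 := (hasDerivWithinAt_iff_tendsto_slope.mp h.deriv_zero)
      rw [show Ici (0 : ℝ) \ {0} = Ioi 0 from Ici_sdiff_left] at h1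
      refine h1.congr fun x => ?_
      rw [slope_def_field, h.value_zero, sub_zero, sub_zero]
    have hqξ : Tendsto (fun x => q (ξ x)) (𝓝[>] 0) (𝓝 0) := by
      have h1 : Tendsto (fun x => ξ x ^ d) (𝓝[>] 0) (𝓝 0) := by
        have := (tendsto_nhdsWithin_iff.mp hξ0).1.pow d
        rwa [zero_pow (by omega)] at this
      have h2 := h1.mul hslope
      rw [zero_mul] at h2
      refine h2.congr' ?_
      filter_upwards [self_mem_nhdsWithin] with x hx
      rw [hqdef]
      simp only
      rw [(hξ x hx).2]
    have hL0 : L = 0 := tendsto_nhds_unique (hqL.comp hξ0) hqξ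
    rwa [hL0] at hqL
  · exact h.flux_zero

end IsEntireRadialSolution

namespace IsRadialSystem

variable {d : ℕ} {α β : ℝ} {u w q m : ℝ → ℝ}

theorem continuousOn_u (h : IsRadialSystem d α β u w q m) : ContinuousOn u (Ioi 0) :=
  fun r hr => (h.deriv_u r hr).continuousAt.continuousWithinAt

theorem continuousOn_w (h : IsRadialSystem d α β u w q m) : ContinuousOn w (Ioi 0) :=
  fun r hr => (h.deriv_w r hr).continuousAt.continuousWithinAt

theorem source_u (h : IsRadialSystem d α β u w q m) : IsRadialSource 0 u :=
  IsRadialSource.of_tendsto h.continuousOn_u h.tendsto_u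

theorem source_w (h : IsRadialSystem d α β u w q m) : IsRadialSource 0 w :=
  IsRadialSource.of_tendsto h.continuousOn_w h.tendsto_w

theorem continuousOn_rpow_mul_exp (h : IsRadialSystem d α β u w q m) :
    ContinuousOn (fun t => t ^ α * Real.exp (u t)) (Ioi 0) := by
  refine ContinuousOn.mul (fun t ht => ?_) (Real.continuous_exp.comp_continuousOn h.continuousOn_u)
  exact (Real.continuousAt_rpow_const t α (Or.inl (mem_Ioi.mp ht).ne')).continuousWithinAt

theorem m_eq (hd : 2 ≤ d) (hα : -2 < α) (h : IsRadialSystem d α β u w q m) {r : ℝ} (hr : 0 < r) :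
    m r = radialFlux d (fun t => t ^ α * Real.exp (u t)) r :=
  eq_of_hasDerivAt_eq_of_tendsto h.deriv_m
    (fun _ hs => (h.source_u.rpow_mul_exp α).hasDerivAt_radialFlux hd hα
      h.continuousOn_rpow_mul_exp hs)
    h.tendsto_m ((h.source_u.rpow_mul_exp α).tendsto_radialFlux_zero hd hα) hr

theorem w_eq (hd : 2 ≤ d) (hα : -2 < α) (h : IsRadialSystem d α β u w q m) {r : ℝ} (hr : 0 < r) :
    w r = β + invLaplacian d (fun t => t ^ α * Real.exp (u t)) r := by
  refine eq_of_hasDerivAt_eq_of_tendsto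
    (g := fun s => β + invLaplacian d (fun t => t ^ α * Real.exp (u t)) s)
    h.deriv_w (fun s hs => ?_) h.tendsto_w ?_ hr
  · rw [h.m_eq hd hα hs]
    exact ((h.source_u.rpow_mul_exp α).hasDerivAt_invLaplacian hd hα hs).const_add β
  · simpa using ((h.source_u.rpow_mul_exp α).tendsto_invLaplacian_zero hd hα).const_add β

theorem q_eq (hd : 2 ≤ d) (h : IsRadialSystem d α β u w q m) {r : ℝ} (hr : 0 < r) :
    q r = radialFlux d w r :=
  eq_of_hasDerivAt_eq_of_tendsto h.deriv_q
    (fun _ hs => h.source_w.hasDerivAt_radialFlux hd (by norm_num) h.continuousOn_w hs)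
    h.tendsto_q (h.source_w.tendsto_radialFlux_zero hd (by norm_num)) hr

theorem u_eq (hd : 2 ≤ d) (h : IsRadialSystem d α β u w q m) {r : ℝ} (hr : 0 < r) :
    u r = invLaplacian d w r := by
  refine eq_of_hasDerivAt_eq_of_tendsto h.deriv_u (fun s hs => ?_) h.tendsto_u
    (h.source_w.tendsto_invLaplacian_zero hd (by norm_num)) hr
  rw [h.q_eq hd hs]
  exact h.source_w.hasDerivAt_invLaplacian hd (by norm_num) hs

/-- Conversely, the first component of a regular solution of the system is an entire solution. -/
theorem isEntireRadialSolution (hd : 2 ≤ d) (h : IsRadialSystem d α β u w q m) (h0 : u 0 = 0) :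
    IsEntireRadialSolution (d + 1) α β u := by
  have hd1 : 1 ≤ d := by omega
  have hdiv : ∀ {n : ℕ} {f : ℝ → ℝ}, ContDiffOn ℝ n f (Ioi 0) →
      ContDiffOn ℝ n (fun r => f r / r ^ d) (Ioi 0) := fun hf => by
    simp only [div_eq_mul_inv]
    exact hf.mul (contDiffOn_pow_inv d _)
  have hm1 : ContDiffOn ℝ (0 + 1 : ℕ) m (Ioi 0) := by
    refine contDiffOn_succ_Ioi h.deriv_m (contDiffOn_zero.mpr ?_)
    exact (continuous_pow d).continuousOn.mul h.continuousOn_rpow_mul_exp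
  have hw2 : ContDiffOn ℝ (1 + 1 : ℕ) w (Ioi 0) := contDiffOn_succ_Ioi h.deriv_w (hdiv hm1)
  have hq3 : ContDiffOn ℝ (2 + 1 : ℕ) q (Ioi 0) :=
    contDiffOn_succ_Ioi h.deriv_q ((contDiff_id.pow d).contDiffOn.mul hw2)
  have hu4 : ContDiffOn ℝ (3 + 1 : ℕ) u (Ioi 0) := contDiffOn_succ_Ioi h.deriv_u (hdiv hq3)
  have hlap : ∀ r, 0 < r → radialLaplacian (d + 1) u r = w r := fun r hr =>
    radialLaplacian_eq hd1 h.deriv_u h.deriv_q hr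
  have hlapw : ∀ r, 0 < r → radialLaplacian (d + 1) u =ᶠ[𝓝 r] w := fun r hr => by
    filter_upwards [Ioi_mem_nhds hr] with s hs using hlap s hs
  have hdl : ∀ r, 0 < r → deriv (radialLaplacian (d + 1) u) r = m r / r ^ d := fun r hr => by
    rw [(hlapw r hr).deriv_eq, (h.deriv_w r hr).deriv]
  refine ⟨hu4.of_le (by norm_num), fun r hr => ?_, h0, ?_, ?_, ?_⟩
  · rw [← radialLaplacian_eq hd1 h.deriv_w h.deriv_m hr]
    unfold radialLaplacian
    have h1 : deriv (radialLaplacian (d + 1) u) =ᶠ[𝓝 r] deriv w := (hlapw r hr).deriv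
    have h2 := h1.deriv_eq
    have h3 := h1.eq_of_nhds
    unfold radialLaplacian at h2 h3
    rw [h2, h3]
  · refine hasDerivWithinAt_Ici_of_tendsto_deriv (s := Ioi 0)
      (fun r hr => (h.deriv_u r hr).differentiableAt.differentiableWithinAt) ?_
      self_mem_nhdsWithin ?_
    · have := h.tendsto_u
      rw [ContinuousWithinAt, h0]
      exact this
    · obtain ⟨C, hC0, hC⟩ := h.source_w.exists_bound 1
      refine squeeze_zero_norm' (a := fun r => C * r) ?_ ?_
      · filter_upwards [Ioc_mem_nhdsGT one_pos] with r hr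
        rw [(h.deriv_u r hr.1).deriv, h.q_eq hd hr.1]
        have := IsRadialSource.abs_radialFlux_div_le hd (by norm_num) hC0 hC hr
        rwa [zero_add, Real.rpow_one] at this
      · have h1 : Tendsto (fun r : ℝ => C * r) (𝓝 0) (𝓝 (C * 0)) := tendsto_id.const_mul C
        rw [mul_zero] at h1
        exact h1.mono_left nhdsWithin_le_nhds
  · refine h.tendsto_w.congr' ?_
    filter_upwards [self_mem_nhdsWithin] with r hr using (hlap r hr).symm
  · refine h.tendsto_m.congr' ?_
    filter_upwards [self_mem_nhdsWithin] with r hr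
    rw [hdl r hr, Nat.add_sub_cancel, mul_div_cancel₀ _ (pow_pos hr d).ne']

/-- A locally bounded measurable fixed point of `u ↦ Δ⁻¹ (β + Δ⁻¹ (r ^ α e^u))` solves the
system. -/
theorem of_fixedPoint (hd : 2 ≤ d) (hα : -2 < α) (hu : IsRadialSource 0 u)
    (hfix : ∀ r, 0 < r →
      u r = invLaplacian d (fun s => β + invLaplacian d (fun t => t ^ α * Real.exp (u t)) s) r) :
    IsRadialSystem d α β u (fun s => β + invLaplacian d (fun t => t ^ α * Real.exp (u t)) s)
      (radialFlux d (fun s => β + invLaplacian d (fun t => t ^ α * Real.exp (u t)) s))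
      (radialFlux d (fun t => t ^ α * Real.exp (u t))) := by
  have hg := hu.rpow_mul_exp α
  have hws : IsRadialSource 0 (fun s => β + invLaplacian d (fun t => t ^ α * Real.exp (u t)) s) :=
    (IsRadialSource.const β).add (hg.invLaplacian_source hd hα)
  have hwc : ContinuousOn (fun s => β + invLaplacian d (fun t => t ^ α * Real.exp (u t)) s)
      (Ioi 0) := continuousOn_const.add (hg.continuousOn_invLaplacian hd hα)
  have hev : ∀ r, 0 < r → u =ᶠ[𝓝 r]
      invLaplacian d (fun s => β + invLaplacian d (fun t => t ^ α * Real.exp (u t)) s) :=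
    fun r hr => by filter_upwards [Ioi_mem_nhds hr] with s hs using hfix s hs
  have hu' : ∀ r, 0 < r → HasDerivAt u
      (radialFlux d (fun s => β + invLaplacian d (fun t => t ^ α * Real.exp (u t)) s) r / r ^ d)
      r := fun r hr =>
    (hws.hasDerivAt_invLaplacian hd (by norm_num) hr).congr_of_eventuallyEq (hev r hr)
  have hgc : ContinuousOn (fun t => t ^ α * Real.exp (u t)) (Ioi 0) := by
    refine ContinuousOn.mul (fun t ht => ?_) (Real.continuous_exp.comp_continuousOn
      fun r hr => (hu' r hr).continuousAt.continuousWithinAt)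
    exact (Real.continuousAt_rpow_const t α (Or.inl (mem_Ioi.mp ht).ne')).continuousWithinAt
  refine ⟨hu', fun r hr => hws.hasDerivAt_radialFlux hd (by norm_num) hwc hr, fun r hr =>
    (hg.hasDerivAt_invLaplacian hd hα hr).const_add β, fun r hr =>
    hg.hasDerivAt_radialFlux hd hα hgc hr, ?_, hws.tendsto_radialFlux_zero hd (by norm_num), ?_,
    hg.tendsto_radialFlux_zero hd hα⟩
  · refine (hws.tendsto_invLaplacian_zero hd (by norm_num)).congr' ?_
    filter_upwards [self_mem_nhdsWithin] with r hr using (hfix r hr).symm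
  · simpa using (hg.tendsto_invLaplacian_zero hd hα).const_add β

end IsRadialSystem

/-! ### Blow-up: an entire solution has negative Laplacian -/

/-- Propagates a power-type lower bound from a function to its flux. The factor `t ^ d` is kept, so
that dividing the flux by `t ^ d` gives back a clean power of `t - r`. -/
theorem le_of_hasDerivAt_pow_mul {d k : ℕ} {F g : ℝ → ℝ} {c r : ℝ} (hr : 0 < r) (hc : 0 ≤ c)
    (hF : ∀ s, 0 < s → HasDerivAt F (s ^ d * g s) s) (hg : ∀ s, r ≤ s → c * (s - r) ^ k ≤ g s)
    (hF0 : 0 ≤ F r) {t : ℝ} (ht : r ≤ t) :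
    c / (d + k + 1) * (t ^ d * (t - r) ^ (k + 1)) ≤ F t := by
  have hD : (0 : ℝ) < d + k + 1 := by positivity
  have h1 : MonotoneOn (fun s => F s - c / (d + k + 1) * (s ^ d * (s - r) ^ (k + 1))) (Ici r) := by
    refine monotoneOn_Ici_of_hasDerivAt (fun s hs => (hF s (hr.trans_le hs)).fun_sub
      (((hasDerivAt_pow d s).fun_mul
        (((hasDerivAt_id' s).sub_const r).fun_pow (k + 1))).const_mul _)) fun s hs => ?_
    have hs0 : 0 < s := hr.trans_le hs
    have hsr : 0 ≤ s - r := sub_nonneg.mpr hs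
    have e1 : (d : ℝ) * s ^ (d - 1) * (s - r) ^ (k + 1) ≤ d * (s ^ d * (s - r) ^ k) := by
      rcases Nat.eq_zero_or_pos d with h0 | h0
      · simp [h0]
      · rw [mul_assoc]
        refine mul_le_mul_of_nonneg_left ?_ (Nat.cast_nonneg d)
        calc s ^ (d - 1) * (s - r) ^ (k + 1) = s ^ (d - 1) * (s - r) * (s - r) ^ k := by ring
          _ ≤ s ^ (d - 1) * s * (s - r) ^ k := by gcongr; linarith
          _ = s ^ d * (s - r) ^ k := by rw [← pow_succ, Nat.sub_add_cancel h0]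
    have e2 := mul_le_mul_of_nonneg_left (hg s hs) (pow_pos hs0 d).le
    have e3 : c / (d + k + 1) * (d * s ^ (d - 1) * (s - r) ^ (k + 1)
        + s ^ d * ((k + 1) * (s - r) ^ k)) ≤ s ^ d * (c * (s - r) ^ k) := by
      calc _ ≤ c / (d + k + 1) * (d * (s ^ d * (s - r) ^ k)
            + s ^ d * ((k + 1) * (s - r) ^ k)) := by gcongr
        _ = s ^ d * (c * (s - r) ^ k) := by field_simp; ring
    have e4 : (↑(k + 1) : ℝ) * (s - r) ^ (k + 1 - 1) * 1 = (k + 1) * (s - r) ^ k := by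
      push_cast
      simp
    rw [e4]
    linarith
  have h2 := h1 self_mem_Ici ht ht
  simp only [sub_self, ne_eq, Nat.add_eq_zero_iff, one_ne_zero, and_false, not_false_eq_true,
    zero_pow, mul_zero, sub_zero] at h2
  linarith

namespace IsRadialSystem

variable {d : ℕ} {α β : ℝ} {u w q m : ℝ → ℝ}

theorem m_pos (h : IsRadialSystem d α β u w q m) {r : ℝ} (hr : 0 < r) : 0 < m r := by
  have h1 : StrictMonoOn m (Ioi 0) := strictMonoOn_Ioi_of_hasDerivAt h.deriv_m fun _ hr =>
    mul_pos (pow_pos hr d) (mul_pos (Real.rpow_pos_of_pos hr _) (Real.exp_pos _))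
  exact (h1.monotoneOn.le_of_tendsto_nhdsGT h.tendsto_m (half_pos hr)).trans_lt
    (h1 (half_pos hr) hr (half_lt_self hr))

theorem monotoneOn_m (h : IsRadialSystem d α β u w q m) : MonotoneOn m (Ioi 0) :=
  monotoneOn_Ioi_of_hasDerivAt h.deriv_m fun _ hr =>
    (mul_pos (pow_pos hr d) (mul_pos (Real.rpow_pos_of_pos hr _) (Real.exp_pos _))).le

theorem strictMonoOn_w (h : IsRadialSystem d α β u w q m) : StrictMonoOn w (Ioi 0) :=
  strictMonoOn_Ioi_of_hasDerivAt h.deriv_w fun _ hr => div_pos (h.m_pos hr) (pow_pos hr d)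

theorem β_le_w (h : IsRadialSystem d α β u w q m) {r : ℝ} (hr : 0 < r) : β ≤ w r :=
  h.strictMonoOn_w.monotoneOn.le_of_tendsto_nhdsGT h.tendsto_w hr

/-- The quantitative growth estimate behind blow-up: a lower bound `K` on the source beyond `r` is
integrated four times. -/
theorem quartic_growth (h : IsRadialSystem d α β u w q m) {r K : ℝ} (hr : 0 < r) (hK : 0 ≤ K)
    (hw : 0 ≤ w r) (hq : 0 ≤ q r) (hsrc : ∀ s, r ≤ s → K ≤ s ^ α * Real.exp (u s)) {t : ℝ}
    (ht : r ≤ t) : u r + K / (8 * (d + 1) * (d + 3)) * (t - r) ^ 4 ≤ u t := by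
  have hm : ∀ s, r ≤ s → K / (d + 1) * (s ^ d * (s - r)) ≤ m s := fun s hs => by
    have := le_of_hasDerivAt_pow_mul (k := 0) hr hK h.deriv_m (fun s hs => by simpa using hsrc s hs)
      (h.m_pos hr).le hs
    simpa using this
  have hw2 : ∀ s, r ≤ s → K / (d + 1) / 2 * (s - r) ^ 2 ≤ w s := fun s hs => by
    have h1 : MonotoneOn (fun s => w s - K / (d + 1) / 2 * (s - r) ^ 2) (Ici r) := by
      refine monotoneOn_Ici_of_hasDerivAt (fun s hs => (h.deriv_w s (hr.trans_le hs)).fun_sub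
        ((((hasDerivAt_id' s).sub_const r).fun_pow 2).const_mul _)) fun s hs => ?_
      have hs0 := pow_pos (hr.trans_le hs) d
      have := (le_div_iff₀ hs0).mpr (le_of_eq_of_le (by ring :
        K / (d + 1) * (s - r) * s ^ d = K / (d + 1) * (s ^ d * (s - r))) (hm s hs))
      simp only [Nat.cast_ofNat, Nat.add_one_sub_one, pow_one, mul_one]
      linarith
    have h2 := h1 self_mem_Ici hs hs
    simp only [sub_self] at h2
    linarith
  have hq3 : ∀ s, r ≤ s → K / (d + 1) / 2 / (d + 3) * (s ^ d * (s - r) ^ 3) ≤ q s :=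
    fun s hs => by
      have := le_of_hasDerivAt_pow_mul (k := 2) hr (by positivity) h.deriv_q hw2 hq hs
      convert this using 2
      push_cast
      ring
  have h1 : MonotoneOn (fun s => u s - K / (8 * (d + 1) * (d + 3)) * (s - r) ^ 4) (Ici r) := by
    refine monotoneOn_Ici_of_hasDerivAt (fun s hs => (h.deriv_u s (hr.trans_le hs)).fun_sub
      ((((hasDerivAt_id' s).sub_const r).fun_pow 4).const_mul _)) fun s hs => ?_
    have hs0 := pow_pos (hr.trans_le hs) d
    have := (le_div_iff₀ hs0).mpr (le_of_eq_of_le (by ring :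
      K / (d + 1) / 2 / (d + 3) * (s - r) ^ 3 * s ^ d
        = K / (d + 1) / 2 / (d + 3) * (s ^ d * (s - r) ^ 3)) (hq3 s hs))
    have e : K / (8 * (d + 1) * (d + 3)) * (((4 : ℕ) : ℝ) * (s - r) ^ (4 - 1) * 1)
        = K / (d + 1) / 2 / (d + 3) * (s - r) ^ 3 := by
      push_cast
      field_simp
      ring
    rw [e]
    linarith
  have h2 := h1 self_mem_Ici ht ht
  simp only [sub_self] at h2
  linarith

/-- A solution with nonnegative Laplacian somewhere cannot be global: by the quartic growth
estimate `u` increases by `1` over steps of length `κ e^(-u/8)`, and the potential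
`r + A e^(-u/8)` shows that infinitely many such steps fit into a bounded interval. -/
theorem not_forall_growth (h : IsRadialSystem d α β u w q m) {r₀ : ℝ} (hr₀ : 0 < r₀)
    (hw : 0 ≤ w r₀) (hq : 0 ≤ q r₀)
    (hsrc : ∀ s, r₀ ≤ s → Real.exp (u s / 2) ≤ s ^ α * Real.exp (u s)) : False := by
  have hwn : ∀ s, r₀ ≤ s → 0 ≤ w s := fun s hs =>
    hw.trans (h.strictMonoOn_w.monotoneOn hr₀ (hr₀.trans_le hs) hs)
  have hqmono : MonotoneOn q (Ici r₀) :=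
    monotoneOn_Ici_of_hasDerivAt (fun s hs => h.deriv_q s (hr₀.trans_le hs)) fun s hs =>
      mul_nonneg (pow_pos (hr₀.trans_le hs) d).le (hwn s hs)
  have hqn : ∀ s, r₀ ≤ s → 0 ≤ q s := fun s hs => hq.trans (hqmono self_mem_Ici hs hs)
  have humono : MonotoneOn u (Ici r₀) :=
    monotoneOn_Ici_of_hasDerivAt (fun s hs => h.deriv_u s (hr₀.trans_le hs)) fun s hs =>
      div_nonneg (hqn s hs) (pow_pos (hr₀.trans_le hs) d).le
  set κ : ℝ := (8 * (d + 1) * (d + 3) : ℝ) ^ (1 / 4 : ℝ) with hκ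
  have hκ0 : 0 < κ := by positivity
  have hκ4 : κ ^ 4 = 8 * (d + 1) * (d + 3) := by
    rw [hκ, ← Real.rpow_natCast, ← Real.rpow_mul (by positivity)]
    norm_num
  set ρ : ℝ := Real.exp (-1 / 8) with hρ
  have hρ1 : ρ < 1 := by
    rw [hρ, ← Real.exp_zero]
    exact Real.exp_lt_exp.mpr (by norm_num)
  set A : ℝ := κ / (1 - ρ) with hA
  have hA0 : 0 < A := div_pos hκ0 (by linarith)
  have hAρ : κ + A * ρ = A := by
    rw [hA]
    have : 1 - ρ ≠ 0 := by linarith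
    field_simp
    ring
  have hstep : ∀ k : ℕ, ∃ r, r₀ ≤ r ∧ r + A * Real.exp (-u r / 8) ≤ r₀ + A * Real.exp (-u r₀ / 8) ∧
      u r₀ + k ≤ u r := by
    intro k
    induction k with
    | zero => exact ⟨r₀, le_rfl, le_rfl, by simp⟩
    | succ k ih =>
      obtain ⟨r, hr, hpot, hur⟩ := ih
      have hE := Real.exp_pos (-u r / 8)
      set t := r + κ * Real.exp (-u r / 8) with ht
      have hrt : r ≤ t := by rw [ht]; linarith [mul_pos hκ0 hE]
      have hg := h.quartic_growth (hr₀.trans_le hr) (Real.exp_pos (u r / 2)).le (hwn r hr)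
        (hqn r hr) (fun s hs => (Real.exp_le_exp.mpr (by
          linarith [humono (mem_Ici.mpr hr) (mem_Ici.mpr (hr.trans hs)) hs])).trans
          (hsrc s (hr.trans hs))) hrt
      have e1 : Real.exp (u r / 2) / (8 * (d + 1) * (d + 3)) * (t - r) ^ 4 = 1 := by
        have : Real.exp (u r / 2) * Real.exp (-u r / 8) ^ 4 = 1 := by
          rw [← Real.exp_nat_mul, ← Real.exp_add, Real.exp_eq_one_iff]
          push_cast
          ring
        rw [ht, add_sub_cancel_left, mul_pow, hκ4, ← this]
        field_simp
      rw [e1] at hg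
      refine ⟨t, hr.trans hrt, ?_, by push_cast; linarith⟩
      have e2 : Real.exp (-u t / 8) ≤ ρ * Real.exp (-u r / 8) := by
        rw [hρ, ← Real.exp_add]
        exact Real.exp_le_exp.mpr (by linarith)
      have e3 := mul_le_mul_of_nonneg_left e2 hA0.le
      have e4 : κ * Real.exp (-u r / 8) + A * (ρ * Real.exp (-u r / 8))
          = A * Real.exp (-u r / 8) := by
        linear_combination Real.exp (-u r / 8) * hAρ
      rw [ht] at e3 ⊢
      linarith
  set R := r₀ + A * Real.exp (-u r₀ / 8)
  obtain ⟨k, hk⟩ := exists_nat_gt (u R - u r₀)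
  obtain ⟨r, hr, hpot, hur⟩ := hstep k
  have hrR : r ≤ R := by linarith [mul_pos hA0 (Real.exp_pos (-u r / 8))]
  have := humono (mem_Ici.mpr hr) (mem_Ici.mpr (hr.trans hrR)) hrR
  linarith

theorem w_neg (h : IsRadialSystem d α β u w q m) {r : ℝ} (hr : 0 < r) : w r < 0 := by
  by_contra hcon
  have hcon : 0 ≤ w r := not_lt.mp hcon
  set r₁ := r + 1
  have hr₁ : 0 < r₁ := by positivity
  set δ := w r₁
  have hδ : 0 < δ := hcon.trans_lt (h.strictMonoOn_w hr hr₁ (by simp [r₁]))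
  have hwδ : ∀ s, r₁ ≤ s → δ ≤ w s := fun s hs =>
    h.strictMonoOn_w.monotoneOn hr₁ (hr₁.trans_le hs) hs
  -- `q` grows at least like `δ s^(d+1) / (d+1)`
  have hq : ∀ s, r₁ ≤ s → q r₁ + δ / (d + 1) * (s ^ (d + 1) - r₁ ^ (d + 1)) ≤ q s := by
    intro s hs
    have h1 : MonotoneOn (fun s => q s - δ / (d + 1) * s ^ (d + 1)) (Ici r₁) := by
      refine monotoneOn_Ici_of_hasDerivAt (fun s hs => (h.deriv_q s (hr₁.trans_le hs)).fun_sub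
        ((hasDerivAt_pow (d + 1) s).const_mul _)) fun s hs => ?_
      have e : δ / (d + 1) * (((d + 1 : ℕ) : ℝ) * s ^ (d + 1 - 1)) = s ^ d * δ := by
        push_cast
        field_simp
      rw [e]
      have := mul_le_mul_of_nonneg_left (hwδ s hs) (pow_pos (hr₁.trans_le hs) d).le
      linarith
    have := h1 self_mem_Ici hs hs
    simp only at this
    linarith
  set c := δ / (2 * (d + 1)) with hc
  have hc0 : 0 < c := by positivity
  have hc2 : δ / (d + 1) = 2 * c := by rw [hc]; field_simp
  rw [hc2] at hq
  obtain ⟨r₂, hr₂, hqc⟩ : ∃ r₂, r₁ ≤ r₂ ∧ ∀ s, r₂ ≤ s → c * s ^ (d + 1) ≤ q s := by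
    have h1 : Tendsto (fun s : ℝ => c * s ^ (d + 1)) atTop atTop :=
      (tendsto_pow_atTop (by omega)).const_mul_atTop hc0
    obtain ⟨a, ha⟩ := eventually_atTop.mp
      (h1.eventually_ge_atTop (2 * c * r₁ ^ (d + 1) - q r₁))
    refine ⟨max a r₁, le_max_right _ _, fun s hs => ?_⟩
    have e1 := hq s ((le_max_right _ _).trans hs)
    have e2 := ha s ((le_max_left _ _).trans hs)
    linarith
  have hr₂0 : 0 < r₂ := hr₁.trans_le hr₂
  have hu : ∀ s, r₂ ≤ s → u r₂ - c / 2 * r₂ ^ 2 + c / 2 * s ^ 2 ≤ u s := by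
    intro s hs
    have h1 : MonotoneOn (fun s => u s - c / 2 * s ^ 2) (Ici r₂) := by
      refine monotoneOn_Ici_of_hasDerivAt (fun s hs => (h.deriv_u s (hr₂0.trans_le hs)).fun_sub
        ((hasDerivAt_pow 2 s).const_mul _)) fun s hs => ?_
      have hs0 := hr₂0.trans_le hs
      have := (le_div_iff₀ (pow_pos hs0 d)).mpr (le_of_eq_of_le (by ring :
        c * s * s ^ d = c * s ^ (d + 1)) (hqc s hs))
      simp only [Nat.cast_ofNat, Nat.add_one_sub_one, pow_one]
      linarith
    have := h1 self_mem_Ici hs hs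
    simp only at this
    linarith
  obtain ⟨r₃, hr₃, hr₃1, hua⟩ : ∃ r₃, r₂ ≤ r₃ ∧ 1 ≤ r₃ ∧
      ∀ s, r₃ ≤ s → 2 * |α| * s ≤ u s := by
    set B := u r₂ - c / 2 * r₂ ^ 2
    refine ⟨max r₂ (max 1 ((2 * |α| + |B|) / (c / 2))), le_max_left _ _,
      (le_max_left _ _).trans (le_max_right _ _), fun s hs => ?_⟩
    have h1 : 1 ≤ s := (le_max_left _ _).trans ((le_max_right _ _).trans hs)
    have h2 := (div_le_iff₀ (by positivity)).mp
      ((le_max_right _ _).trans ((le_max_right _ _).trans hs))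
    have h3 := hu s ((le_max_left _ _).trans hs)
    have h4 := mul_le_mul_of_nonneg_right h2 (by linarith : 0 ≤ s)
    have h5 : |B| ≤ |B| * s := le_mul_of_one_le_right (abs_nonneg B) h1
    have h6 := neg_abs_le B
    nlinarith
  refine h.not_forall_growth (hr₂0.trans_le hr₃) (hδ.le.trans (hwδ _ (hr₂.trans hr₃)))
    (le_trans (by have := hr₂0.trans_le hr₃; positivity) (hqc _ hr₃)) fun s hs => ?_
  have hs1 : 1 ≤ s := hr₃1.trans hs
  have hs0 : 0 < s := by linarith
  rw [Real.rpow_def_of_pos hs0, ← Real.exp_add]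
  refine Real.exp_le_exp.mpr ?_
  have e1 := hua s hs
  have e2 : Real.log s ≤ s := (Real.log_le_sub_one_of_pos hs0).trans (by linarith)
  have e3 : 0 ≤ Real.log s := Real.log_nonneg hs1
  have e4 : -(Real.log s * α) ≤ s * |α| := by
    calc -(Real.log s * α) ≤ |Real.log s * α| := neg_le_abs _
      _ = Real.log s * |α| := by rw [abs_mul, abs_of_nonneg e3]
      _ ≤ s * |α| := by gcongr
  linarith

theorem β_neg (h : IsRadialSystem d α β u w q m) : β < 0 :=
  (h.β_le_w one_pos).trans_lt (h.w_neg one_pos)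

theorem antitoneOn_q (h : IsRadialSystem d α β u w q m) : AntitoneOn q (Ioi 0) := by
  have h1 : MonotoneOn (fun r => -q r) (Ioi 0) :=
    monotoneOn_Ioi_of_hasDerivAt (fun r hr => (h.deriv_q r hr).fun_neg) fun r hr => by
      have := mul_nonneg (pow_pos hr d).le (neg_nonneg.mpr (h.w_neg hr).le)
      linarith
  exact fun a ha b hb hab => neg_le_neg_iff.mp (h1 ha hb hab)

theorem q_nonpos (h : IsRadialSystem d α β u w q m) {r : ℝ} (hr : 0 < r) : q r ≤ 0 := by
  have := MonotoneOn.le_of_tendsto_nhdsGT (f := fun r => -q r)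
    (fun a ha b hb hab => neg_le_neg (h.antitoneOn_q ha hb hab)) h.tendsto_q.neg hr
  linarith

theorem antitoneOn_u (h : IsRadialSystem d α β u w q m) : AntitoneOn u (Ioi 0) := by
  have h1 : MonotoneOn (fun r => -u r) (Ioi 0) :=
    monotoneOn_Ioi_of_hasDerivAt (fun r hr => (h.deriv_u r hr).fun_neg) fun r hr => by
      have := div_nonneg (neg_nonneg.mpr (h.q_nonpos hr)) (pow_pos hr d).le
      rw [neg_div] at this
      exact this
  exact fun a ha b hb hab => neg_le_neg_iff.mp (h1 ha hb hab)

theorem u_nonpos (h : IsRadialSystem d α β u w q m) {r : ℝ} (hr : 0 < r) : u r ≤ 0 := by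
  have := MonotoneOn.le_of_tendsto_nhdsGT (f := fun r => -u r)
    (fun a ha b hb hab => neg_le_neg (h.antitoneOn_u ha hb hab)) h.tendsto_u.neg hr
  linarith

end IsRadialSystem

/-! ### Monotone iteration and the set of admissible initial values -/

/-- The operator `v ↦ Δ⁻¹ (β + Δ⁻¹ (r^α e^v))`, whose fixed points are the solutions with
`Δu(0) = β`. -/
noncomputable def picardMap (d : ℕ) (α β : ℝ) (v : ℝ → ℝ) : ℝ → ℝ :=
  invLaplacian d fun s => β + invLaplacian d (fun t => t ^ α * Real.exp (v t)) s

/-- The Picard iterates starting from the solution `Δ⁻¹ β` of the equation without source. -/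
noncomputable def picardIterate (d : ℕ) (α β : ℝ) : ℕ → ℝ → ℝ
  | 0 => invLaplacian d fun _ => β
  | n + 1 => picardMap d α β (picardIterate d α β n)

section Threshold

variable {d : ℕ} {α β : ℝ}

theorem picardMap_inner_source (hd : 2 ≤ d) (hα : -2 < α) (β : ℝ) {v : ℝ → ℝ}
    (hv : IsRadialSource 0 v) :
    IsRadialSource 0 fun s => β + invLaplacian d (fun t => t ^ α * Real.exp (v t)) s :=
  (IsRadialSource.const β).add ((hv.rpow_mul_exp α).invLaplacian_source hd hα)

theorem picardMap_source (hd : 2 ≤ d) (hα : -2 < α) (β : ℝ) {v : ℝ → ℝ}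
    (hv : IsRadialSource 0 v) : IsRadialSource 0 (picardMap d α β v) :=
  (picardMap_inner_source hd hα β hv).invLaplacian_source hd (by norm_num)

theorem picardMap_mono (hd : 2 ≤ d) (hα : -2 < α) {β β' : ℝ} (hβ : β ≤ β') {v v' : ℝ → ℝ}
    (hv : IsRadialSource 0 v) (hv' : IsRadialSource 0 v') (hle : ∀ r, 0 < r → v r ≤ v' r) {r : ℝ}
    (hr : 0 < r) : picardMap d α β v r ≤ picardMap d α β' v' r := by
  refine (picardMap_inner_source hd hα β hv).invLaplacian_mono hd (by norm_num)
    (picardMap_inner_source hd hα β' hv') hr fun s hs => ?_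
  refine add_le_add hβ ((hv.rpow_mul_exp α).invLaplacian_mono hd hα (hv'.rpow_mul_exp α) hs.1
    fun t ht => ?_)
  exact mul_le_mul_of_nonneg_left (Real.exp_le_exp.mpr (hle t ht.1))
    (Real.rpow_nonneg ht.1.le _)

theorem invLaplacian_const_le_picardMap (hd : 2 ≤ d) (hα : -2 < α) {v : ℝ → ℝ}
    (hv : IsRadialSource 0 v) {r : ℝ} (hr : 0 < r) :
    invLaplacian d (fun _ => β) r ≤ picardMap d α β v r := by
  refine (IsRadialSource.const β).invLaplacian_mono hd (by norm_num)
    (picardMap_inner_source hd hα β hv) hr fun s hs => ?_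
  have := IsRadialSource.invLaplacian_nonneg (d := d) (g := fun t => t ^ α * Real.exp (v t))
    (fun t ht => mul_nonneg (Real.rpow_nonneg ht.le _) (Real.exp_pos _).le) hs.1
  linarith

theorem picardIterate_source (hd : 2 ≤ d) (hα : -2 < α) (β : ℝ) (n : ℕ) :
    IsRadialSource 0 (picardIterate d α β n) := by
  cases n with
  | zero => exact (IsRadialSource.const β).invLaplacian_source hd (by norm_num)
  | succ n =>
    induction n with
    | zero =>
      exact picardMap_source hd hα β
        ((IsRadialSource.const β).invLaplacian_source hd (by norm_num))
    | succ n ih => exact picardMap_source hd hα β ih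

theorem picardIterate_le_succ (hd : 2 ≤ d) (hα : -2 < α) (n : ℕ) {r : ℝ} (hr : 0 < r) :
    picardIterate d α β n r ≤ picardIterate d α β (n + 1) r := by
  induction n generalizing r with
  | zero => exact invLaplacian_const_le_picardMap hd hα (picardIterate_source hd hα β 0) hr
  | succ n ih =>
    exact picardMap_mono hd hα le_rfl (picardIterate_source hd hα β n)
      (picardIterate_source hd hα β (n + 1)) (fun r hr => ih hr) hr

/-- The Picard operator is continuous under pointwise convergence of nonpositive functions. -/
theorem tendsto_picardMap (hd : 2 ≤ d) (hα : -2 < α) {b : ℕ → ℝ} {V : ℕ → ℝ → ℝ} {v : ℝ → ℝ}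
    (hb : Tendsto b atTop (𝓝 β)) (hV : ∀ n, IsRadialSource 0 (V n))
    (hV0 : ∀ n r, 0 < r → V n r ≤ 0) (hlim : ∀ r, 0 < r → Tendsto (fun n => V n r) atTop (𝓝 (v r)))
    {r : ℝ} (hr : 0 < r) :
    Tendsto (fun n => picardMap d α (b n) (V n) r) atTop (𝓝 (picardMap d α β v r)) := by
  have hdom : IsRadialSource α fun t => t ^ α * Real.exp ((fun _ => (0 : ℝ)) t) :=
    (IsRadialSource.const 0).rpow_mul_exp α
  have hnn : ∀ n t, 0 < t → 0 ≤ t ^ α * Real.exp (V n t) := fun n t ht =>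
    mul_nonneg (Real.rpow_nonneg ht.le _) (Real.exp_pos _).le
  have hle : ∀ n t, 0 < t → t ^ α * Real.exp (V n t) ≤ t ^ α * Real.exp 0 := fun n t ht =>
    mul_le_mul_of_nonneg_left (Real.exp_le_exp.mpr (hV0 n t ht)) (Real.rpow_nonneg ht.le _)
  refine IsRadialSource.tendsto_invLaplacian (γ := 0) hd (by norm_num)
    (fun n => (picardMap_inner_source hd hα (b n) (hV n)).aestronglyMeasurable) (fun R => ?_)
    (fun s hs => hb.add ?_) hr
  · obtain ⟨B, hB⟩ := (hb.abs).bddAbove_range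
    obtain ⟨C, hC0, hC⟩ := (hdom.invLaplacian_source hd hα).exists_bound R
    refine ⟨|B| + C, by positivity, fun n t ht => ?_⟩
    have h1 : |b n| ≤ |B| := (hB ⟨n, rfl⟩).trans (le_abs_self B)
    have h2 := hC t ht
    rw [Real.rpow_zero, mul_one] at h2 ⊢
    have h3 := IsRadialSource.invLaplacian_nonneg (d := d) (hnn n) ht.1
    have h4 := ((hV n).rpow_mul_exp α).invLaplacian_mono hd hα hdom ht.1
      fun t ht => hle n t ht.1
    refine (abs_add_le _ _).trans (add_le_add h1 ?_)
    rw [abs_of_nonneg h3]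
    exact h4.trans ((le_abs_self _).trans h2)
  · refine IsRadialSource.tendsto_invLaplacian hd hα
      (fun n => ((hV n).rpow_mul_exp α).aestronglyMeasurable)
      (fun R => ⟨1, zero_le_one, fun n t ht => ?_⟩) (fun t ht => ?_) hs
    · rw [abs_of_nonneg (hnn n t ht.1), one_mul]
      simpa using hle n t ht.1
    · exact ((Real.continuous_exp.tendsto _).comp (hlim t ht)).const_mul _

/-- The initial values `β` for which all Picard iterates stay nonpositive; these turn out to be
the ones admitting an entire solution. -/
def nonposIterates (d : ℕ) (α : ℝ) : Set ℝ :=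
  {β | ∀ n r, 0 < r → picardIterate d α β n r ≤ 0}

/-- Nonpositive iterates increase to a solution. -/
theorem exists_isEntireRadialSolution (hd : 2 ≤ d) (hα : -2 < α) (hβ : β ∈ nonposIterates d α) :
    ∃ u, IsEntireRadialSolution (d + 1) α β u := by
  classical
  set U := picardIterate d α β with hU
  have hmono : ∀ r, 0 < r → Monotone fun n => U n r := fun r hr =>
    monotone_nat_of_le_succ fun n => picardIterate_le_succ hd hα n hr
  set u : ℝ → ℝ := fun r => if 0 < r then ⨆ n, U n r else 0 with hu
  have hlim : ∀ r, 0 < r → Tendsto (fun n => U n r) atTop (𝓝 (u r)) := by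
    intro r hr
    have := tendsto_atTop_ciSup (hmono r hr) ⟨0, by rintro _ ⟨n, rfl⟩; exact hβ n r hr⟩
    simpa only [hu, if_pos hr] using this
  have hsrc : ∀ n, IsRadialSource 0 (U n) := picardIterate_source hd hα β
  have hus : IsRadialSource 0 u := by
    refine ⟨aestronglyMeasurable_of_tendsto_ae atTop (fun n => (hsrc n).aestronglyMeasurable) ?_,
      fun R => ?_⟩
    · filter_upwards [self_mem_ae_restrict measurableSet_Ioi] with r hr using hlim r hr
    · obtain ⟨C, hC⟩ := (hsrc 0).bound R
      refine ⟨C, fun t ht => le_trans ?_ (hC t ht)⟩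
      have h1 : u t ≤ 0 := le_of_tendsto' (hlim t ht.1) fun n => hβ n t ht.1
      have h2 : U 0 t ≤ u t := (hmono t ht.1).ge_of_tendsto (hlim t ht.1) 0
      rw [abs_of_nonpos h1, abs_of_nonpos (h2.trans h1)]
      linarith
  have hfix : ∀ r, 0 < r → u r = picardMap d α β u r := fun r hr =>
    tendsto_nhds_unique ((hlim r hr).comp (tendsto_add_atTop_nat 1))
      (tendsto_picardMap hd hα tendsto_const_nhds hsrc hβ hlim hr)
  exact ⟨u, (IsRadialSystem.of_fixedPoint hd hα hus hfix).isEntireRadialSolution hd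
    (by simp [hu])⟩

/-- A nonpositive supersolution dominates all iterates. -/
theorem mem_nonposIterates_of_supersolution (hd : 2 ≤ d) (hα : -2 < α) {v : ℝ → ℝ}
    (hv : IsRadialSource 0 v) (hv0 : ∀ r, 0 < r → v r ≤ 0)
    (hsup : ∀ r, 0 < r → picardMap d α β v r ≤ v r) : β ∈ nonposIterates d α := by
  have h : ∀ n r, 0 < r → picardIterate d α β n r ≤ v r := by
    intro n
    induction n with
    | zero => exact fun r hr => (invLaplacian_const_le_picardMap hd hα hv hr).trans (hsup r hr)
    | succ n ih =>
      exact fun r hr => (picardMap_mono hd hα le_rfl (picardIterate_source hd hα β n) hv ih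
        hr).trans (hsup r hr)
  exact fun n r hr => (h n r hr).trans (hv0 r hr)

theorem IsRadialSystem.mem_nonposIterates {u w q m : ℝ → ℝ} (hd : 2 ≤ d) (hα : -2 < α)
    (h : IsRadialSystem d α β u w q m) {β' : ℝ} (hβ : β' ≤ β) : β' ∈ nonposIterates d α := by
  refine mem_nonposIterates_of_supersolution hd hα h.source_u (fun r hr => h.u_nonpos hr)
    fun r hr => ?_
  rw [h.u_eq hd hr]
  refine (picardMap_inner_source hd hα β' h.source_u).invLaplacian_mono hd (by norm_num)
    h.source_w hr fun s hs => ?_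
  rw [h.w_eq hd hα hs.1]
  linarith

theorem exists_isEntireRadialSolution_iff (hd : 2 ≤ d) (hα : -2 < α) :
    (∃ u, IsEntireRadialSolution (d + 1) α β u) ↔ β ∈ nonposIterates d α :=
  ⟨fun ⟨_, hu⟩ => (hu.isRadialSystem hd).mem_nonposIterates hd hα le_rfl,
    exists_isEntireRadialSolution hd hα⟩

theorem integrableOn_pow_mul_rpow_mul_exp_sq (hd : 2 ≤ d) (hα : -2 < α) {b : ℝ} (hb : 0 < b) :
    IntegrableOn (fun t : ℝ => t ^ d * (t ^ α * Real.exp (-b * t ^ 2))) (Ioi 0) := by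
  have hd' : (2 : ℝ) ≤ d := by exact_mod_cast hd
  refine (integrableOn_rpow_mul_exp_neg_mul_sq hb (s := d + α) (by linarith)).congr_fun
    (fun t ht => ?_) measurableSet_Ioi
  simp only
  rw [Real.rpow_add ht, Real.rpow_natCast, mul_assoc]

theorem nonempty_nonposIterates (hd : 2 ≤ d) (hα : -2 < α) : (nonposIterates d α).Nonempty := by
  set v : ℝ → ℝ := invLaplacian d fun _ => (-1 : ℝ) with hv
  have hvs : IsRadialSource 0 v := (IsRadialSource.const (-1)).invLaplacian_source hd (by norm_num)
  have hveq : ∀ r, 0 ≤ r → v r = -(1 / (2 * (d + 1))) * r ^ 2 := fun r hr => by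
    rw [hv, IsRadialSource.invLaplacian_const _ hr]
    ring
  obtain ⟨C, hC⟩ := (hvs.rpow_mul_exp α).exists_invLaplacian_le hd hα
    (fun t ht => mul_nonneg (Real.rpow_nonneg ht.le _) (Real.exp_pos _).le) <| by
    refine (integrableOn_pow_mul_rpow_mul_exp_sq hd hα
      (by positivity : (0 : ℝ) < 1 / (2 * (d + 1)))).congr_fun (fun t ht => ?_) measurableSet_Ioi
    simp only
    rw [hveq t (le_of_lt ht)]
  refine ⟨-1 - C, mem_nonposIterates_of_supersolution hd hα hvs (fun r hr => ?_) fun r hr => ?_⟩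
  · rw [hveq r hr.le]
    have : (0 : ℝ) ≤ 1 / (2 * (d + 1)) * r ^ 2 := by positivity
    linarith
  · refine (picardMap_inner_source hd hα _ hvs).invLaplacian_mono hd (by norm_num)
      (IsRadialSource.const (-1)) hr fun s hs => ?_
    have := hC s hs.1
    linarith

theorem sSup_mem_nonposIterates (hd : 2 ≤ d) (hα : -2 < α) (hbdd : BddAbove (nonposIterates d α)) :
    sSup (nonposIterates d α) ∈ nonposIterates d α := by
  obtain ⟨b, -, hb, hbE⟩ := exists_seq_tendsto_sSup (nonempty_nonposIterates hd hα) hbdd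
  have hlim : ∀ n r, 0 < r → Tendsto (fun k => picardIterate d α (b k) n r) atTop
      (𝓝 (picardIterate d α (sSup (nonposIterates d α)) n r)) := by
    intro n
    induction n with
    | zero =>
      intro r hr
      simp only [picardIterate]
      simp only [IsRadialSource.invLaplacian_const _ hr.le]
      exact (hb.mul_const _).div_const _
    | succ n ih =>
      exact fun r hr => tendsto_picardMap hd hα hb
        (fun k => picardIterate_source hd hα (b k) n) (fun k => hbE k n) ih hr
  exact fun n r hr => le_of_tendsto' (hlim n r hr) fun k => hbE k n r hr

/-- If `Δu` stays below a negative constant then `u` decays like a Gaussian exponent and can be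
perturbed to a supersolution for a larger initial value. The perturbation is `η Δ⁻¹ p`, where
`p = exp (Δ⁻¹ h)` with `h = r^α (r² / (2 (d + 1))) e^(u/2)` dominates the linearised equation. -/
theorem IsRadialSystem.exists_gt_mem_nonposIterates {u w q m : ℝ → ℝ} (hd : 2 ≤ d) (hα : -2 < α)
    (h : IsRadialSystem d α β u w q m) {δ : ℝ} (hδ : 0 < δ) (hw : ∀ r, 0 < r → w r ≤ -δ) :
    ∃ β', β < β' ∧ β' ∈ nonposIterates d α := by
  have hD : (0 : ℝ) < 2 * (d + 1) := by positivity
  have hu : ∀ r, 0 < r → u r ≤ -δ * r ^ 2 / (2 * (d + 1)) := fun r hr => by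
    rw [h.u_eq hd hr, ← IsRadialSource.invLaplacian_const _ hr.le]
    exact h.source_w.invLaplacian_mono hd (by norm_num) (IsRadialSource.const _) hr
      fun s hs => hw s hs.1
  have hu2 : IsRadialSource 0 fun t => 1 / 2 * u t := h.source_u.const_mul _
  set k : ℝ → ℝ := fun t => t ^ 2 / (2 * (d + 1)) with hk
  have hkc : Continuous k := by fun_prop
  set g : ℝ → ℝ := fun t => k t * (t ^ α * Real.exp (1 / 2 * u t)) with hg
  have hgs : IsRadialSource α g := (hu2.rpow_mul_exp α).continuous_mul hkc
  have hk0 : ∀ t, 0 ≤ k t := fun t => by positivity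
  have hg0 : ∀ t, 0 < t → 0 ≤ g t := fun t ht =>
    mul_nonneg (hk0 t) (mul_nonneg (Real.rpow_nonneg ht.le _) (Real.exp_pos _).le)
  have hgc : ContinuousOn g (Ioi 0) := by
    refine hkc.continuousOn.mul (ContinuousOn.mul (fun t ht => ?_)
      (Real.continuous_exp.comp_continuousOn (continuousOn_const.mul h.continuousOn_u)))
    exact (Real.continuousAt_rpow_const t α (Or.inl (mem_Ioi.mp ht).ne')).continuousWithinAt
  have hgint : IntegrableOn (fun t => t ^ d * g t) (Ioi 0) := by
    set b : ℝ := δ / (4 * (d + 1)) with hb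
    have hb0 : 0 < b := by positivity
    refine Integrable.mono' ((integrableOn_pow_mul_rpow_mul_exp_sq (d := d + 2) (by omega) hα
      hb0).const_mul (1 / (2 * (d + 1)))) ?_ ?_
    · exact ((continuous_pow d).continuousOn.mul hgc).aestronglyMeasurable measurableSet_Ioi
    · filter_upwards [self_mem_ae_restrict measurableSet_Ioi] with t ht
      have ht0 : 0 < t := ht
      rw [Real.norm_of_nonneg (mul_nonneg (pow_pos ht0 d).le (hg0 t ht0))]
      have e1 : 1 / 2 * u t ≤ -b * t ^ 2 := by
        have := hu t ht0
        have e : -δ * t ^ 2 / (2 * (d + 1)) = 2 * (-b * t ^ 2) := by rw [hb]; field_simp; ring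
        linarith
      calc t ^ d * g t = 1 / (2 * (d + 1)) * (t ^ (d + 2) * (t ^ α * Real.exp (1 / 2 * u t))) := by
            simp only [hg, hk]; ring
        _ ≤ _ := by gcongr
  obtain ⟨C, hC⟩ := hgs.exists_invLaplacian_le hd hα hg0 hgint
  set p : ℝ → ℝ := fun t => Real.exp (invLaplacian d g t) with hp
  have hp1 : ∀ t, 0 < t → 1 ≤ p t := fun t ht =>
    Real.one_le_exp (IsRadialSource.invLaplacian_nonneg hg0 ht)
  have hpC : ∀ t, 0 < t → p t ≤ Real.exp C := fun t ht => Real.exp_le_exp.mpr (hC t ht)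
  have hpd : ∀ t, 0 < t → HasDerivAt p (p t * (radialFlux d g t / t ^ d)) t := fun t ht =>
    (hgs.hasDerivAt_invLaplacian hd hα ht).exp
  have hpm : MonotoneOn p (Ioi 0) := monotoneOn_Ioi_of_hasDerivAt hpd fun t ht =>
    mul_nonneg (Real.exp_pos _).le
      (div_nonneg (IsRadialSource.radialFlux_nonneg hg0 ht) (pow_pos ht d).le)
  have hplim : Tendsto p (𝓝[>] 0) (𝓝 1) := by
    have := (Real.continuous_exp.tendsto _).comp (hgs.tendsto_invLaplacian_zero hd hα)
    rwa [Real.exp_zero] at this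
  have hps : IsRadialSource 0 p := IsRadialSource.of_tendsto
    (fun t ht => (hpd t ht).continuousAt.continuousWithinAt) hplim
  set φ := invLaplacian d p with hφ
  have hφ0 : ∀ r, 0 < r → 0 ≤ φ r := fun r hr =>
    IsRadialSource.invLaplacian_nonneg (fun t ht => zero_le_one.trans (hp1 t ht)) hr
  have hφp : ∀ r, 0 < r → φ r ≤ p r * k r := fun r hr => by
    rw [hk]
    simp only
    rw [← mul_div_assoc, ← IsRadialSource.invLaplacian_const _ hr.le]
    exact hps.invLaplacian_mono hd (by norm_num) (IsRadialSource.const _) hr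
      fun t ht => hpm ht.1 hr ht.2.le
  have hgp : IsRadialSource α fun t => g t * p t := hgs.mul_source hps
  have hinv : ∀ r, 0 < r → invLaplacian d (fun t => g t * p t) r ≤ p r - 1 := by
    intro r hr
    have h1 : MonotoneOn (fun r => p r - invLaplacian d (fun t => g t * p t) r) (Ioi 0) := by
      refine monotoneOn_Ioi_of_hasDerivAt (fun t ht => (hpd t ht).fun_sub
        (hgp.hasDerivAt_invLaplacian hd hα ht)) fun t ht => ?_
      rw [← mul_div_assoc, ← IsRadialSource.radialFlux_const_mul, ← sub_div]
      refine div_nonneg (sub_nonneg.mpr ?_) (pow_pos ht d).le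
      refine hgp.radialFlux_mono hd hα (hgs.const_mul _) ht fun s hs => ?_
      rw [mul_comm]
      exact mul_le_mul_of_nonneg_right (hpm hs.1 ht hs.2.le) (hg0 s hs.1)
    have h2 := h1.le_of_tendsto_nhdsGT (hplim.sub (hgp.tendsto_invLaplacian_zero hd hα)) hr
    linarith
  set η : ℝ := δ / (2 * Real.exp C) with hη
  have hη0 : 0 < η := by positivity
  have hηφ : ∀ r, 0 < r → η * φ r ≤ -(1 / 2 * u r) := by
    intro r hr
    have e1 : η * φ r ≤ η * (Real.exp C * k r) := mul_le_mul_of_nonneg_left ((hφp r hr).trans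
      (mul_le_mul_of_nonneg_right (hpC r hr) (hk0 r))) hη0.le
    have e2 : η * (Real.exp C * k r) = -(1 / 2 * (-δ * r ^ 2 / (2 * (d + 1)))) := by
      rw [hη, hk]
      field_simp
    have := hu r hr
    linarith
  have hvs : IsRadialSource 0 fun r => u r + η * φ r :=
    h.source_u.add ((hps.invLaplacian_source hd (by norm_num)).const_mul η)
  refine ⟨β + η, by linarith, mem_nonposIterates_of_supersolution hd hα hvs (fun r hr => ?_)
    fun r hr => ?_⟩
  · linarith [hηφ r hr, h.u_nonpos hr]
  · have e1 : u r + η * φ r = invLaplacian d (fun t => w t + η * p t) r := by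
      rw [IsRadialSource.invLaplacian_add hd (by norm_num) h.source_w (hps.const_mul η) hr.le,
        IsRadialSource.invLaplacian_const_mul, h.u_eq hd hr]
    rw [e1]
    refine (picardMap_inner_source hd hα _ hvs).invLaplacian_mono hd (by norm_num)
      (h.source_w.add (hps.const_mul η)) hr fun s hs => ?_
    have hus := h.source_u.rpow_mul_exp α
    have e2 : invLaplacian d (fun t => t ^ α * Real.exp (u t + η * φ t)) s ≤
        invLaplacian d (fun t => t ^ α * Real.exp (u t) + η * (g t * p t)) s := by
      refine (hvs.rpow_mul_exp α).invLaplacian_mono hd hα (hus.add (hgp.const_mul η)) hs.1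
        fun t ht => ?_
      have ht0 : 0 < t := ht.1
      set x := η * φ t
      have hx0 : 0 ≤ x := mul_nonneg hη0.le (hφ0 t ht0)
      have hxp : x ≤ η * (p t * k t) := mul_le_mul_of_nonneg_left (hφp t ht0) hη0.le
      -- `e^(u+x) - e^u ≤ x e^(u+x) ≤ x e^(u/2)`
      have f1 : Real.exp (u t + x) * (1 - x) ≤ Real.exp (u t) := by
        calc Real.exp (u t + x) * (1 - x) ≤ Real.exp (u t + x) * Real.exp (-x) := by
              gcongr
              exact Real.one_sub_le_exp_neg x
          _ = Real.exp (u t) := by rw [← Real.exp_add]; ring_nf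
      have f2 : Real.exp (u t + x) ≤ Real.exp (1 / 2 * u t) :=
        Real.exp_le_exp.mpr (by linarith [hηφ t ht0])
      have f3 : Real.exp (u t + x) ≤ Real.exp (u t) + η * (p t * k t) * Real.exp (1 / 2 * u t) := by
        have := mul_le_mul hxp f2 (Real.exp_pos _).le (hx0.trans hxp)
        linarith
      calc t ^ α * Real.exp (u t + x)
          ≤ t ^ α * (Real.exp (u t) + η * (p t * k t) * Real.exp (1 / 2 * u t)) :=
            mul_le_mul_of_nonneg_left f3 (Real.rpow_nonneg ht0.le _)
        _ = t ^ α * Real.exp (u t) + η * (g t * p t) := by simp only [hg]; ring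
    rw [IsRadialSource.invLaplacian_add hd hα hus (hgp.const_mul η) hs.1.le,
      IsRadialSource.invLaplacian_const_mul] at e2
    have e3 := mul_le_mul_of_nonneg_left (hinv s hs.1) hη0.le
    rw [h.w_eq hd hα hs.1]
    linarith

/-- The threshold: entire solutions exist exactly up to some `β₀ < 0`, and at the threshold the
Laplacian of the solution vanishes at infinity. -/
theorem exists_threshold (hd : 2 ≤ d) (hα : -2 < α) :
    ∃ β₀ : ℝ, β₀ < 0 ∧ (∀ β, (∃ u, IsEntireRadialSolution (d + 1) α β u) ↔ β ≤ β₀) ∧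
      ∀ u w q m, IsRadialSystem d α β₀ u w q m → Tendsto w atTop (𝓝 0) := by
  have hneg : ∀ β ∈ nonposIterates d α, β < 0 := fun β hβ => by
    obtain ⟨u, hu⟩ := exists_isEntireRadialSolution hd hα hβ
    exact (hu.isRadialSystem hd).β_neg
  have hbdd : BddAbove (nonposIterates d α) := ⟨0, fun β hβ => (hneg β hβ).le⟩
  have hmem := sSup_mem_nonposIterates hd hα hbdd
  refine ⟨sSup (nonposIterates d α), hneg _ hmem, fun β => ?_, fun u w q m h => ?_⟩
  · rw [exists_isEntireRadialSolution_iff hd hα]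
    refine ⟨fun hβ => le_csSup hbdd hβ, fun hβ => ?_⟩
    obtain ⟨u, hu⟩ := exists_isEntireRadialSolution hd hα hmem
    exact (hu.isRadialSystem hd).mem_nonposIterates hd hα hβ
  · rw [Metric.tendsto_atTop]
    intro ε hε
    obtain ⟨R, hR, hRw⟩ : ∃ R, 0 < R ∧ -ε < w R := by
      by_contra! hcon
      obtain ⟨β', h1, h2⟩ := h.exists_gt_mem_nonposIterates hd hα hε hcon
      exact absurd (le_csSup hbdd h2) (not_le.mpr h1)
    refine ⟨R, fun r hr => ?_⟩
    have hr0 := hR.trans_le hr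
    have h1 := h.w_neg hr0
    have h2 := h.strictMonoOn_w.monotoneOn hR hr0 hr
    rw [Real.dist_eq, sub_zero, abs_of_neg h1]
    linarith

end Threshold

/-! ### Decay estimates for solutions whose Laplacian vanishes at infinity -/

namespace IsRadialSystem

variable {d : ℕ} {α β : ℝ} {u w q m : ℝ → ℝ}

/-- `-Δu(r) = ∫_r^∞ s^(-d) m(s) ds ≥ m(r) ∫_r^∞ s^(-d) ds`. -/
theorem m_le (hd : 2 ≤ d) (h : IsRadialSystem d α β u w q m) (hw : Tendsto w atTop (𝓝 0)) {r : ℝ}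
    (hr : 0 < r) : m r * r / r ^ d ≤ (d - 1) * -w r := by
  obtain ⟨k, rfl⟩ : ∃ k, d = k + 1 + 1 := ⟨d - 2, by omega⟩
  have h1 : MonotoneOn (fun s => (k + 1) * w s + m r / s ^ (k + 1)) (Ici r) := by
    refine monotoneOn_Ici_of_hasDerivAt (fun s hs => ((h.deriv_w s (hr.trans_le hs)).const_mul
      _).fun_add ((hasDerivAt_const s (m r)).fun_div (hasDerivAt_pow (k + 1) s)
        (pow_pos (hr.trans_le hs) _).ne')) fun s hs => ?_
    have hs0 := hr.trans_le hs
    have hm := h.monotoneOn_m hr hs0 hs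
    have e : (k + 1 : ℝ) * (m s / s ^ (k + 1 + 1)) + (0 * s ^ (k + 1) - m r *
        (((k + 1 : ℕ) : ℝ) * s ^ (k + 1 - 1))) / (s ^ (k + 1)) ^ 2
        = (k + 1) * (m s - m r) / s ^ (k + 1 + 1) := by
      push_cast
      field_simp
      ring
    rw [e]
    exact div_nonneg (mul_nonneg (by positivity) (sub_nonneg.mpr hm)) (pow_pos hs0 _).le
  have h2 : Tendsto (fun s => (k + 1) * w s + m r / s ^ (k + 1)) atTop (𝓝 ((k + 1) * 0 + 0)) :=
    (hw.const_mul _).add (tendsto_const_nhds.div_atTop (tendsto_pow_atTop (by omega)))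
  have h3 : (k + 1) * w r + m r / r ^ (k + 1) ≤ (k + 1) * 0 + 0 := by
    refine ge_of_tendsto h2 ?_
    filter_upwards [eventually_ge_atTop r] with s hs using h1 self_mem_Ici hs hs
  have e : m r * r / r ^ (k + 1 + 1) = m r / r ^ (k + 1) := by
    field_simp
    ring
  rw [e]
  push_cast
  linarith

/-- The upper bound `r^(4+α) e^u ≤ C`: since `u` decreases, `-u'` is at least a multiple of
`r^(3+α) e^u`, so that `e^(-u)` grows at least like `r^(4+α)`. -/
theorem exists_rpow_mul_exp_le (hd : 2 ≤ d) (hα : -2 < α) (h : IsRadialSystem d α β u w q m)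
    (hw : Tendsto w atTop (𝓝 0)) :
    ∃ C, 0 < C ∧ ∀ r, 0 < r → r ^ (4 + α) * Real.exp (u r) ≤ C := by
  have hd' : (2 : ℝ) ≤ d := by exact_mod_cast hd
  have hc1 : 0 < (d : ℝ) + α + 1 := by linarith
  have hc2 : 0 < (d : ℝ) + (2 + α) + 1 := by linarith
  have hd1 : 0 < (d : ℝ) - 1 := by linarith
  have hm : ∀ r, 0 < r → Real.exp (u r) * (r ^ (d + α + 1) / (d + α + 1)) ≤ m r := by
    intro r hr
    rw [h.m_eq hd hα hr, ← IsRadialSource.radialFlux_rpow hα hd hr,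
      ← IsRadialSource.radialFlux_const_mul]
    refine ((IsRadialSource.rpow α).const_mul _).radialFlux_mono hd hα
      (h.source_u.rpow_mul_exp α) hr
      fun t ht => ?_
    rw [mul_comm]
    exact mul_le_mul_of_nonneg_left (Real.exp_le_exp.mpr (h.antitoneOn_u ht.1 hr ht.2.le))
      (Real.rpow_nonneg ht.1.le _)
  set c1 : ℝ := 1 / ((d + α + 1) * (d - 1)) with hc1def
  have hc10 : 0 < c1 := by positivity
  have hwl : ∀ r, 0 < r → c1 * Real.exp (u r) * r ^ (2 + α) ≤ -w r := by
    intro r hr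
    have h1 := h.m_le hd hw hr
    have h2 : Real.exp (u r) * (r ^ (d + α + 1) / (d + α + 1)) * r / r ^ d
        ≤ m r * r / r ^ d := by
      have := hm r hr
      gcongr
    have e : Real.exp (u r) * (r ^ (d + α + 1) / (d + α + 1)) * r / r ^ d
        = (d - 1) * (c1 * Real.exp (u r) * r ^ (2 + α)) := by
      rw [show (d : ℝ) + α + 1 = (d : ℝ) + (1 + α) by ring, Real.rpow_add hr, Real.rpow_natCast,
        show (2 : ℝ) + α = 1 + (1 + α) by ring, Real.rpow_add hr 1 (1 + α), Real.rpow_one, hc1def]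
      have := (pow_pos hr d).ne'
      have : (d : ℝ) + (1 + α) ≠ 0 := by linarith
      field_simp
      ring
    rw [e] at h2
    exact le_of_mul_le_mul_left (h2.trans h1) hd1
  set c2 : ℝ := c1 / (d + (2 + α) + 1) with hc2def
  have hc20 : 0 < c2 := by positivity
  have hq : ∀ r, 0 < r → c2 * Real.exp (u r) * r ^ (3 + α) ≤ -(q r / r ^ d) := by
    intro r hr
    have h1 : radialFlux d (fun t => (c1 * Real.exp (u r)) * t ^ (2 + α)) r
        ≤ radialFlux d (fun t => (-1) * w t) r := by
      have hs : IsRadialSource (0 : ℝ) fun t : ℝ => t ^ (2 + α) := by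
        refine ⟨(IsRadialSource.rpow (2 + α)).aestronglyMeasurable, fun R =>
          ⟨R ^ (2 + α), fun t ht => ?_⟩⟩
        rw [abs_of_nonneg (Real.rpow_nonneg ht.1.le _), Real.rpow_zero, mul_one]
        exact Real.rpow_le_rpow ht.1.le ht.2 (by linarith)
      refine (hs.const_mul _).radialFlux_mono hd (by norm_num) (h.source_w.const_mul _) hr
        fun t ht => ?_
      have h2 := hwl t ht.1
      have h3 : c1 * Real.exp (u r) * t ^ (2 + α) ≤ c1 * Real.exp (u t) * t ^ (2 + α) := by
        have := Real.exp_le_exp.mpr (h.antitoneOn_u ht.1 hr ht.2.le)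
        have := Real.rpow_nonneg ht.1.le (2 + α)
        gcongr
      linarith
    rw [IsRadialSource.radialFlux_const_mul, IsRadialSource.radialFlux_const_mul,
      IsRadialSource.radialFlux_rpow (by linarith) hd hr, ← h.q_eq hd hr] at h1
    have h2 : c1 * Real.exp (u r) * (r ^ (d + (2 + α) + 1) / (d + (2 + α) + 1)) / r ^ d
        ≤ (-1) * q r / r ^ d := div_le_div_of_nonneg_right h1 (pow_pos hr d).le
    have e : c1 * Real.exp (u r) * (r ^ (d + (2 + α) + 1) / (d + (2 + α) + 1)) / r ^ d
        = c2 * Real.exp (u r) * r ^ (3 + α) := by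
      rw [show (d : ℝ) + (2 + α) + 1 = (d : ℝ) + (3 + α) by ring, Real.rpow_add hr,
        Real.rpow_natCast, hc2def]
      have := (pow_pos hr d).ne'
      have : (d : ℝ) + (3 + α) ≠ 0 := by linarith
      field_simp
      ring
    rw [e] at h2
    rw [← neg_div, neg_eq_neg_one_mul]
    exact h2
  have hα4 : 0 < 4 + α := by linarith
  have hmono : MonotoneOn (fun r => Real.exp (-u r) - c2 / (4 + α) * r ^ (4 + α)) (Ioi 0) := by
    refine monotoneOn_Ioi_of_hasDerivAt (fun r hr => ((h.deriv_u r hr).fun_neg.exp).fun_sub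
      ((Real.hasDerivAt_rpow_const (Or.inl hr.ne')).const_mul _)) fun r hr => ?_
    have h1 := mul_le_mul_of_nonneg_left (hq r hr) (Real.exp_pos (-u r)).le
    have h2 : Real.exp (-u r) * (c2 * Real.exp (u r) * r ^ (3 + α)) = c2 * r ^ (3 + α) := by
      have : Real.exp (-u r) * Real.exp (u r) = 1 := by rw [← Real.exp_add]; simp
      linear_combination c2 * r ^ (3 + α) * this
    rw [show 4 + α - 1 = 3 + α by ring, ← mul_assoc, div_mul_cancel₀ _ hα4.ne']
    linarith
  have hlim : Tendsto (fun r => Real.exp (-u r) - c2 / (4 + α) * r ^ (4 + α)) (𝓝[>] 0)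
      (𝓝 (Real.exp (-0) - c2 / (4 + α) * 0 ^ (4 + α))) := by
    refine ((Real.continuous_exp.tendsto _).comp h.tendsto_u.neg).sub (Tendsto.const_mul _ ?_)
    exact ((Real.continuousAt_rpow_const 0 (4 + α) (Or.inr hα4.le)).tendsto).mono_left
      nhdsWithin_le_nhds
  rw [Real.zero_rpow hα4.ne', mul_zero, neg_zero, Real.exp_zero, sub_zero] at hlim
  refine ⟨(4 + α) / c2, by positivity, fun r hr => ?_⟩
  have h1 := hmono.le_of_tendsto_nhdsGT hlim hr
  have h2 : c2 / (4 + α) * r ^ (4 + α) ≤ Real.exp (-u r) := by linarith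
  rw [le_div_iff₀ hc20]
  have h3 := mul_le_mul_of_nonneg_right h2 (mul_nonneg hα4.le (Real.exp_pos (u r)).le)
  have h4 : Real.exp (-u r) * Real.exp (u r) = 1 := by rw [← Real.exp_add]; simp
  have h5 : c2 / (4 + α) * r ^ (4 + α) * ((4 + α) * Real.exp (u r))
      = r ^ (4 + α) * Real.exp (u r) * c2 := by field_simp
  rw [h5] at h3
  linear_combination h3 + (4 + α) * h4

end IsRadialSystem

/-! ### The autonomous system in the logarithmic variable -/

/-- The Emden-Fowler form of the equation: with `s = log r` and `k = 4 + α`, the quantities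
`a = r u'`, `b = r² Δu`, `c = r³ (Δu)'` and `e = r^k e^u` solve an autonomous polynomial system.
The sign conditions and the bound `c ≤ (d - 1) (-b)` hold for solutions on the half-line with
`Δu → 0`. -/
structure IsLogSystem (d k : ℝ) (U a b c e : ℝ → ℝ) : Prop where
  deriv_U : ∀ s, HasDerivAt U (a s) s
  deriv_a : ∀ s, HasDerivAt a (b s - (d - 1) * a s) s
  deriv_b : ∀ s, HasDerivAt b (2 * b s + c s) s
  deriv_c : ∀ s, HasDerivAt c ((3 - d) * c s + e s) s
  deriv_e : ∀ s, HasDerivAt e ((k + a s) * e s) s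
  e_eq : ∀ s, e s = Real.exp (k * s + U s)
  a_nonpos : ∀ s, a s ≤ 0
  c_pos : ∀ s, 0 < c s
  c_le : ∀ s, c s ≤ (d - 1) * -b s
  tendsto_exp_mul_b : Tendsto (fun s => Real.exp (-2 * s) * b s) atTop (𝓝 0)

theorem HasDerivAt.comp_exp {f : ℝ → ℝ} {f' s : ℝ} (hf : HasDerivAt f f' (Real.exp s)) :
    HasDerivAt (fun s => f (Real.exp s)) (Real.exp s * f') s := by
  rw [mul_comm]
  exact hf.comp s (Real.hasDerivAt_exp s)

theorem IsRadialSystem.isLogSystem {d : ℕ} {α β : ℝ} {u w q m : ℝ → ℝ} (hd : 2 ≤ d)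
    (h : IsRadialSystem d α β u w q m) (hw : Tendsto w atTop (𝓝 0)) :
    IsLogSystem d (4 + α) (fun s => u (Real.exp s))
      (fun s => (fun r => r * q r / r ^ d) (Real.exp s))
      (fun s => (fun r => r ^ 2 * w r) (Real.exp s))
      (fun s => (fun r => r ^ 3 * m r / r ^ d) (Real.exp s))
      (fun s => Real.exp ((4 + α) * s + u (Real.exp s))) := by
  obtain ⟨k, rfl⟩ : ∃ k, d = k + 1 := ⟨d - 1, by omega⟩
  have hpos : ∀ s, 0 < Real.exp s := Real.exp_pos
  have hU : ∀ s, HasDerivAt (fun s => u (Real.exp s))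
      ((fun r => r * q r / r ^ (k + 1)) (Real.exp s)) s := fun s => by
    refine (h.deriv_u _ (hpos s)).comp_exp.congr_deriv ?_
    simp only
    ring
  refine ⟨hU, fun s => ?_, fun s => ?_, fun s => ?_, fun s => ?_, fun s => rfl, fun s => ?_,
    fun s => ?_, fun s => ?_, ?_⟩
  · have hr := hpos s
    refine (((hasDerivAt_id' _).fun_mul (h.deriv_q _ hr)).fun_div (hasDerivAt_pow (k + 1) _)
      (pow_pos hr _).ne').comp_exp.congr_deriv ?_
    push_cast
    field_simp
    ring
  · have hr := hpos s
    refine ((hasDerivAt_pow 2 _).fun_mul (h.deriv_w _ hr)).comp_exp.congr_deriv ?_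
    push_cast
    field_simp
  · have hr := hpos s
    refine (((hasDerivAt_pow 3 _).fun_mul (h.deriv_m _ hr)).fun_div (hasDerivAt_pow (k + 1) _)
      (pow_pos hr _).ne').comp_exp.congr_deriv ?_
    have e1 : Real.exp ((4 + α) * s + u (Real.exp s))
        = Real.exp s ^ 4 * (Real.exp s ^ α * Real.exp (u (Real.exp s))) := by
      rw [← Real.exp_mul, ← Real.exp_nat_mul, ← Real.exp_add, ← Real.exp_add]
      congr 1
      push_cast
      ring
    rw [e1]
    push_cast
    field_simp
    ring
  · refine (((hasDerivAt_id' s).const_mul (4 + α)).fun_add (hU s)).exp.congr_deriv ?_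
    ring
  · exact div_nonpos_of_nonpos_of_nonneg
      (mul_nonpos_of_nonneg_of_nonpos (hpos s).le (h.q_nonpos (hpos s))) (pow_pos (hpos s) _).le
  · exact div_pos (mul_pos (pow_pos (hpos s) 3) (h.m_pos (hpos s))) (pow_pos (hpos s) _)
  · have h1 := mul_le_mul_of_nonneg_left (h.m_le hd hw (hpos s)) (pow_pos (hpos s) 2).le
    simp only at h1 ⊢
    refine (le_of_eq ?_).trans (h1.trans (le_of_eq ?_)) <;> ring
  · refine (hw.comp Real.tendsto_exp_atTop).congr fun s => ?_
    have : Real.exp (-2 * s) * Real.exp s ^ 2 = 1 := by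
      rw [← Real.exp_nat_mul, ← Real.exp_add, Real.exp_eq_one_iff]
      push_cast
      ring
    simp only [Function.comp]
    rw [← mul_assoc, this, one_mul]

/-- A Barbalat-type lemma: over a short interval the mean value of `f'` is small by convergence of
`f`, and `f'` deviates little from it because `f''` is bounded. -/
theorem tendsto_deriv_zero_of_tendsto {f f' f'' : ℝ → ℝ} {L : ℝ} (hf : ∀ s, HasDerivAt f (f' s) s)
    (hf' : ∀ s, HasDerivAt f' (f'' s) s) (hL : Tendsto f atTop (𝓝 L))
    (hb : f'' =O[atTop] fun _ => (1 : ℝ)) : Tendsto f' atTop (𝓝 0) := by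
  obtain ⟨K, hK0, hK⟩ := hb.exists_pos
  obtain ⟨S, hS⟩ := eventually_atTop.mp hK.bound
  rw [Metric.tendsto_atTop]
  intro ε hε
  set δ := ε / (4 * K) with hδ
  have hδ0 : 0 < δ := by positivity
  have hdiff : Tendsto (fun s => f (s + δ) - f s) atTop (𝓝 (L - L)) :=
    (hL.comp (tendsto_atTop_add_const_right _ δ tendsto_id)).sub hL
  rw [sub_self] at hdiff
  obtain ⟨S', hS'⟩ := Metric.tendsto_atTop.mp hdiff (δ * (ε / 2)) (by positivity)
  refine ⟨max S S', fun s hs => ?_⟩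
  have hsδ : s < s + δ := by linarith
  obtain ⟨ξ, hξ, hξ'⟩ := exists_hasDerivAt_eq_slope f f' hsδ
    (fun t _ => (hf t).continuousAt.continuousWithinAt) fun t _ => hf t
  obtain ⟨ζ, hζ, hζ'⟩ := exists_hasDerivAt_eq_slope f' f'' hξ.1
    (fun t _ => (hf' t).continuousAt.continuousWithinAt) fun t _ => hf' t
  have h1 := hS' s ((le_max_right _ _).trans hs)
  rw [Real.dist_eq, sub_zero] at h1
  have h2 : |f' ξ| < ε / 2 := by
    rw [hξ', add_sub_cancel_left, abs_div, abs_of_pos hδ0, div_lt_iff₀ hδ0]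
    linarith
  have h3 := hS ζ ((le_max_left _ _).trans (hs.trans hζ.1.le))
  rw [norm_one, mul_one, Real.norm_eq_abs, hζ', abs_div,
    abs_of_pos (sub_pos.mpr hξ.1), div_le_iff₀ (sub_pos.mpr hξ.1)] at h3
  have h4 : K * (ξ - s) ≤ ε / 4 := by
    calc K * (ξ - s) ≤ K * δ := by gcongr; linarith [hξ.2]
      _ = ε / 4 := by rw [hδ]; field_simp
  rw [Real.dist_eq, sub_zero]
  have h5 : |f' s| ≤ |f' ξ| + |f' ξ - f' s| := by
    have := abs_sub (f' ξ) (f' ξ - f' s)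
    rwa [sub_sub_cancel] at this
  linarith

/-- A forward bound for `y' ≤ -l y + C`. -/
theorem exists_le_of_deriv_le {y y' : ℝ → ℝ} {l C : ℝ} (hl : 0 < l)
    (hy : ∀ s, HasDerivAt y (y' s) s) (hle : ∀ s, 0 ≤ s → y' s ≤ -l * y s + C) :
    ∃ M, ∀ s, 0 ≤ s → y s ≤ M := by
  have h1 : MonotoneOn (fun s => Real.exp (l * s) * (C / l - y s)) (Ici 0) := by
    refine monotoneOn_Ici_of_hasDerivAt (fun s _ => (((hasDerivAt_id' s).const_mul l).exp).fun_mul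
      ((hy s).const_sub (C / l))) fun s hs => ?_
    have e : Real.exp (l * s) * (l * 1) * (C / l - y s) + Real.exp (l * s) * -y' s
        = Real.exp (l * s) * (-l * y s + C - y' s) := by field_simp; ring
    rw [e]
    exact mul_nonneg (Real.exp_pos _).le (sub_nonneg.mpr (hle s hs))
  refine ⟨C / l + |C / l - y 0|, fun s hs => ?_⟩
  have h2 := h1 self_mem_Ici hs hs
  simp only [mul_zero, Real.exp_zero, one_mul] at h2
  by_contra! hcon
  have h3 : 1 ≤ Real.exp (l * s) := Real.one_le_exp (by positivity)
  have h4 : C / l - y s < -|C / l - y 0| := by linarith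
  have h5 : Real.exp (l * s) * (C / l - y s) ≤ 1 * (C / l - y s) :=
    mul_le_mul_of_nonpos_right h3 (h4.le.trans (neg_nonpos.mpr (abs_nonneg _)))
  have := neg_abs_le (C / l - y 0)
  linarith

theorem isBigO_one_of_forall_abs_le {f : ℝ → ℝ} {C : ℝ} (hf : ∀ s, 0 ≤ s → |f s| ≤ C) :
    f =O[atTop] fun _ => (1 : ℝ) := by
  refine IsBigO.of_bound C ?_
  filter_upwards [eventually_ge_atTop 0] with s hs
  simpa using hf s hs

namespace IsLogSystem

variable {d k : ℝ} {U a b c e : ℝ → ℝ}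

theorem e_pos (h : IsLogSystem d k U a b c e) (s : ℝ) : 0 < e s := by
  rw [h.e_eq]
  exact Real.exp_pos _

theorem b_nonpos (h : IsLogSystem d k U a b c e) (hd : 1 < d) (s : ℝ) : b s ≤ 0 := by
  have h1 := (h.c_pos s).le.trans (h.c_le s)
  have := nonneg_of_mul_nonneg_right h1 (sub_pos.mpr hd)
  linarith

/-- An upper bound for `c` gives a lower bound for `b`, because `Δu → 0` at infinity. -/
theorem neg_b_le (h : IsLogSystem d k U a b c e) {C : ℝ} {s₀ : ℝ} (hC : ∀ s, s₀ ≤ s → c s ≤ C)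
    {s : ℝ} (hs : s₀ ≤ s) : -b s ≤ C / 2 := by
  have h1 : MonotoneOn (fun t => -(Real.exp (-2 * t) * (b t + C / 2))) (Ici s) := by
    refine monotoneOn_Ici_of_hasDerivAt (fun t _ =>
      ((((hasDerivAt_id' t).const_mul (-2)).exp).fun_mul
        ((h.deriv_b t).add_const (C / 2))).fun_neg) fun t ht => ?_
    have e : -(Real.exp (-2 * t) * (-2 * 1) * (b t + C / 2) + Real.exp (-2 * t) * (2 * b t + c t))
        = Real.exp (-2 * t) * (C - c t) := by ring
    rw [e]
    exact mul_nonneg (Real.exp_pos _).le (sub_nonneg.mpr (hC t (hs.trans ht)))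
  have h2 : Tendsto (fun t => -(Real.exp (-2 * t) * (b t + C / 2))) atTop (𝓝 (-(0 + 0))) := by
    have h3 : Tendsto (fun t : ℝ => Real.exp (-2 * t) * (C / 2)) atTop (𝓝 (0 * (C / 2))) :=
      (Real.tendsto_exp_atBot.comp (tendsto_id.const_mul_atTop_of_neg (by norm_num))).mul_const _
    rw [zero_mul] at h3
    refine (h.tendsto_exp_mul_b.add h3).neg.congr fun t => ?_
    ring
  rw [add_zero, neg_zero] at h2
  have h3 : -(Real.exp (-2 * s) * (b s + C / 2)) ≤ 0 := by
    refine ge_of_tendsto h2 ?_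
    filter_upwards [eventually_ge_atTop s] with t ht using h1 self_mem_Ici ht ht
  have h4 := nonneg_of_mul_nonneg_right (neg_nonpos.mp h3) (Real.exp_pos (-2 * s))
  linarith

/-- In dimension at least five a bounded `e` tends to its equilibrium value. The energy of the
autonomous fourth-order equation for `U + k s` is nondecreasing and bounded above, so its
derivative, a positive definite quadratic form in the first two derivatives, tends to zero. -/
theorem tendsto_e (h : IsLogSystem d k U a b c e) (hd : 3 < d) (hk : 0 < k) {C : ℝ}
    (hC : ∀ s, e s ≤ C) : Tendsto e atTop (𝓝 (2 * k * (d - 1) * (d - 3))) := by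
  have oadd : ∀ {f g : ℝ → ℝ}, f =O[atTop] (fun _ => (1 : ℝ)) → g =O[atTop] (fun _ => (1 : ℝ)) →
      (fun s => f s + g s) =O[atTop] fun _ => (1 : ℝ) := fun hf hg => hf.add hg
  have omul : ∀ {f g : ℝ → ℝ}, f =O[atTop] (fun _ => (1 : ℝ)) → g =O[atTop] (fun _ => (1 : ℝ)) →
      (fun s => f s * g s) =O[atTop] fun _ => (1 : ℝ) := fun hf hg => by simpa using hf.mul hg
  have oconst : ∀ {f : ℝ → ℝ} (x : ℝ), f =O[atTop] (fun _ => (1 : ℝ)) →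
      (fun s => x * f s) =O[atTop] fun _ => (1 : ℝ) := fun x hf => hf.const_mul_left x
  have osub : ∀ {f g : ℝ → ℝ}, f =O[atTop] (fun _ => (1 : ℝ)) → g =O[atTop] (fun _ => (1 : ℝ)) →
      (fun s => f s - g s) =O[atTop] fun _ => (1 : ℝ) := fun hf hg => hf.sub hg
  -- `c` and `-a` satisfy inequalities `y' ≤ -l y + C` with `l > 0`; `b` does not, but it is
  -- controlled by `c` because `Δu → 0`
  have oe : e =O[atTop] fun _ => (1 : ℝ) := isBigO_one_of_forall_abs_le fun s _ => by
    rw [abs_of_pos (h.e_pos s)]; exact hC s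
  obtain ⟨Mc, hMc⟩ := exists_le_of_deriv_le (l := d - 3) (C := C) (by linarith) h.deriv_c
    fun s _ => by linarith [hC s]
  have oc : c =O[atTop] fun _ => (1 : ℝ) := isBigO_one_of_forall_abs_le fun s hs => by
    rw [abs_of_pos (h.c_pos s)]; exact hMc s hs
  have hMb : ∀ s, 0 ≤ s → -b s ≤ Mc / 2 := fun s hs => h.neg_b_le hMc hs
  have ob : b =O[atTop] fun _ => (1 : ℝ) := isBigO_one_of_forall_abs_le fun s hs => by
    rw [abs_of_nonpos (h.b_nonpos (by linarith) s)]; exact hMb s hs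
  obtain ⟨Ma, hMa⟩ := exists_le_of_deriv_le (y := fun s => -a s) (l := d - 1) (C := Mc / 2)
    (by linarith) (fun s => (h.deriv_a s).fun_neg) fun s hs => by linarith [hMb s hs]
  have oa : a =O[atTop] fun _ => (1 : ℝ) := isBigO_one_of_forall_abs_le fun s hs => by
    rw [abs_of_nonpos (h.a_nonpos s)]; exact hMa s hs
  -- `x₁, …, x₅` are the successive derivatives of `v = U + k s`
  set x₁ : ℝ → ℝ := fun s => a s + k with hx₁
  set x₂ : ℝ → ℝ := fun s => b s - (d - 1) * a s with hx₂
  set x₃ : ℝ → ℝ := fun s => 2 * b s + c s - (d - 1) * x₂ s with hx₃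
  set x₄ : ℝ → ℝ := fun s => 2 * (2 * b s + c s) + ((3 - d) * c s + e s) - (d - 1) * x₃ s with hx₄
  set x₅ : ℝ → ℝ := fun s => 2 * (2 * (2 * b s + c s) + ((3 - d) * c s + e s))
    + ((3 - d) * ((3 - d) * c s + e s) + (k + a s) * e s) - (d - 1) * x₄ s with hx₅
  have dx₁ : ∀ s, HasDerivAt x₁ (x₂ s) s := fun s => (h.deriv_a s).add_const k
  have dx₂ : ∀ s, HasDerivAt x₂ (x₃ s) s := fun s =>
    (h.deriv_b s).fun_sub ((h.deriv_a s).const_mul (d - 1))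
  have dx₃ : ∀ s, HasDerivAt x₃ (x₄ s) s := fun s =>
    (((h.deriv_b s).const_mul 2).fun_add (h.deriv_c s)).fun_sub ((dx₂ s).const_mul (d - 1))
  have dx₄ : ∀ s, HasDerivAt x₄ (x₅ s) s := fun s =>
    (((((h.deriv_b s).const_mul 2).fun_add (h.deriv_c s)).const_mul 2).fun_add
      (((h.deriv_c s).const_mul (3 - d)).fun_add (h.deriv_e s))).fun_sub
      ((dx₃ s).const_mul (d - 1))
  have ox₁ : x₁ =O[atTop] fun _ => (1 : ℝ) := oadd oa
    ((oconst k (isBigO_refl _ _)).congr_left fun _ => mul_one k)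
  have ox₂ : x₂ =O[atTop] fun _ => (1 : ℝ) := osub ob (oconst _ oa)
  have ox₃ : x₃ =O[atTop] fun _ => (1 : ℝ) := osub (oadd (oconst 2 ob) oc) (oconst _ ox₂)
  have oce : (fun s => (3 - d) * c s + e s) =O[atTop] fun _ => (1 : ℝ) := oadd (oconst _ oc) oe
  have obc : (fun s => 2 * b s + c s) =O[atTop] fun _ => (1 : ℝ) := oadd (oconst _ ob) oc
  have ox₄ : x₄ =O[atTop] fun _ => (1 : ℝ) := osub (oadd (oconst 2 obc) oce) (oconst _ ox₃)
  have oke : (fun s => (k + a s) * e s) =O[atTop] fun _ => (1 : ℝ) :=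
    omul (ox₁.congr_left fun s => add_comm _ _) oe
  have ox₅ : x₅ =O[atTop] fun _ => (1 : ℝ) :=
    osub (oadd (oconst 2 (oadd (oconst 2 obc) oce)) (oadd (oconst _ oce) oke)) (oconst _ ox₄)
  -- the energy: multiply the fourth-order equation for `v` by `v'` and collect total derivatives
  set A : ℝ := 2 * (d - 3) with hA
  set B : ℝ := d ^ 2 - 8 * d + 11 with hB
  set D : ℝ := 2 * (d - 1) * (d - 3) with hD
  have hA0 : 0 < A := by rw [hA]; linarith
  have hD0 : 0 < D := by rw [hD]; exact mul_pos (by linarith) (by linarith)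
  have hx₄e : ∀ s, x₄ s = e s - k * D - A * x₃ s - B * x₂ s + D * x₁ s := fun s => by
    simp only [hx₄, hx₃, hx₂, hx₁, hA, hB, hD]
    ring
  set E : ℝ → ℝ := fun s => x₃ s * x₁ s - 1 / 2 * x₂ s ^ 2 + A * (x₂ s * x₁ s)
    + B / 2 * x₁ s ^ 2 - e s + k * D * (U s + k * s) with hE
  have dE : ∀ s, HasDerivAt E (D * x₁ s ^ 2 + A * x₂ s ^ 2) s := fun s => by
    refine (((((((dx₃ s).fun_mul (dx₁ s)).fun_sub (((dx₂ s).fun_pow 2).const_mul (1 / 2))).fun_add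
      (((dx₂ s).fun_mul (dx₁ s)).const_mul A)).fun_add (((dx₁ s).fun_pow 2).const_mul
      (B / 2))).fun_sub (h.deriv_e s)).fun_add (((h.deriv_U s).fun_add
      ((hasDerivAt_id' s).const_mul k)).const_mul (k * D))).congr_deriv ?_
    rw [hx₄e s]
    have : a s = x₁ s - k := by simp only [hx₁]; ring
    rw [this]
    push_cast
    ring
  have dE' : ∀ s, HasDerivAt (fun s => D * x₁ s ^ 2 + A * x₂ s ^ 2)
      (D * (2 * (x₁ s * x₂ s)) + A * (2 * (x₂ s * x₃ s))) s := fun s => by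
    refine ((((dx₁ s).fun_pow 2).const_mul D).fun_add (((dx₂ s).fun_pow 2).const_mul
      A)).congr_deriv ?_
    push_cast
    ring
  have hEmono : Monotone E := by
    refine monotone_of_deriv_nonneg (fun s => (dE s).differentiableAt) fun s => ?_
    rw [(dE s).deriv]
    positivity
  have hC0 : 0 < C := (h.e_pos 0).trans_le (hC 0)
  have hEbdd : BddAbove (range E) := by
    have o1 : (fun s => x₃ s * x₁ s - 1 / 2 * x₂ s ^ 2 + A * (x₂ s * x₁ s)
        + B / 2 * x₁ s ^ 2) =O[atTop] fun _ => (1 : ℝ) := by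
      simp only [pow_two]
      exact oadd (oadd (osub (omul ox₃ ox₁) (oconst _ (omul ox₂ ox₂)))
        (oconst _ (omul ox₂ ox₁))) (oconst _ (omul ox₁ ox₁))
    obtain ⟨K, hK⟩ := o1.bound
    obtain ⟨S, hS⟩ := eventually_atTop.mp hK
    refine ⟨K + k * D * Real.log C, ?_⟩
    rintro _ ⟨s, rfl⟩
    refine (hEmono (le_max_right S s)).trans ?_
    set t := max S s
    have h1 := hS t (le_max_left _ _)
    rw [norm_one, mul_one] at h1
    have h2 : U t + k * t ≤ Real.log C := by
      rw [Real.le_log_iff_exp_le hC0, add_comm, ← h.e_eq]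
      exact hC t
    have h3 := mul_le_mul_of_nonneg_left h2 (mul_pos hk hD0).le
    have h4 := (le_abs_self _).trans h1
    have h5 := h.e_pos t
    simp only [hE]
    linarith
  have hElim := tendsto_atTop_ciSup hEmono hEbdd
  have hE'0 := tendsto_deriv_zero_of_tendsto dE dE' hElim
    (oadd (oconst _ (oconst _ (omul ox₁ ox₂))) (oconst _ (oconst _ (omul ox₂ ox₃))))
  have sq_lim : ∀ {x : ℝ → ℝ} {l : ℝ}, 0 < l →
      (∀ s, l * x s ^ 2 ≤ D * x₁ s ^ 2 + A * x₂ s ^ 2) → Tendsto x atTop (𝓝 0) := by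
    intro x l hl hx
    have h1 : Tendsto (fun s => x s ^ 2) atTop (𝓝 0) := by
      refine squeeze_zero (fun s => sq_nonneg _)
        (g := fun s => l⁻¹ * (D * x₁ s ^ 2 + A * x₂ s ^ 2)) (fun s => ?_) ?_
      · rw [← div_eq_inv_mul, le_div_iff₀ hl, mul_comm]
        exact hx s
      · simpa using hE'0.const_mul l⁻¹
    have h2 := (Real.continuous_sqrt.tendsto _).comp h1
    rw [Real.sqrt_zero] at h2
    refine tendsto_zero_iff_abs_tendsto_zero _ |>.mpr (h2.congr fun s => ?_)
    exact Real.sqrt_sq_eq_abs _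
  have lx₁ : Tendsto x₁ atTop (𝓝 0) := sq_lim hD0 fun s => by
    have := mul_nonneg hA0.le (sq_nonneg (x₂ s)); linarith
  have lx₂ : Tendsto x₂ atTop (𝓝 0) := sq_lim hA0 fun s => by
    have := mul_nonneg hD0.le (sq_nonneg (x₁ s)); linarith
  have lx₃ : Tendsto x₃ atTop (𝓝 0) := tendsto_deriv_zero_of_tendsto dx₂ dx₃ lx₂ ox₄
  have lx₄ : Tendsto x₄ atTop (𝓝 0) := tendsto_deriv_zero_of_tendsto dx₃ dx₄ lx₃ ox₅
  have hlim : Tendsto (fun s => x₄ s + k * D + A * x₃ s + B * x₂ s - D * x₁ s) atTop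
      (𝓝 (0 + k * D + A * 0 + B * 0 - D * 0)) :=
    (((lx₄.add_const _).add (lx₃.const_mul A)).add (lx₂.const_mul B)).sub (lx₁.const_mul D)
  rw [show 2 * k * (d - 1) * (d - 3) = 0 + k * D + A * 0 + B * 0 - D * 0 by rw [hD]; ring]
  refine hlim.congr fun s => ?_
  rw [hx₄e s]
  ring

end IsLogSystem

/-- Logarithmic behaviour in dimension `d + 1 ≥ 5`. -/
theorem IsRadialSystem.tendsto_add_log {d : ℕ} {α β : ℝ} {u w q m : ℝ → ℝ} (hd : 4 ≤ d)
    (hα : -2 < α) (h : IsRadialSystem d α β u w q m) (hw : Tendsto w atTop (𝓝 0)) :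
    Tendsto (fun r => u r + (4 + α) * Real.log r) atTop
      (𝓝 (Real.log (2 * (4 + α) * (d - 1) * (d - 3)))) := by
  have hd' : (4 : ℝ) ≤ d := by exact_mod_cast hd
  obtain ⟨C, -, hC⟩ := h.exists_rpow_mul_exp_le (by omega) hα hw
  have h1 := (h.isLogSystem (by omega) hw).tendsto_e (by linarith) (by linarith) (C := C)
    fun s => by
      have := hC (Real.exp s) (Real.exp_pos s)
      rwa [← Real.exp_mul, ← Real.exp_add, mul_comm s] at this
  have hpos : 0 < 2 * (4 + α) * ((d : ℝ) - 1) * (d - 3) :=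
    mul_pos (mul_pos (by linarith) (by linarith)) (by linarith)
  have h2 := ((Real.continuousAt_log hpos.ne').tendsto.comp h1).comp Real.tendsto_log_atTop
  refine h2.congr' ?_
  filter_upwards [eventually_gt_atTop 0] with r hr
  simp only [Function.comp, Real.log_exp, Real.exp_log hr]
  ring

/-! ### Dimension four -/

/-- Solutions of `y' = f - l y` with `l > 0` forget their initial value exponentially fast, so only
the limit of `f` matters. This one-sided version, applied to `y` and `-y`, gives the limit. -/
theorem eventually_le_of_deriv_eq {y f : ℝ → ℝ} {l F ε : ℝ} (hl : 0 < l)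
    (hy : ∀ s, HasDerivAt y (f s - l * y s) s) (hf : Tendsto f atTop (𝓝 F)) (hε : 0 < ε) :
    ∀ᶠ s in atTop, y s < F / l + ε := by
  have hlε : 0 < l * (ε / 2) := by positivity
  obtain ⟨S, hS⟩ := eventually_atTop.mp (hf.eventually_le_const (by linarith : F < F + l * (ε / 2)))
  have h1 : MonotoneOn (fun s => Real.exp (l * s) * (F / l + ε / 2 - y s)) (Ici S) := by
    refine monotoneOn_Ici_of_hasDerivAt (fun s _ => (((hasDerivAt_id' s).const_mul l).exp).fun_mul
      ((hy s).const_sub (F / l + ε / 2))) fun s hs => ?_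
    have e : Real.exp (l * s) * (l * 1) * (F / l + ε / 2 - y s)
        + Real.exp (l * s) * -(f s - l * y s)
        = Real.exp (l * s) * (F + l * (ε / 2) - f s) := by field_simp; ring
    rw [e]
    exact mul_nonneg (Real.exp_pos _).le (sub_nonneg.mpr (hS s hs))
  set K := Real.exp (l * S) * (F / l + ε / 2 - y S) with hK
  have h2 : Tendsto (fun s => Real.exp (-(l * s)) * K) atTop (𝓝 (0 * K)) :=
    (Real.tendsto_exp_neg_atTop_nhds_zero.comp (tendsto_id.const_mul_atTop hl)).mul_const K
  rw [zero_mul] at h2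
  filter_upwards [eventually_ge_atTop S,
    h2.eventually_const_lt (by linarith : -(ε / 2) < 0)] with s hs hs2
  have h3 := mul_le_mul_of_nonneg_left (h1 self_mem_Ici hs hs) (Real.exp_pos (-(l * s))).le
  have h4 : Real.exp (-(l * s)) * Real.exp (l * s) = 1 := by rw [← Real.exp_add]; simp
  simp only [← mul_assoc, h4, one_mul] at h3
  rw [mul_assoc] at h3
  change Real.exp (-(l * s)) * K ≤ _ at h3
  linarith

theorem tendsto_of_deriv_eq {y f : ℝ → ℝ} {l F : ℝ} (hl : 0 < l)
    (hy : ∀ s, HasDerivAt y (f s - l * y s) s) (hf : Tendsto f atTop (𝓝 F)) :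
    Tendsto y atTop (𝓝 (F / l)) := by
  refine tendsto_order.mpr ⟨fun x hx => ?_, fun x hx => ?_⟩
  · filter_upwards [eventually_le_of_deriv_eq (y := fun s => -y s) (f := fun s => -f s) hl
      (fun s => (hy s).fun_neg.congr_deriv (by ring)) hf.neg (sub_pos.mpr hx)] with s hs
    rw [neg_div] at hs
    linarith
  · filter_upwards [eventually_le_of_deriv_eq hl hy hf (sub_pos.mpr hx)] with s hs
    linarith

namespace IsLogSystem

variable {k : ℝ} {U a b c e : ℝ → ℝ}

theorem deriv_c_three (h : IsLogSystem 3 k U a b c e) (s : ℝ) : HasDerivAt c (e s) s :=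
  (h.deriv_c s).congr_deriv (by ring)

theorem deriv_a_three (h : IsLogSystem 3 k U a b c e) (s : ℝ) :
    HasDerivAt a (b s - 2 * a s) s :=
  (h.deriv_a s).congr_deriv (by ring)

theorem monotone_c (h : IsLogSystem 3 k U a b c e) : Monotone c :=
  monotone_of_deriv_nonneg (fun s => (h.deriv_c_three s).differentiableAt) fun s => by
    rw [(h.deriv_c_three s).deriv]
    exact (h.e_pos s).le

/-- In dimension four the total mass is finite: a large value of `c` would force `u` to decay so
fast that `c + e` is eventually nonincreasing. -/
theorem exists_c_le (h : IsLogSystem 3 k U a b c e) (hk : 0 < k) : ∃ M, ∀ s, c s ≤ M := by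
  by_cases hex : ∃ s₀, 8 * (k + 1) ≤ c s₀
  · obtain ⟨s₀, hs₀⟩ := hex
    have h1 : MonotoneOn (fun s => Real.exp (2 * s) * (-a s - c s₀ / 4)) (Ici s₀) := by
      refine monotoneOn_Ici_of_hasDerivAt (fun s _ =>
        (((hasDerivAt_id' s).const_mul 2).exp).fun_mul
          (((h.deriv_a_three s).fun_neg).sub_const (c s₀ / 4))) fun s hs => ?_
      have e : Real.exp (2 * s) * (2 * 1) * (-a s - c s₀ / 4)
          + Real.exp (2 * s) * -(b s - 2 * a s) = Real.exp (2 * s) * (-b s - c s₀ / 2) := by ring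
      rw [e]
      have := h.c_le s
      have := h.monotone_c hs
      exact mul_nonneg (Real.exp_pos _).le (by linarith)
    have ha : ∀ s, s₀ + 1 ≤ s → k + a s ≤ -1 := by
      intro s hs
      have h2 := h1 self_mem_Ici (by simp only [mem_Ici]; linarith) (by linarith : s₀ ≤ s)
      have h3 : 2 * Real.exp (2 * s₀) ≤ Real.exp (2 * s) := by
        calc 2 * Real.exp (2 * s₀) ≤ Real.exp 1 * Real.exp (2 * s₀) := by
              gcongr
              linarith [Real.add_one_le_exp (1 : ℝ)]
          _ ≤ Real.exp (2 * s) := by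
              rw [← Real.exp_add]
              exact Real.exp_le_exp.mpr (by linarith)
      have h4 := h.a_nonpos s₀
      have h5 := Real.exp_pos (2 * s₀)
      simp only at h2
      by_contra! hcon
      have h6 : Real.exp (2 * s) * (-a s - c s₀ / 4) < Real.exp (2 * s) * (-(c s₀ / 8)) :=
        mul_lt_mul_of_pos_left (by linarith) (Real.exp_pos _)
      have h7 : Real.exp (2 * s) * (-(c s₀ / 8)) ≤ 2 * Real.exp (2 * s₀) * (-(c s₀ / 8)) :=
        mul_le_mul_of_nonpos_right h3 (by linarith)
      have h8 : 0 ≤ Real.exp (2 * s₀) * -a s₀ := mul_nonneg h5.le (by linarith)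
      linarith
    have h2 : MonotoneOn (fun s => -(c s + e s)) (Ici (s₀ + 1)) := by
      refine monotoneOn_Ici_of_hasDerivAt (fun s _ =>
        ((h.deriv_c_three s).fun_add (h.deriv_e s)).fun_neg) fun s hs => ?_
      have := mul_le_mul_of_nonneg_right (ha s hs) (h.e_pos s).le
      linarith
    refine ⟨c (s₀ + 1) + e (s₀ + 1), fun s => ?_⟩
    rcases le_total s (s₀ + 1) with hs | hs
    · linarith [h.monotone_c hs, h.e_pos (s₀ + 1)]
    · have := h2 self_mem_Ici hs hs
      simp only at this
      linarith [h.e_pos s]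
  · push Not at hex
    exact ⟨_, fun s => (hex s).le⟩

/-- In dimension four the equation for `U + k s` has the conserved quantity
`v''' v' - v''² / 2 - 2 v'² - e^v`; comparing its values at both ends gives the total mass. -/
theorem tendsto_mass_four (h : IsLogSystem 3 k U a b c e) (hk : 0 < k) {C : ℝ} (hC : ∀ s, e s ≤ C)
    (ha : Tendsto a atBot (𝓝 0)) (hb : Tendsto b atBot (𝓝 0)) (hc : Tendsto c atBot (𝓝 0))
    (he : Tendsto e atBot (𝓝 0)) :
    Tendsto c atTop (𝓝 (8 * k)) ∧ Tendsto a atTop (𝓝 (-2 * k)) ∧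
      Tendsto (fun s => b s - 2 * a s) atTop (𝓝 0) := by
  obtain ⟨M', hM'⟩ := h.exists_c_le hk
  have hbdd : BddAbove (range c) := ⟨M', by rintro _ ⟨s, rfl⟩; exact hM' s⟩
  set M := ⨆ s, c s
  have lc : Tendsto c atTop (𝓝 M) := tendsto_atTop_ciSup h.monotone_c hbdd
  have hcM : ∀ s, c s ≤ M := fun s => le_ciSup hbdd s
  have hM0 : 0 < M := (h.c_pos 0).trans_le (hcM 0)
  have lb : Tendsto b atTop (𝓝 (-(M / 2))) := by
    have h1 : Tendsto (fun s => -(c s / 2)) atTop (𝓝 (-(M / 2))) := (lc.div_const 2).neg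
    refine tendsto_of_tendsto_of_tendsto_of_le_of_le tendsto_const_nhds h1 (fun s => ?_)
      fun s => ?_
    · have := h.neg_b_le (fun t (_ : s ≤ t) => hcM t) le_rfl
      simp only
      linarith
    · have := h.c_le s
      simp only
      linarith
  have la : Tendsto a atTop (𝓝 (-(M / 2) / 2)) :=
    tendsto_of_deriv_eq two_pos h.deriv_a_three lb
  have oe : e =O[atTop] fun _ => (1 : ℝ) := isBigO_one_of_forall_abs_le fun s _ => by
    rw [abs_of_pos (h.e_pos s)]; exact hC s
  have le : Tendsto e atTop (𝓝 0) := by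
    refine tendsto_deriv_zero_of_tendsto h.deriv_c_three h.deriv_e lc ?_
    have := ((la.const_add k).isBigO_one ℝ).mul oe
    simpa using this
  -- `a + k`, `b - 2 a` and `c + 4 a` are the first three derivatives of `U + k s`
  set E : ℝ → ℝ := fun s => (c s + 4 * a s) * (a s + k) - 1 / 2 * (b s - 2 * a s) ^ 2
    - 2 * (a s + k) ^ 2 - e s with hE
  have dE : ∀ s, HasDerivAt E 0 s := fun s => by
    have da := h.deriv_a_three s
    have dc := h.deriv_c_three s
    have dx := da.add_const k
    refine ((((dc.fun_add (da.const_mul 4)).fun_mul dx).fun_sub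
      ((((h.deriv_b s).fun_sub (da.const_mul 2)).fun_pow 2).const_mul (1 / 2))).fun_sub
      ((dx.fun_pow 2).const_mul 2) |>.fun_sub (h.deriv_e s)).congr_deriv ?_
    push_cast
    ring
  have hconst : ∀ s, E s = E 0 := fun s =>
    is_const_of_deriv_eq_zero (fun s => (dE s).differentiableAt) (fun s => (dE s).deriv) s 0
  have lim : ∀ {l : Filter ℝ} {a₀ b₀ c₀ : ℝ}, Tendsto a l (𝓝 a₀) → Tendsto b l (𝓝 b₀) →
      Tendsto c l (𝓝 c₀) → Tendsto e l (𝓝 0) → Tendsto E l (𝓝 ((c₀ + 4 * a₀) * (a₀ + k)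
        - 1 / 2 * (b₀ - 2 * a₀) ^ 2 - 2 * (a₀ + k) ^ 2 - 0)) := fun ha hb hc he =>
    ((((hc.add (ha.const_mul 4)).mul (ha.add_const k)).sub
      (((hb.sub (ha.const_mul 2)).pow 2).const_mul _)).sub
      (((ha.add_const k).pow 2).const_mul 2)).sub he
  have e1 : E 0 = _ := tendsto_nhds_unique
    (tendsto_const_nhds.congr fun s => (hconst s).symm) (lim ha hb hc he)
  have e2 : E 0 = _ := tendsto_nhds_unique
    (tendsto_const_nhds.congr fun s => (hconst s).symm) (lim la lb lc le)
  have hM : M = 8 * k := by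
    have h1 : M * (M - 8 * k) = 0 := by linear_combination 8 * e2 - 8 * e1
    rcases mul_eq_zero.mp h1 with h2 | h2
    · exact absurd h2 hM0.ne'
    · linarith
  refine ⟨hM ▸ lc, ?_, ?_⟩
  · convert la using 2
    rw [hM]
    ring
  · have := lb.sub (la.const_mul 2)
    convert this using 2
    ring

/-- Exponential decay of `e^U` and of the tail of the mass in dimension four. -/
theorem exists_decay_four (h : IsLogSystem 3 k U a b c e) (hk : 0 < k)
    (hc : Tendsto c atTop (𝓝 (8 * k))) (ha : Tendsto a atTop (𝓝 (-2 * k))) :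
    ∃ S K, ∀ s, S ≤ s → U s ≤ K - 3 / 2 * k * s ∧ 8 * k - c s ≤ 2 / k * e s := by
  obtain ⟨S, hS⟩ := eventually_atTop.mp
    (ha.eventually_le_const (by linarith : -2 * k < -(3 / 2 * k)))
  refine ⟨S, U S + 3 / 2 * k * S, fun s hs => ⟨?_, ?_⟩⟩
  · have h1 : MonotoneOn (fun s => -(U s + 3 / 2 * k * s)) (Ici S) :=
      monotoneOn_Ici_of_hasDerivAt (fun s _ => ((h.deriv_U s).fun_add
        ((hasDerivAt_id' s).const_mul (3 / 2 * k))).fun_neg) fun s hs => by linarith [hS s hs]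
    have := h1 self_mem_Ici hs hs
    simp only at this
    linarith
  · have h1 : MonotoneOn (fun s => -(c s + 2 / k * e s)) (Ici S) := by
      refine monotoneOn_Ici_of_hasDerivAt (fun s _ => ((h.deriv_c_three s).fun_add
        ((h.deriv_e s).const_mul (2 / k))).fun_neg) fun s hs => ?_
      have h2 := mul_le_mul_of_nonneg_right (by linarith [hS s hs] : k + a s ≤ -(k / 2))
        (h.e_pos s).le
      have h3 := mul_le_mul_of_nonneg_left h2 (by positivity : 0 ≤ 2 / k)
      have e3 : 2 / k * (-(k / 2) * e s) = -e s := by field_simp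
      linarith
    have h2 : 8 * k ≤ c s + 2 / k * e s := by
      refine le_of_tendsto hc ?_
      filter_upwards [eventually_ge_atTop s] with t ht
      have h3 := h1 (mem_Ici.mpr hs) (mem_Ici.mpr (hs.trans ht)) ht
      have h4 : 0 ≤ 2 / k * e t := mul_nonneg (by positivity) (h.e_pos t).le
      simp only at h3
      linarith
    linarith

end IsLogSystem

/-- Logarithmic behaviour in dimension four, with the integral in radial form. -/
theorem IsRadialSystem.tendsto_add_log_four {α β : ℝ} {u w q m : ℝ → ℝ} (hα : -2 < α)
    (h : IsRadialSystem 3 α β u w q m) (hw : Tendsto w atTop (𝓝 0)) :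
    IntegrableOn (fun r => r ^ 3 * (Real.exp (u r) * r ^ α * Real.log r)) (Ioi 0) ∧
      Tendsto (fun r => u r + (8 + 2 * α) * Real.log r) atTop
        (𝓝 (1 / 4 * ∫ r in Ioi 0, r ^ 3 * (Real.exp (u r) * r ^ α * Real.log r))) := by
  have hd : 2 ≤ 3 := by norm_num
  set k := 4 + α with hk
  have hk0 : 0 < k := by linarith
  have hL := h.isLogSystem hd hw
  norm_num only [Nat.cast_ofNat] at hL
  have lw : Tendsto (fun r => r ^ 2 * w r) (𝓝[>] 0) (𝓝 0) := by
    have h1 : Tendsto (fun r : ℝ => r ^ 2) (𝓝[>] 0) (𝓝 0) := by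
      have := (continuous_pow 2).tendsto (0 : ℝ)
      rw [zero_pow two_ne_zero] at this
      exact this.mono_left nhdsWithin_le_nhds
    simpa using h1.mul h.tendsto_w
  have lq : Tendsto (fun r => r * q r / r ^ 3) (𝓝[>] 0) (𝓝 0) := by
    obtain ⟨C, hC0, hC⟩ := h.source_w.exists_bound 1
    refine squeeze_zero_norm' (a := fun r => C * r ^ 2) ?_ ?_
    · filter_upwards [Ioc_mem_nhdsGT one_pos] with r hr
      have := IsRadialSource.abs_radialFlux_div_le hd (by norm_num) hC0 hC hr
      rw [zero_add, Real.rpow_one, ← h.q_eq hd hr.1] at this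
      rw [mul_div_assoc, norm_mul, Real.norm_of_nonneg hr.1.le, Real.norm_eq_abs]
      have := mul_le_mul_of_nonneg_left this hr.1.le
      linarith
    · have := ((continuous_pow 2).const_mul C).tendsto (0 : ℝ)
      simp only [ne_eq, OfNat.ofNat_ne_zero, not_false_eq_true, zero_pow, mul_zero] at this
      exact this.mono_left nhdsWithin_le_nhds
  have hmle : ∀ r, 0 < r → m r ≤ r ^ k / k := fun r hr => by
    rw [h.m_eq hd hα hr, show k = ((3 : ℕ) : ℝ) + α + 1 by rw [hk]; push_cast; ring,
      ← IsRadialSource.radialFlux_rpow hα hd hr]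
    refine (h.source_u.rpow_mul_exp α).radialFlux_mono hd hα (IsRadialSource.rpow α) hr
      fun t ht => ?_
    exact mul_le_of_le_one_right (Real.rpow_nonneg ht.1.le _)
      (Real.exp_le_one_iff.mpr (h.u_nonpos ht.1))
  have llog : Tendsto (fun r => Real.log r * m r) (𝓝[>] 0) (𝓝 0) := by
    have h1 := (tendsto_log_mul_rpow_nhdsGT_zero hk0).abs.div_const k
    rw [abs_zero, zero_div] at h1
    refine squeeze_zero_norm' (a := fun r => |Real.log r * r ^ k| / k) ?_ h1
    filter_upwards [self_mem_nhdsWithin] with r hr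
    have hr0 : 0 < r := hr
    rw [Real.norm_eq_abs, abs_mul, abs_mul, abs_of_pos (h.m_pos hr0),
      abs_of_pos (Real.rpow_pos_of_pos hr0 k), mul_div_assoc]
    exact mul_le_mul_of_nonneg_left (hmle r hr0) (abs_nonneg _)
  obtain ⟨C, -, hC⟩ := h.exists_rpow_mul_exp_le hd hα hw
  obtain ⟨tc, ta, tba⟩ := hL.tendsto_mass_four hk0 (C := C)
    (fun s => by
      have := hC (Real.exp s) (Real.exp_pos s)
      rwa [← Real.exp_mul, ← Real.exp_add, mul_comm s] at this)
    (lq.comp Real.tendsto_exp_atBot_nhdsGT) (lw.comp Real.tendsto_exp_atBot_nhdsGT)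
    (by
      refine (h.tendsto_m.comp Real.tendsto_exp_atBot_nhdsGT).congr fun s => ?_
      have := Real.exp_pos s
      simp only [Function.comp]
      field_simp)
    (by
      have h1 : Tendsto (fun s : ℝ => k * s) atBot atBot := tendsto_id.const_mul_atBot hk0
      have h2 := (Real.tendsto_exp_atBot.comp h1).mul ((Real.continuous_exp.tendsto _).comp
        (h.tendsto_u.comp Real.tendsto_exp_atBot_nhdsGT))
      rw [zero_mul] at h2
      exact h2.congr fun s => (Real.exp_add _ _).symm)
  obtain ⟨S, K, hSK⟩ := hL.exists_decay_four hk0 tc ta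
  have tcm : ∀ s, (fun r => r ^ 3 * m r / r ^ 3) (Real.exp s) = m (Real.exp s) := fun s => by
    have := Real.exp_pos s
    field_simp
  have hut : ∀ r, Real.exp S ≤ r → Real.exp (u r) ≤ Real.exp K * r ^ (-(3 / 2 * k)) := by
    intro r hr
    have hr0 : 0 < r := (Real.exp_pos S).trans_le hr
    have h1 := (hSK (Real.log r) ((Real.le_log_iff_exp_le hr0).mpr hr)).1
    rw [Real.exp_log hr0] at h1
    rw [Real.rpow_def_of_pos hr0, ← Real.exp_add]
    exact Real.exp_le_exp.mpr (by linarith)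
  -- near the origin `|r log r| ≤ 1` is used, at infinity `e^u = O(r^(-3k/2))` together with
  -- `log r = O(r^(k/4))`
  have hcont : ContinuousOn (fun r => r ^ 3 * (Real.exp (u r) * r ^ α * Real.log r)) (Ioi 0) := by
    refine (continuous_pow 3).continuousOn.mul (ContinuousOn.mul ?_ ?_)
    · exact h.continuousOn_rpow_mul_exp.congr fun t _ => mul_comm _ _
    · exact Real.continuousOn_log.mono fun t ht => (mem_Ioi.mp ht).ne'
  have hint : IntegrableOn (fun r => r ^ 3 * (Real.exp (u r) * r ^ α * Real.log r)) (Ioi 0) := by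
    rw [← Ioc_union_Ioi_eq_Ioi zero_le_one]
    refine IntegrableOn.union ?_ ?_
    · refine Integrable.mono' (g := fun _ => (1 : ℝ)) (integrableOn_const (by simp))
        ((hcont.mono Ioc_subset_Ioi_self).aestronglyMeasurable measurableSet_Ioc) ?_
      filter_upwards [self_mem_ae_restrict measurableSet_Ioc] with r hr
      have h1 : Real.exp (u r) ≤ 1 := Real.exp_le_one_iff.mpr (h.u_nonpos hr.1)
      have h2 := (Real.abs_log_mul_self_rpow_lt r 1 hr.1 hr.2 one_pos).le
      rw [Real.rpow_one, div_one] at h2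
      have h3 : r ^ (2 + α) ≤ 1 := Real.rpow_le_one hr.1.le hr.2 (by linarith)
      have e : r ^ 3 * (Real.exp (u r) * r ^ α * Real.log r)
          = r ^ (2 + α) * (Real.exp (u r) * (Real.log r * r)) := by
        rw [Real.rpow_add hr.1, Real.rpow_two]
        ring
      rw [e, norm_mul, norm_mul, Real.norm_of_nonneg (Real.rpow_nonneg hr.1.le _),
        Real.norm_of_nonneg (Real.exp_pos _).le, Real.norm_eq_abs]
      exact mul_le_one₀ h3 (by positivity) (mul_le_one₀ h1 (abs_nonneg _) h2)
    · rw [← integrableOn_Ici_iff_integrableOn_Ioi]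
      refine LocallyIntegrableOn.integrableOn_of_isBigO_atTop
        (g := fun r => r ^ (-1 - k / 4)) ((hcont.mono
          (Ici_subset_Ioi.mpr one_pos)).locallyIntegrableOn measurableSet_Ici) ?_
        ⟨Ioi 1, Ioi_mem_atTop 1, integrableOn_Ioi_rpow_of_lt (by linarith) one_pos⟩
      have o1 : (fun r => Real.exp (u r)) =O[atTop] fun r => r ^ (-(3 / 2 * k)) := by
        refine IsBigO.of_bound (Real.exp K) ?_
        filter_upwards [eventually_ge_atTop (Real.exp S)] with r hr
        rw [Real.norm_of_nonneg (Real.exp_pos _).le, Real.norm_of_nonneg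
          (Real.rpow_nonneg ((Real.exp_pos S).le.trans hr) _)]
        exact hut r hr
      have o2 : Real.log =O[atTop] fun r => r ^ (k / 4) :=
        (isLittleO_log_rpow_atTop (by positivity)).isBigO
      have o3 := (isBigO_refl (fun r : ℝ => r ^ (3 + α)) atTop).mul (o1.mul o2)
      refine o3.congr' ?_ ?_
      · filter_upwards [eventually_gt_atTop 0] with r hr
        rw [Real.rpow_add hr, show (3 : ℝ) = ((3 : ℕ) : ℝ) by norm_num, Real.rpow_natCast]
        ring
      · filter_upwards [eventually_gt_atTop 0] with r hr
        rw [← Real.rpow_add hr, ← Real.rpow_add hr]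
        congr 1
        rw [hk]
        ring
  refine ⟨hint, ?_⟩
  set g : ℝ → ℝ := fun r => r ^ 3 * (Real.exp (u r) * r ^ α * Real.log r)
  -- a primitive of the integrand; in the logarithmic variable it is `s c - (b - 2 a - 4 U)`,
  -- because `(b - 2 a - 4 U)' = c` and `c' = e`
  set G : ℝ → ℝ := fun r => Real.log r * m r - (r ^ 2 * w r - 2 * (r * q r / r ^ 3) - 4 * u r)
    with hG
  have dG : ∀ r, 0 < r → HasDerivAt G (g r) r := fun r hr => by
    refine (((Real.hasDerivAt_log hr.ne').fun_mul (h.deriv_m r hr)).fun_sub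
      ((((hasDerivAt_pow 2 r).fun_mul (h.deriv_w r hr)).fun_sub
      ((((hasDerivAt_id' r).fun_mul (h.deriv_q r hr)).fun_div (hasDerivAt_pow 3 r)
        (pow_pos hr 3).ne').const_mul 2)).fun_sub ((h.deriv_u r hr).const_mul 4))).congr_deriv ?_
    simp only [g]
    push_cast
    field_simp
    ring
  have lG : Tendsto G (𝓝[>] 0) (𝓝 0) := by
    have := llog.sub ((lw.sub (lq.const_mul 2)).sub (h.tendsto_u.const_mul 4))
    simpa using this
  have hGint : ∀ r, 0 < r → ∫ t in (0 : ℝ)..r, g t = G r := fun r hr => by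
    have := intervalIntegral.integral_eq_sub_of_hasDerivAt_of_tendsto hr
      (fun t ht => dG t ht.1) ((intervalIntegrable_iff_integrableOn_Ioc_of_le hr.le).mpr
        (hint.mono_set Ioc_subset_Ioi_self)) lG
      ((dG r hr).continuousAt.tendsto.mono_left nhdsWithin_le_nhds)
    rw [this, sub_zero]
  have tG : Tendsto G atTop (𝓝 (∫ r in Ioi 0, g r)) := by
    refine (intervalIntegral_tendsto_integral_Ioi 0 hint tendsto_id).congr' ?_
    filter_upwards [eventually_gt_atTop 0] with r hr using hGint r hr
  -- the tail of the mass, multiplied by the logarithm, vanishes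
  have tlog : Tendsto (fun s => s * (8 * k - m (Real.exp s))) atTop (𝓝 0) := by
    have h1 := (tendsto_rpow_mul_exp_neg_mul_atTop_nhds_zero 1 (k / 2) (by positivity)).const_mul
      (2 / k * Real.exp K)
    rw [mul_zero] at h1
    refine squeeze_zero' ?_ ?_ h1
    · filter_upwards [eventually_ge_atTop 0] with s hs
      have h2 : m (Real.exp s) ≤ 8 * k := (tcm s).ge.trans (hL.monotone_c.ge_of_tendsto tc s)
      exact mul_nonneg hs (by linarith)
    · filter_upwards [eventually_ge_atTop 0, eventually_ge_atTop S] with s hs hsS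
      have h2 := (hSK s hsS).1
      have h3 : 8 * k - m (Real.exp s) ≤ 2 / k * Real.exp (k * s + u (Real.exp s)) :=
        (sub_le_sub_left (tcm s).le _).trans (hSK s hsS).2
      have h5 : Real.exp (k * s + u (Real.exp s)) ≤ Real.exp K * Real.exp (-(k / 2) * s) := by
        rw [← Real.exp_add]
        exact Real.exp_le_exp.mpr (by linarith)
      rw [Real.rpow_one]
      calc s * (8 * k - m (Real.exp s))
          ≤ s * (2 / k * (Real.exp K * Real.exp (-(k / 2) * s))) := by
            refine mul_le_mul_of_nonneg_left (h3.trans ?_) hs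
            exact mul_le_mul_of_nonneg_left h5 (by positivity)
        _ = _ := by ring
  have tfin := (((tG.comp Real.tendsto_exp_atTop).add tlog).add tba).const_mul (1 / 4 : ℝ)
  rw [add_zero, add_zero] at tfin
  refine (tfin.comp Real.tendsto_log_atTop).congr' ?_
  filter_upwards [eventually_gt_atTop 0] with r hr
  simp only [Function.comp, Real.exp_log hr, hG]
  rw [hk]
  ring

/-! ### Dimension three -/

section Primitive

variable {g : ℝ → ℝ}

theorem hasDerivAt_primitive_Ioi (hg : ContinuousOn g (Ioi 0)) (hi : IntegrableOn g (Ioi 0)) {r : ℝ}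
    (hr : 0 < r) : HasDerivAt (fun r => ∫ t in (0 : ℝ)..r, g t) (g r) r :=
  intervalIntegral.integral_hasDerivAt_right
    ((intervalIntegrable_iff_integrableOn_Ioc_of_le hr.le).mpr (hi.mono_set Ioc_subset_Ioi_self))
    (hg.stronglyMeasurableAtFilter isOpen_Ioi r hr) (hg.continuousAt (Ioi_mem_nhds hr))

theorem tendsto_primitive_zero (hi : IntegrableOn g (Ioi 0)) :
    Tendsto (fun r => ∫ t in (0 : ℝ)..r, g t) (𝓝[>] 0) (𝓝 0) := by
  have h := intervalIntegral.continuousOn_primitive_interval'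
    ((intervalIntegrable_iff_integrableOn_Ioc_of_le zero_le_one).mpr
      (hi.mono_set Ioc_subset_Ioi_self)) left_mem_uIcc
  rw [uIcc_of_le zero_le_one] at h
  have h0 := (h 0 ⟨le_rfl, zero_le_one⟩).mono_left (nhdsWithin_mono 0 Ioo_subset_Icc_self)
  rw [nhdsWithin_Ioo_eq_nhdsGT zero_lt_one] at h0
  simp only [intervalIntegral.integral_same] at h0
  exact h0

end Primitive

namespace IsRadialSystem

variable {α β : ℝ} {u w q m : ℝ → ℝ}

theorem exists_linear_bound (h : IsRadialSystem 2 α β u w q m) (hw : Tendsto w atTop (𝓝 0)) :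
    ∃ c, 0 < c ∧ ∀ r, 0 < r → u r ≤ 2 * c - c * r := by
  have hd : 2 ≤ 2 := le_rfl
  have hm1 := h.m_pos one_pos
  have hwl : ∀ r, 1 ≤ r → r ^ 2 * w r ≤ -(m 1 * r) := by
    intro r hr
    have hr0 : 0 < r := by linarith
    have h1 := h.m_le hd hw hr0
    rw [div_le_iff₀ (pow_pos hr0 2)] at h1
    push_cast at h1
    have h2 := mul_le_mul_of_nonneg_right (h.monotoneOn_m (mem_Ioi.mpr one_pos) hr0 hr) hr0.le
    linarith
  have hq : ∀ r, 1 ≤ r → q r ≤ -(m 1 / 2 * (r ^ 2 - 1)) := by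
    intro r hr
    have h1 : MonotoneOn (fun r => -(q r + m 1 / 2 * r ^ 2)) (Ici 1) := by
      refine monotoneOn_Ici_of_hasDerivAt (fun s hs => ((h.deriv_q s (by linarith)).fun_add
        ((hasDerivAt_pow 2 s).const_mul (m 1 / 2))).fun_neg) fun s hs => ?_
      have := hwl s hs
      simp only [Nat.cast_ofNat, Nat.add_one_sub_one, pow_one]
      linarith
    have h2 := h1 self_mem_Ici hr hr
    have h3 := h.q_nonpos one_pos
    simp only at h2
    linarith
  refine ⟨m 1 / 4, by positivity, fun r hr => ?_⟩
  rcases le_total r 2 with h2 | h2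
  · have := mul_nonneg hm1.le (by linarith : 0 ≤ 2 - r)
    linarith [h.u_nonpos hr]
  · have h1 : MonotoneOn (fun r => -(u r + m 1 / 4 * r)) (Ici 2) := by
      refine monotoneOn_Ici_of_hasDerivAt (fun s hs => ((h.deriv_u s (by linarith)).fun_add
        ((hasDerivAt_id' s).const_mul (m 1 / 4))).fun_neg) fun s hs => ?_
      have hs0 : 0 < s ^ 2 := by positivity
      have h3 := hq s (by linarith)
      have h4 : q s / s ^ 2 ≤ -(m 1 / 4) := by
        rw [div_le_iff₀ hs0]
        have : 0 ≤ m 1 * (s ^ 2 - 2) := mul_nonneg hm1.le (by nlinarith)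
        linarith
      linarith
    have h3 := h1 self_mem_Ici h2 h2
    simp only at h3
    linarith [h.u_nonpos (two_pos)]

theorem continuousOn_pow_mul (h : IsRadialSystem 2 α β u w q m) (j : ℕ) :
    ContinuousOn (fun t => t ^ j * (t ^ α * Real.exp (u t))) (Ioi 0) :=
  (continuous_pow j).continuousOn.mul h.continuousOn_rpow_mul_exp

/-- The moments of `e^u` beyond radius `r` decay exponentially, even after multiplication by
`r²`. -/
theorem exists_tail_bound (hα : -2 < α) (h : IsRadialSystem 2 α β u w q m)
    (hw : Tendsto w atTop (𝓝 0)) :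
    (∀ j : ℕ, 1 ≤ j → IntegrableOn (fun t => t ^ j * (t ^ α * Real.exp (u t))) (Ioi 0)) ∧
      ∃ c, 0 < c ∧ ∃ K, ∀ j : ℕ, 1 ≤ j → j ≤ 4 → ∀ r, 1 ≤ r →
        r ^ 2 * ∫ t in Ioi r, t ^ j * (t ^ α * Real.exp (u t)) ≤ K * Real.exp (-c * r) := by
  obtain ⟨c, hc, hu⟩ := h.exists_linear_bound hw
  have hmod : ∀ j : ℕ, 1 ≤ j → ∀ {b : ℝ}, 0 < b →
      IntegrableOn (fun t : ℝ => t ^ j * (t ^ α * Real.exp (-b * t))) (Ioi 0) := by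
    intro j hj b hb
    have hj' : (1 : ℝ) ≤ j := by exact_mod_cast hj
    refine (integrableOn_rpow_mul_exp_neg_mul_rpow (s := j + α) (p := 1) (by linarith) one_pos
      hb).congr_fun (fun t ht => ?_) measurableSet_Ioi
    simp only
    rw [Real.rpow_one, Real.rpow_add ht, Real.rpow_natCast, mul_assoc]
  have hint : ∀ j : ℕ, 1 ≤ j →
      IntegrableOn (fun t => t ^ j * (t ^ α * Real.exp (u t))) (Ioi 0) := by
    intro j hj
    refine Integrable.mono' ((hmod j hj hc).const_mul (Real.exp (2 * c)))
      ((h.continuousOn_pow_mul j).aestronglyMeasurable measurableSet_Ioi) ?_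
    filter_upwards [self_mem_ae_restrict measurableSet_Ioi] with t ht
    have ht0 : 0 < t := ht
    have h1 : Real.exp (u t) ≤ Real.exp (2 * c) * Real.exp (-c * t) := by
      rw [← Real.exp_add]
      exact Real.exp_le_exp.mpr (by linarith [hu t ht0])
    have h2 := Real.rpow_nonneg ht0.le α
    rw [Real.norm_of_nonneg (by positivity)]
    calc t ^ j * (t ^ α * Real.exp (u t))
        ≤ t ^ j * (t ^ α * (Real.exp (2 * c) * Real.exp (-c * t))) := by gcongr
      _ = _ := by ring
  refine ⟨hint, c / 2, by positivity, ∫ t in Ioi (0 : ℝ), Real.exp (2 * c) *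
    (t ^ 6 * (t ^ α * Real.exp (-(c / 2) * t))), fun j hj hj4 r hr => ?_⟩
  have hr0 : 0 < r := by linarith
  have hi6 : IntegrableOn (fun t : ℝ => Real.exp (2 * c) *
      (t ^ 6 * (t ^ α * Real.exp (-(c / 2) * t)))) (Ioi 0) :=
    (hmod 6 (by norm_num) (half_pos hc)).const_mul (Real.exp (2 * c))
  have hsub : Ioi r ⊆ Ioi (0 : ℝ) := Ioi_subset_Ioi hr0.le
  rw [mul_comm _ (Real.exp (-(c / 2) * r)), ← div_le_iff₀' (Real.exp_pos _)]
  calc r ^ 2 * (∫ t in Ioi r, t ^ j * (t ^ α * Real.exp (u t))) / Real.exp (-(c / 2) * r)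
      = ∫ t in Ioi r, r ^ 2 / Real.exp (-(c / 2) * r) * (t ^ j * (t ^ α * Real.exp (u t))) := by
        rw [integral_const_mul]
        ring
    _ ≤ ∫ t in Ioi r, Real.exp (2 * c) * (t ^ 6 * (t ^ α * Real.exp (-(c / 2) * t))) := by
        refine setIntegral_mono_on (((hint j hj).mono_set hsub).const_mul _) (hi6.mono_set hsub)
          measurableSet_Ioi fun t ht => ?_
        have ht1 : r < t := ht
        have ht0 : 0 < t := hr0.trans ht1
        have h1 : Real.exp (u t) ≤ Real.exp (-(c / 2) * r) *
            (Real.exp (2 * c) * Real.exp (-(c / 2) * t)) := by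
          rw [← Real.exp_add, ← Real.exp_add]
          refine Real.exp_le_exp.mpr ?_
          have := mul_le_mul_of_nonneg_left ht1.le hc.le
          linarith [hu t ht0]
        have h2 : r ^ 2 * t ^ j ≤ t ^ 6 := by
          calc r ^ 2 * t ^ j ≤ t ^ 2 * t ^ 4 := by
                gcongr
                linarith
            _ = t ^ 6 := by ring
        have h3 := Real.rpow_nonneg ht0.le α
        have h4 := Real.exp_pos (-(c / 2) * r)
        rw [div_mul_eq_mul_div, div_le_iff₀ h4]
        calc r ^ 2 * (t ^ j * (t ^ α * Real.exp (u t)))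
            = (r ^ 2 * t ^ j) * (t ^ α * Real.exp (u t)) := by ring
          _ ≤ t ^ 6 * (t ^ α * (Real.exp (-(c / 2) * r) *
              (Real.exp (2 * c) * Real.exp (-(c / 2) * t)))) := by gcongr
          _ = _ := by ring
    _ ≤ _ := by
        refine setIntegral_mono_set hi6 ?_ hsub.eventuallyLE
        filter_upwards [self_mem_ae_restrict measurableSet_Ioi] with t ht
        have ht0 : 0 < t := ht
        have h3 := Real.rpow_nonneg ht0.le α
        positivity

/-- The expansion at infinity in dimension three, with the integrals in radial form. It is read
off from the representation of `u` by the Green kernel `(r - t)³ / (6 r t)` of the radial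
bilaplacian. -/
theorem expansion_three (hα : -2 < α) (h : IsRadialSystem 2 α β u w q m)
    (hw : Tendsto w atTop (𝓝 0)) :
    (∀ j : ℕ, 1 ≤ j → IntegrableOn (fun t => t ^ j * (t ^ α * Real.exp (u t))) (Ioi 0)) ∧
      ∃ c, 0 < c ∧ (fun r => u r - (-(1 / 2 * ∫ t in Ioi 0, t ^ 2 * (t ^ α * Real.exp (u t))) * r
        + 1 / 2 * (∫ t in Ioi 0, t ^ 3 * (t ^ α * Real.exp (u t)))
        + -(1 / 6 * ∫ t in Ioi 0, t ^ 4 * (t ^ α * Real.exp (u t))) * r⁻¹))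
        =O[atTop] fun r => Real.exp (-c * r) := by
  obtain ⟨hint, c, hc, K, hK⟩ := h.exists_tail_bound hα hw
  refine ⟨hint, c, hc, ?_⟩
  set g : ℝ → ℝ := fun t => t ^ α * Real.exp (u t) with hg
  set F : ℕ → ℝ → ℝ := fun j r => ∫ t in (0 : ℝ)..r, t ^ j * g t with hF
  set I : ℕ → ℝ := fun j => ∫ t in Ioi 0, t ^ j * g t with hI
  have dF : ∀ j, 1 ≤ j → ∀ r, 0 < r → HasDerivAt (F j) (r ^ j * g r) r := fun j hj r hr =>
    hasDerivAt_primitive_Ioi (h.continuousOn_pow_mul j) (hint j hj) hr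
  have F0 : ∀ j, 1 ≤ j → Tendsto (F j) (𝓝[>] 0) (𝓝 0) := fun j hj =>
    tendsto_primitive_zero (hint j hj)
  have FI : ∀ j, 1 ≤ j → Tendsto (F j) atTop (𝓝 (I j)) := fun j hj =>
    intervalIntegral_tendsto_integral_Ioi 0 (hint j hj) tendsto_id
  have hg0 : ∀ t, 0 < t → 0 ≤ g t := fun t ht =>
    mul_nonneg (Real.rpow_nonneg ht.le _) (Real.exp_pos _).le
  have hFn : ∀ j r, 0 < r → 0 ≤ F j r := fun j r hr => IsRadialSource.radialFlux_nonneg hg0 hr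
  have hFr : ∀ j, 1 ≤ j → ∀ r, 0 < r → F (j + 1) r ≤ r * F j r := by
    intro j hj r hr
    simp only [hF]
    rw [← intervalIntegral.integral_const_mul]
    have hii : ∀ j, 1 ≤ j → IntervalIntegrable (fun t => t ^ j * g t) volume 0 r := fun j hj =>
      (intervalIntegrable_iff_integrableOn_Ioc_of_le hr.le).mpr
        ((hint j hj).mono_set Ioc_subset_Ioi_self)
    refine intervalIntegral.integral_mono_on_of_le_Ioo hr.le (hii _ (by omega))
      ((hii j hj).const_mul r) fun t ht => ?_
    have := mul_le_mul_of_nonneg_right ht.2.le (mul_nonneg (pow_pos ht.1 j).le (hg0 t ht.1))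
    rw [pow_succ]
    linarith
  have hdiv : ∀ j, 1 ≤ j → Tendsto (fun r => F (j + 1) r / r) (𝓝[>] 0) (𝓝 0) := by
    intro j hj
    refine squeeze_zero' ?_ ?_ (F0 j hj)
    · filter_upwards [self_mem_nhdsWithin] with r hr using div_nonneg (hFn _ r hr) (le_of_lt hr)
    · filter_upwards [self_mem_nhdsWithin] with r hr
      rw [div_le_iff₀ hr, mul_comm]
      exact hFr j hj r hr
  have lpow : ∀ j : ℕ, j ≠ 0 → Tendsto (fun r : ℝ => r ^ j) (𝓝[>] 0) (𝓝 0) := fun j hj => by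
    have := (continuous_pow j).tendsto (0 : ℝ)
    rw [zero_pow hj] at this
    exact this.mono_left nhdsWithin_le_nhds
  have l1 : Tendsto (fun r : ℝ => r) (𝓝[>] 0) (𝓝 0) := by simpa using lpow 1 one_ne_zero
  -- the moments `F j` express all components of the system explicitly
  have hm : ∀ r, 0 < r → m r = F 2 r := fun r hr => h.m_eq le_rfl hα hr
  have hweq : ∀ r, 0 < r → w r = β + F 1 r - F 2 r / r := fun r hr => by
    refine eq_of_hasDerivAt_eq_of_tendsto (g := fun r => β + F 1 r - F 2 r / r) h.deriv_w
      (fun s hs => ?_) h.tendsto_w ?_ hr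
    · refine (((dF 1 le_rfl s hs).const_add β).fun_sub ((dF 2 (by norm_num) s hs).fun_div
        (hasDerivAt_id' s) hs.ne')).congr_deriv ?_
      rw [hm s hs]
      field_simp
      ring
    · simpa using ((F0 1 le_rfl).const_add β).sub (hdiv 1 le_rfl)
  have hqeq : ∀ r, 0 < r → q r = r ^ 3 * (β + F 1 r) / 3 - r ^ 2 * F 2 r / 2 + F 4 r / 6 :=
    fun r hr => by
      refine eq_of_hasDerivAt_eq_of_tendsto
        (g := fun r => r ^ 3 * (β + F 1 r) / 3 - r ^ 2 * F 2 r / 2 + F 4 r / 6) h.deriv_q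
        (fun s hs => ?_) h.tendsto_q ?_ hr
      · refine (((((hasDerivAt_pow 3 s).fun_mul ((dF 1 le_rfl s hs).const_add β)).div_const
          3).fun_sub (((hasDerivAt_pow 2 s).fun_mul (dF 2 (by norm_num) s hs)).div_const
          2)).fun_add ((dF 4 (by norm_num) s hs).div_const 6)).congr_deriv ?_
        rw [hweq s hs]
        push_cast
        field_simp
        ring
      · have := (((lpow 3 (by norm_num)).mul ((F0 1 le_rfl).const_add β)).div_const 3).sub
          (((lpow 2 (by norm_num)).mul (F0 2 (by norm_num))).div_const 2) |>.add
          ((F0 4 (by norm_num)).div_const 6)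
        simpa using this
  have hueq : ∀ r, 0 < r → u r = r ^ 2 * (β + F 1 r) / 6 + F 3 r / 2 - r * F 2 r / 2
      - F 4 r / r / 6 := fun r hr => by
    refine eq_of_hasDerivAt_eq_of_tendsto
      (g := fun r => r ^ 2 * (β + F 1 r) / 6 + F 3 r / 2 - r * F 2 r / 2 - F 4 r / r / 6)
      h.deriv_u (fun s hs => ?_) h.tendsto_u ?_ hr
    · refine ((((((hasDerivAt_pow 2 s).fun_mul ((dF 1 le_rfl s hs).const_add β)).div_const
        6).fun_add ((dF 3 (by norm_num) s hs).div_const 2)).fun_sub (((hasDerivAt_id' s).fun_mul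
        (dF 2 (by norm_num) s hs)).div_const 2)).fun_sub
        (((dF 4 (by norm_num) s hs).fun_div (hasDerivAt_id' s) hs.ne').div_const
        6)).congr_deriv ?_
      rw [hqeq s hs]
      push_cast
      field_simp
      ring
    · have := ((((lpow 2 (by norm_num)).mul ((F0 1 le_rfl).const_add β)).div_const 6).add
        ((F0 3 (by norm_num)).div_const 2)).sub ((l1.mul (F0 2 (by norm_num))).div_const 2) |>.sub
        ((hdiv 3 (by norm_num)).div_const 6)
      simpa using this
  have hβ : β = -I 1 := by
    have h1 : Tendsto (fun r => β + F 1 r - F 2 r / r) atTop (𝓝 (β + I 1 - 0)) :=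
      ((FI 1 le_rfl).const_add β).sub ((FI 2 (by norm_num)).div_atTop tendsto_id)
    have h2 := tendsto_nhds_unique (h1.congr' (by
      filter_upwards [eventually_gt_atTop 0] with r hr using (hweq r hr).symm)) hw
    linarith
  refine IsBigO.of_bound (4 * K) ?_
  filter_upwards [eventually_ge_atTop 1] with r hr
  have hr0 : 0 < r := by linarith
  set T : ℕ → ℝ := fun j => ∫ t in Ioi r, t ^ j * g t with hT
  have hIT : ∀ j, 1 ≤ j → I j = F j r + T j := fun j hj =>
    (intervalIntegral.integral_interval_add_Ioi (hint j hj)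
      ((hint j hj).mono_set (Ioi_subset_Ioi hr0.le))).symm
  have hT0 : ∀ j, 0 ≤ T j := fun j => setIntegral_nonneg measurableSet_Ioi fun t ht =>
    mul_nonneg (pow_pos (hr0.trans ht) j).le (hg0 t (hr0.trans ht))
  have hTK : ∀ j, 1 ≤ j → j ≤ 4 → r ^ 2 * T j ≤ K * Real.exp (-c * r) := fun j h1 h4 =>
    hK j h1 h4 r hr
  have hexp : u r - (-(1 / 2 * I 2) * r + 1 / 2 * I 3 + -(1 / 6 * I 4) * r⁻¹)
      = -(r ^ 2 * T 1) / 6 - T 3 / 2 + r * T 2 / 2 + T 4 / r / 6 := by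
    rw [hueq r hr0, hβ, hIT 1 le_rfl, hIT 2 (by norm_num), hIT 3 (by norm_num),
      hIT 4 (by norm_num)]
    field_simp
    ring
  change ‖u r - (-(1 / 2 * I 2) * r + 1 / 2 * I 3 + -(1 / 6 * I 4) * r⁻¹)‖ ≤ _
  rw [hexp, Real.norm_of_nonneg (Real.exp_pos _).le, Real.norm_eq_abs]
  have b1 := hTK 1 le_rfl (by norm_num)
  have b2 := hTK 2 (by norm_num) (by norm_num)
  have b3 := hTK 3 (by norm_num) (by norm_num)
  have b4 := hTK 4 (by norm_num) le_rfl
  have r2 : 1 ≤ r ^ 2 := one_le_pow₀ hr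
  have c1 : 0 ≤ r ^ 2 * T 1 := mul_nonneg (by positivity) (hT0 1)
  have c2 : r * T 2 ≤ r ^ 2 * T 2 := mul_le_mul_of_nonneg_right (by nlinarith) (hT0 2)
  have c2' : 0 ≤ r * T 2 := mul_nonneg hr0.le (hT0 2)
  have c3 : T 3 ≤ r ^ 2 * T 3 := le_mul_of_one_le_left (hT0 3) r2
  have c4 : T 4 / r ≤ r ^ 2 * T 4 := (div_le_self (hT0 4) hr).trans
    (le_mul_of_one_le_left (hT0 4) r2)
  have c4' : 0 ≤ T 4 / r := div_nonneg (hT0 4) hr0.le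
  have c3' := hT0 3
  rw [abs_le]
  constructor <;> linarith

end IsRadialSystem

/-! ### Polar coordinates -/

theorem volume_real_ball_four :
    volume.real (Metric.ball (0 : EuclideanSpace ℝ (Fin 4)) 1) = Real.pi ^ 2 / 2 := by
  rw [Measure.real, EuclideanSpace.volume_ball]
  have h1 : √Real.pi ^ 4 = Real.pi ^ 2 := by
    rw [show 4 = 2 * 2 by norm_num, pow_mul, Real.sq_sqrt Real.pi_pos.le]
  have h2 : Real.Gamma ((4 : ℕ) / 2 + 1) = 2 := by
    rw [show (((4 : ℕ) : ℝ) / 2 + 1) = ((2 : ℕ) : ℝ) + 1 by norm_num, Real.Gamma_nat_eq_factorial]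
    norm_num
  rw [Fintype.card_fin, h1, h2, ENNReal.ofReal_one, one_pow, one_mul, ENNReal.toReal_ofReal
    (by positivity)]

theorem volume_real_ball_three :
    volume.real (Metric.ball (0 : EuclideanSpace ℝ (Fin 3)) 1) = Real.pi * 4 / 3 := by
  rw [Measure.real, EuclideanSpace.volume_ball_fin_three]
  simp only [ENNReal.ofReal_one, one_pow, one_mul]
  exact ENNReal.toReal_ofReal (by positivity)

theorem integral_fun_norm_three (f : ℝ → ℝ) :
    ∫ x : EuclideanSpace ℝ (Fin 3), f ‖x‖ = 4 * Real.pi * ∫ r in Ioi 0, r ^ 2 * f r := by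
  rw [integral_fun_norm_addHaar, finrank_euclideanSpace_fin, volume_real_ball_three]
  simp only [smul_eq_mul, nsmul_eq_mul]
  push_cast
  ring

theorem integral_fun_norm_four (f : ℝ → ℝ) :
    ∫ x : EuclideanSpace ℝ (Fin 4), f ‖x‖ = 2 * Real.pi ^ 2 * ∫ r in Ioi 0, r ^ 3 * f r := by
  rw [integral_fun_norm_addHaar, finrank_euclideanSpace_fin, volume_real_ball_four]
  simp only [smul_eq_mul, nsmul_eq_mul]
  push_cast
  ring

/-- Moments of a radial function in `ℝ³` with a power weight, in polar coordinates. -/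
theorem integral_weight_three {α : ℝ} (u : ℝ → ℝ) (j : ℕ) :
    (IntegrableOn (fun t => t ^ (j + 2) * (t ^ α * Real.exp (u t))) (Ioi 0) →
      Integrable (fun x : EuclideanSpace ℝ (Fin 3) => ‖x‖ ^ (j + α) * Real.exp (u ‖x‖))) ∧
    ∫ x : EuclideanSpace ℝ (Fin 3), ‖x‖ ^ (j + α) * Real.exp (u ‖x‖)
      = 4 * Real.pi * ∫ t in Ioi 0, t ^ (j + 2) * (t ^ α * Real.exp (u t)) := by
  have e : ∀ t ∈ Ioi (0 : ℝ), t ^ (j + 2) * (t ^ α * Real.exp (u t))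
      = t ^ 2 * (t ^ (j + α) * Real.exp (u t)) := fun t ht => by
    rw [Real.rpow_add ht, Real.rpow_natCast]
    ring
  refine ⟨fun hi => ?_, ?_⟩
  · refine (integrable_fun_norm_addHaar volume
      (f := fun r : ℝ => r ^ (j + α) * Real.exp (u r))).mpr ?_
    rw [finrank_euclideanSpace_fin]
    exact hi.congr_fun e measurableSet_Ioi
  · rw [integral_fun_norm_three fun r : ℝ => r ^ (j + α) * Real.exp (u r),
      setIntegral_congr_fun measurableSet_Ioi e]

/-! ### The threshold and the separatrix -/

theorem theorem1p3 (N : ℕ) (hN : 3 ≤ N) (α : ℝ) (hα : -2 < α) :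
    ∃ β₀ : ℝ, β₀ < 0 ∧
      (∀ β : ℝ, (∃ u : ℝ → ℝ, IsEntireRadialSolution N α β u) ↔ β ≤ β₀) ∧
      ∀ u : ℝ → ℝ, IsEntireRadialSolution N α β₀ u →
        (N = 3 →
          Integrable (fun x : EuclideanSpace ℝ (Fin 3) => ‖x‖ ^ α * Real.exp (u ‖x‖)) ∧
          Integrable (fun x : EuclideanSpace ℝ (Fin 3) => ‖x‖ ^ (1 + α) * Real.exp (u ‖x‖)) ∧
          Integrable (fun x : EuclideanSpace ℝ (Fin 3) => ‖x‖ ^ (2 + α) * Real.exp (u ‖x‖)) ∧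
          ∃ c : ℝ, 0 < c ∧
            (fun r : ℝ => u r -
              (-(1 / (8 * Real.pi)) *
                  (∫ x : EuclideanSpace ℝ (Fin 3), ‖x‖ ^ α * Real.exp (u ‖x‖)) * r +
                1 / (8 * Real.pi) *
                  (∫ x : EuclideanSpace ℝ (Fin 3), ‖x‖ ^ (1 + α) * Real.exp (u ‖x‖)) +
                -(1 / (24 * Real.pi)) *
                  (∫ x : EuclideanSpace ℝ (Fin 3), ‖x‖ ^ (2 + α) * Real.exp (u ‖x‖)) * r⁻¹))
              =O[atTop] fun r : ℝ => Real.exp (-c * r)) ∧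
        (N = 4 →
          Integrable (fun x : EuclideanSpace ℝ (Fin 4) =>
            Real.exp (u ‖x‖) * ‖x‖ ^ α * Real.log ‖x‖) ∧
          Tendsto (fun r : ℝ => u r + (8 + 2 * α) * Real.log r) atTop
            (𝓝 (1 / (8 * Real.pi ^ 2) *
              ∫ x : EuclideanSpace ℝ (Fin 4),
                Real.exp (u ‖x‖) * ‖x‖ ^ α * Real.log ‖x‖))) ∧
        (5 ≤ N →
          Tendsto (fun r : ℝ => u r + (4 + α) * Real.log r) atTop
            (𝓝 (Real.log (2 * (4 + α) * ((N : ℝ) - 2) * ((N : ℝ) - 4))))) := by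
  obtain ⟨d, rfl⟩ : ∃ d, N = d + 1 := ⟨N - 1, by omega⟩
  have hd : 2 ≤ d := by omega
  obtain ⟨β₀, hβ₀, hiff, hlim⟩ := exists_threshold hd hα
  refine ⟨β₀, hβ₀, hiff, fun u hu => ?_⟩
  have h := hu.isRadialSystem hd
  have hw := hlim _ _ _ _ h
  have hpi : Real.pi ≠ 0 := Real.pi_ne_zero
  refine ⟨fun hN3 => ?_, fun hN4 => ?_, fun hN5 => ?_⟩
  · obtain rfl : d = 2 := by omega
    obtain ⟨hint, c, hc, hO⟩ := h.expansion_three hα hw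
    obtain ⟨i0, e0⟩ := integral_weight_three (α := α) u 0
    obtain ⟨i1, e1⟩ := integral_weight_three (α := α) u 1
    obtain ⟨i2, e2⟩ := integral_weight_three (α := α) u 2
    simp only [Nat.cast_zero, zero_add, Nat.cast_one, Nat.cast_ofNat] at i0 e0 i1 e1 i2 e2
    refine ⟨i0 (hint 2 (by norm_num)), i1 (hint 3 (by norm_num)), i2 (hint 4 (by norm_num)),
      c, hc, ?_⟩
    rw [e0, e1, e2]
    refine hO.congr_left fun r => ?_
    norm_num only
    field_simp
    ring
  · obtain rfl : d = 3 := by omega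
    obtain ⟨hint, ht⟩ := h.tendsto_add_log_four hα hw
    refine ⟨?_, ?_⟩
    · refine (integrable_fun_norm_addHaar volume
        (f := fun r : ℝ => Real.exp (u r) * r ^ α * Real.log r)).mpr ?_
      rw [finrank_euclideanSpace_fin]
      exact hint
    · rw [integral_fun_norm_four fun r : ℝ => Real.exp (u r) * r ^ α * Real.log r]
      convert ht using 2
      field_simp
      ring
  · have := h.tendsto_add_log (by omega) hα hw
    convert this using 4 <;> push_cast <;> ring
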